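/- **Setting.** For $u$ on $\mathbb R^2$ let $\partial_k\Delta^{-1}h(x)=\frac1{2\pi}\int_{\mathbb R^2}\frac{(x-y)_k}{|x-y|^2}h(y)\,dy$. For $u\in H^2(\mathbb R^2;\mathbb C)$ put $$A_1=\tfrac12\partial_2\Delta^{-1}|u|^2,\quad A_2=-\tfrac12\partial_1\Delta^{-1}|u|^2,\quad \mathbf D_k=\partial_k+iA_k,\quad A_0=\partial_1\Delta^{-1}j_2-\partial_2\Delta^{-1}j_1,\quad j_k=\tfrac i2\big(u\overline{\mathbf D_ku}-(\mathbf D_ku)\overline u\big).$$ Fix $g\in\mathbb C$. Let $I\subseteq\mathbb R$ be an open interval containing $0$ (for instance $(-T,T)$ with $0<T\le\infty$). An *$H^2$ solution of the Chern–Simons–Schrödinger system in the Coulomb gauge on $I$* is a $\phi\in C(I;H^2(\mathbb R^2))$ which, with $A_\mu=A_\mu(t)$ formed from $u=\phi(t)$, solves $$\partial_t\phi-i\Delta\phi=-iA_0\phi-2A_\ell\partial_\ell\phi-iA_\ell A_\ell\phi+ig|\phi|^2\phi\qquad\text{on } I.$$ Write $D=(\partial_1,\partial_2)$, $J_k=x_k+2it\partial_k$,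 $J=(J_1,J_2)$, $\widehat u(\xi)=(2\pi)^{-1}\int e^{-ix\cdot\xi}u(x)\,dx$. A superscript $(m)$ denotes $m$-fold application; norms of vectors and tensors are Euclidean; $\sigma\in\{+1,-1\}$ is a sign. For $B,\varepsilon_1>0$ assume that $\phi$ is such a solution, that $$\sum_{m=0}^2\|\mathbf D^{(m)}\phi(0)\|_{L^2}+\||x|\phi(0)\|_{L^2}+\||x|\mathbf D\phi(0)\|_{L^2}+\||x|^2\phi(0)\|_{L^2}\le\varepsilon_1,$$ and that for all $t\in I$ with $\sigma t\ge0$ $$\|\phi(t)\|_{L^\infty}\le B\varepsilon_1(1+|t|)^{-1},\qquad \|\phi(t)\|_{L^2}+\|D\phi(t)\|_{L^2}+\|D^{(2)}\phi(t)\|_{L^2}\le\tfrac{B}{100}\varepsilon_1,$$ $$\|J\phi(t)\|_{L^2}+\|JD\phi(t)\|_{L^2}\le\tfrac B{100}\varepsilon_1\log(2+|t|),\qquad\|J^{(2)}\phi(t)\|_{L^2}\le\tfrac B{100}\varepsilon_1(\log(2+|t|))^2.$$ **Proposition.** 1. There is a constant $C>0$ depending only on $g$ such that, for all $B,\varepsilon_1,I,\sigma,\phi$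 as above and all $t_1,t_2\in I$ with $0\le\sigma t_1\le\sigma t_2$, $$\big\|e^{it_2|\xi|^2}\widehat\phi(t_2,\xi)-e^{it_1|\xi|^2}\widehat\phi(t_1,\xi)\big\|_{L^\infty_\xi}\le C B^3\varepsilon_1^3(1+|t_1|)^{-1/10}.$$ If moreover $I$ contains all $t$ with $\sigma t\ge0$, there is $\widehat{f_{\sigma\infty}}\in L^\infty_\xi$ with $\big\|e^{it|\xi|^2}\widehat\phi(t)-\widehat{f_{\sigma\infty}}\big\|_{L^\infty_\xi}\le CB^3\varepsilon_1^3(1+|t|)^{-1/10}$ for all $\sigma t\ge0$; in particular $e^{it|\xi|^2}\widehat\phi(t)\to\widehat{f_{\sigma\infty}}$ in $L^\infty_\xi$ as $t\to\sigma\infty$. 2. For every $\delta>0$ there is $B_0>0$ such that for every $B\ge B_0$ there is $\varepsilon_0>0$ such that, whenever $0<\varepsilon_1\le\varepsilon_0$ and $I,\sigma,\phi$ are as above, $\|\widehat\phi(t)\|_{L^\infty_\xi}\le\delta B\varepsilon_1$ for all $t\in I$ with $\sigma t\ge0$. 3. There is $B_0>0$ such that for every $B\ge B_0$ there is $\varepsilon_0>0$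 such that, whenever $0<\varepsilon_1\le\varepsilon_0$ and $I,\sigma,\phi$ are as above, $\|\phi(t)\|_{L^\infty_x}\le\frac B{10}\varepsilon_1(1+|t|)^{-1}$ for all $t\in I$ with $\sigma t\ge0$. (In 2 and 3, $B_0$ may depend on $g$ and, in 2, on $\delta$; $\varepsilon_0$ may depend in addition on $B$.) -/

import Mathlib

open MeasureTheory Filter Topology
open scoped ENNReal SchwartzMap LineDeriv Laplacian FourierTransform ComplexConjugate

noncomputable section

namespace CSS

/-- The plane `ℝ²` with its Euclidean norm; the coordinates `x₁, x₂` are `x 0, x 1`. -/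
abbrev Plane : Type := EuclideanSpace ℝ (Fin 2)

/-- `L²(ℝ²; ℂ)`. -/
abbrev L2 : Type := Lp ℂ 2 (volume : Measure Plane)

/-- The standard basis vectors of the plane. -/
def e (k : Fin 2) : Plane := EuclideanSpace.single k 1

/-- The `L²` norm of a tempered distribution: the norm of the `L²` function representing it,
and `∞` if it is not represented by an `L²` function. -/
def l2Norm (T : 𝓢'(Plane, ℂ)) : ℝ≥0∞ :=
  ⨅ (u : L2) (_ : (u : 𝓢'(Plane, ℂ)) = T), ‖u‖ₑ

open Classical in
/-- The `L²` function representing a tempered distribution (`0` if there is none). -/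
def l2Rep (T : 𝓢'(Plane, ℂ)) : L2 :=
  if h : ∃ u : L2, (u : 𝓢'(Plane, ℂ)) = T then h.choose else 0

open Classical in
/-- The class in `L²` of a square-integrable function (`0` if it is not square-integrable). -/
def toL2 (f : Plane → ℂ) : L2 :=
  if h : MemLp f 2 volume then h.toLp f else 0

/-- The Euclidean length of a finite family of norms: if the `a i` are the `L²` norms of the
components of a vector (or tensor) field, this is the `L²` norm of that field. -/
def vecNorm {ι : Type} [Fintype ι] (a : ι → ℝ≥0∞) : ℝ≥0∞ :=
  (∑ i, a i ^ (2 : ℝ)) ^ (1 / 2 : ℝ)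

/-- `‖T‖_{L²} + ‖D T‖_{L²} + ‖D⁽²⁾ T‖_{L²}`, with distributional derivatives. -/
def h2Norm (T : 𝓢'(Plane, ℂ)) : ℝ≥0∞ :=
  l2Norm T + vecNorm (fun k : Fin 2 => l2Norm (∂_{e k} T))
    + vecNorm (fun p : Fin 2 × Fin 2 => l2Norm (∂_{e p.1} (∂_{e p.2} T)))

/-- The weak derivative `∂ₖ u`, as an `L²` function, of a function `u` that has one. -/
def partialL2 (k : Fin 2) (u : L2) : L2 := l2Rep (∂_{e k} (u : 𝓢'(Plane, ℂ)))

/-- The weak Laplacian of `u`, as an `L²` function, if it has one. -/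
def laplacianL2 (u : L2) : L2 := l2Rep (Δ (u : 𝓢'(Plane, ℂ)))

/-- `J_k = x_k + 2 i t ∂_k`, acting on tempered distributions. -/
def opJ (t : ℝ) (k : Fin 2) (T : 𝓢'(Plane, ℂ)) : 𝓢'(Plane, ℂ) :=
  TemperedDistribution.smulLeftCLM ℂ (fun x : Plane => ((x k : ℝ) : ℂ)) T
    + (2 * Complex.I * (t : ℂ)) • ∂_{e k} T

/-- `∂_k Δ⁻¹ h`, the convolution of `h` with the gradient of the Newtonian potential:
`(∂_k Δ⁻¹ h)(x) = (2π)⁻¹ ∫ (x - y)_k / |x - y|² h(y) dy`. -/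
def gradInvLaplacian (k : Fin 2) (h : Plane → ℝ) (x : Plane) : ℝ :=
  (2 * Real.pi)⁻¹ * ∫ y : Plane, (x - y) k / ‖x - y‖ ^ 2 * h y

/-- The spatial gauge potential in the Coulomb gauge, given by the Biot-Savart law:
`A₁ = ½ Δ⁻¹ ∂₂ |u|²` and `A₂ = -½ Δ⁻¹ ∂₁ |u|²`. -/
def gaugeA (u : L2) (j : Fin 2) (x : Plane) : ℝ :=
  if j = 0 then 1 / 2 * gradInvLaplacian 1 (fun y => ‖u y‖ ^ 2) x
  else -(1 / 2) * gradInvLaplacian 0 (fun y => ‖u y‖ ^ 2) x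

/-- The covariant derivative `𝐃_k v = ∂_k v + i A_k v`, a tempered distribution, for the
gauge potential `A` generated by `u`. -/
def covD (u : L2) (k : Fin 2) (v : L2) : 𝓢'(Plane, ℂ) :=
  ∂_{e k} (v : 𝓢'(Plane, ℂ))
    + (toL2 (fun x => Complex.I * (gaugeA u k x : ℂ) * v x) : 𝓢'(Plane, ℂ))

/-- The covariant derivative as an `L²` function, if it is one. -/
def covDL2 (u : L2) (k : Fin 2) (v : L2) : L2 := l2Rep (covD u k v)

/-- The current `(i/2) (u \overline{𝐃_k u} - (𝐃_k u) \overline{u}) = Im (\overline{u} 𝐃_k u)`. -/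
def current (u : L2) (k : Fin 2) (x : Plane) : ℝ :=
  (conj (u x) * covDL2 u k u x).im

/-- The temporal gauge potential `A₀ = Δ⁻¹ (∂₁ j₂ - ∂₂ j₁)`, where `j` is the current. -/
def gaugeA0 (u : L2) (x : Plane) : ℝ :=
  gradInvLaplacian 0 (current u 1) x - gradInvLaplacian 1 (current u 0) x

/-- The right-hand side of `∂ₜ φ - i Δ φ = - i A₀ φ - 2 A_ℓ ∂_ℓ φ - i A_ℓ A_ℓ φ + i g |φ|² φ`. -/
def nonlinearity (g : ℂ) (u : L2) (x : Plane) : ℂ :=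
  -Complex.I * (gaugeA0 u x : ℂ) * u x
    - 2 * ∑ l : Fin 2, (gaugeA u l x : ℂ) * partialL2 l u x
    - Complex.I * ∑ l : Fin 2, (gaugeA u l x : ℂ) ^ 2 * u x
    + Complex.I * g * ((‖u x‖ ^ 2 : ℝ) : ℂ) * u x

/-- `φ` is an `H²` solution of the Chern-Simons-Schrödinger system in the Coulomb gauge on the
open time interval `I` containing `0`: it belongs to `C(I; H²)` and solves the equation at each
time of `I`. For `φ ∈ C(I; H²)` the right-hand side lies in `C(I; L²)`, so that the time derivative
is a derivative in `L²`. -/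
structure IsH2Solution (g : ℂ) (I : Set ℝ) (φ : ℝ → L2) : Prop where
  isOpen : IsOpen I
  ordConnected : I.OrdConnected
  zero_mem : (0 : ℝ) ∈ I
  memH2 : ∀ t ∈ I, h2Norm (φ t : 𝓢'(Plane, ℂ)) < ∞
  continuousH2 : ∀ s ∈ I,
    Tendsto (fun t => h2Norm ((φ t - φ s : L2) : 𝓢'(Plane, ℂ))) (𝓝[I] s) (𝓝 0)
  equation : ∀ t ∈ I, ∃ d : L2, HasDerivAt φ d t ∧
    ∀ᵐ x : Plane, d x = Complex.I * laplacianL2 (φ t) x + nonlinearity g (φ t) x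

/-- The initial data bound
`∑_{m ≤ 2} ‖𝐃⁽ᵐ⁾ u‖ + ‖|x| u‖ + ‖|x| 𝐃 u‖ + ‖|x|² u‖ ≤ ε`, with all norms in `L²`. -/
def InitialBound (ε : ℝ) (u : L2) : Prop :=
  l2Norm (u : 𝓢'(Plane, ℂ))
    + vecNorm (fun k : Fin 2 => l2Norm (covD u k u))
    + vecNorm (fun p : Fin 2 × Fin 2 => l2Norm (covD u p.1 (covDL2 u p.2 u)))
    + eLpNorm (fun x : Plane => (‖x‖ : ℂ) * u x) 2 volume
    + vecNorm (fun k : Fin 2 => eLpNorm (fun x : Plane => (‖x‖ : ℂ) * covDL2 u k u x) 2 volume)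
    + eLpNorm (fun x : Plane => (‖x‖ ^ 2 : ℂ) * u x) 2 volume
    ≤ ENNReal.ofReal ε

/-- `‖u‖_{L^∞} ≤ K (1 + |t|)⁻¹`. -/
def DecayBound (K t : ℝ) (u : L2) : Prop :=
  eLpNorm u ∞ volume ≤ ENNReal.ofReal (K * (1 + |t|)⁻¹)

/-- The three gauge-dependent bounds at time `t`:
`‖u‖ + ‖D u‖ + ‖D⁽²⁾ u‖ ≤ K`, `‖J u‖ + ‖J D u‖ ≤ K log (2 + |t|)` and
`‖J⁽²⁾ u‖ ≤ K (log (2 + |t|))²`, with all norms in `L²`. -/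
structure GaugeBounds (K t : ℝ) (u : L2) : Prop where
  sobolev : h2Norm (u : 𝓢'(Plane, ℂ)) ≤ ENNReal.ofReal K
  weighted :
    vecNorm (fun k : Fin 2 => l2Norm (opJ t k (u : 𝓢'(Plane, ℂ))))
      + vecNorm (fun p : Fin 2 × Fin 2 => l2Norm (opJ t p.1 (∂_{e p.2} (u : 𝓢'(Plane, ℂ)))))
      ≤ ENNReal.ofReal (K * Real.log (2 + |t|))
  weighted_two :
    vecNorm (fun p : Fin 2 × Fin 2 => l2Norm (opJ t p.1 (opJ t p.2 (u : 𝓢'(Plane, ℂ)))))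
      ≤ ENNReal.ofReal (K * Real.log (2 + |t|) ^ 2)

/-- All assumptions on a solution, on the part `{t ∈ I : 0 ≤ σ t}` of the time interval lying on
the side of the sign `σ = ±1`. -/
structure Assumptions (g : ℂ) (B ε : ℝ) (I : Set ℝ) (σ : ℝ) (φ : ℝ → L2) : Prop where
  solution : IsH2Solution g I φ
  initial : InitialBound ε (φ 0)
  decay : ∀ t ∈ I, 0 ≤ σ * t → DecayBound (B * ε) t (φ t)
  gauge : ∀ t ∈ I, 0 ≤ σ * t → GaugeBounds (B / 100 * ε) t (φ t)

/-- The Fourier transform on `L²` with the normalization `(2π)⁻¹ ∫ e^{-i x·ξ} u(x) dx`.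
(Mathlib's `𝓕 u` extends `ξ ↦ ∫ e^{-2πi x·ξ} u(x) dx`.) -/
def fourier (u : L2) (ξ : Plane) : ℂ :=
  (((2 * Real.pi)⁻¹ : ℝ) : ℂ) * (𝓕 u : L2) ((2 * Real.pi)⁻¹ • ξ)

/-- `e^{i t |ξ|²} û(ξ)`. -/
def profile (t : ℝ) (u : L2) (ξ : Plane) : ℂ :=
  Complex.exp (Complex.I * ((t * ‖ξ‖ ^ 2 : ℝ) : ℂ)) * fourier u ξ

end CSS

end

open MeasureTheory Filter Topology
open scoped ENNReal SchwartzMap LineDeriv Laplacian FourierTransform ComplexConjugate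

noncomputable section

namespace CSS

/-! ### Estimates for the Riesz potential of order one in the plane -/

/-! The object to control is the profile `f(t) = e^{-itΔ} φ(t)`: its Fourier transform has the
modulus of that of `φ(t)`, and its time derivative contains only the nonlinearity. Everything rests
on one estimate, `enorm_integral_nonlinearity_le`: the nonlinearity of `u`, paired with `𝓕 G`, is at
most `|τ|^{-3/2} (K³ + K⁵) ∫ |G|` up to a constant, where `K` bounds `‖f‖ + ‖|y|² f‖` in `L²` for `f
= e^{-iτΔ} u`. Duality between `L¹` and `L^∞` turns the time integral of this bound into an `L^∞`
bound for differences of profiles.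

The estimate is proved in pseudoconformal variables. With `ρ = 4πτ`, the function `V(X) = iρ
e^{-4π²iτ|X|²} u(ρX)` is the Fourier transform of the chirped profile `e^{i|y|²/(4τ)} f(y)`
(`pseudoconf_eq`, `fourier_chirpMul_freeInvL2`). The operators `J_k` become derivatives, so the
weighted bounds on `f` are `H²` bounds on `V`. The nonlinearity is covariant under this transform
(`nl_psc`): the chirp adds a multiple of `x u` to the gradient, and the term `x · A` that this
produces in `A · ∇u` cancels the one that a rotational identity of the Biot–Savart kernel produces
in `A₀`.

In these variables the pairing with `𝓕 G` is a superposition, with weights of modulus `|G(ξ)|`, of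
the integrals of `e^{ic|X-ξ|²}` against the nonlinearity of `V`, where `c = 4π²τ`. An integration by
parts with the multiplier `(1 + 2ic|X-ξ|²)⁻¹` gains `|c|^{-1/2}` and costs one derivative of the
nonlinearity (`enorm_integral_phase_mul_le`). The scaling factors give the remaining `|τ|⁻¹`. The
bounds for the nonlocal terms use `V` in `L² ∩ L^∞` and its first two derivatives in `L²`, after
splitting the kernel `|z|⁻¹` into an integrable singularity and a bounded `L⁴` tail. All this is
done for Schwartz profiles, and density in the weighted space removes the restriction.

On a solution the estimate is applied with `τ = t + σ`, so that `|τ| = 1 + |t|` never degenerates.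
This is legitimate because the bound sees only `|G|`, which the free evolution preserves. As `K`
grows at most like `Bε (1+|t|)^{1/40}`, the profile varies after time `t₁` by at most a constant
times `((Bε)³ + (Bε)⁵)(1+|t₁|)^{-1/4}`. The first claim has no smallness assumption, so the quintic
term is absorbed only while `(Bε)² ≤ (1+|t|)^{3/20}`; at earlier times the crude bound `‖f‖_{L¹}` on
the profile is already cubic, and `ae_prof_sub_le_cube` joins the two regimes at the switching time.
Completeness then gives the limit.

The second claim compares the profile with its value at time `0`, which is bounded by `ε` without
the factor `B`. In the third, bounded times follow from Fourier inversion and the `H²` bound, and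
large times from `|u(ρX)| = |ρ|⁻¹ |V(X)|`, where `V` is close to `𝓕 f` because the chirp
`e^{i|y|²/(4τ)}` tends to `1`. -/

/-- The `L²` norm of an `ℝ≥0∞`-valued function. -/
def N2 (f : Plane → ℝ≥0∞) : ℝ≥0∞ := (∫⁻ x, f x ^ (2 : ℝ)) ^ (1 / 2 : ℝ)

lemma N2_mono {f g : Plane → ℝ≥0∞} (h : ∀ x, f x ≤ g x) : N2 f ≤ N2 g := by
  unfold N2
  gcongr with x
  exact h x

lemma N2_mono_ae {f g : Plane → ℝ≥0∞} (h : ∀ᵐ x, f x ≤ g x) : N2 f ≤ N2 g := by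
  unfold N2
  refine ENNReal.rpow_le_rpow (lintegral_mono_ae ?_) (by norm_num)
  filter_upwards [h] with x hx
  gcongr

lemma N2_const_mul (c : ℝ≥0∞) {f : Plane → ℝ≥0∞} (hf : Measurable f) :
    N2 (fun x => c * f x) = c * N2 f := by
  unfold N2
  simp_rw [ENNReal.mul_rpow_of_nonneg _ _ (zero_le_two : (0 : ℝ) ≤ 2)]
  rw [lintegral_const_mul _ (hf.pow_const _), ENNReal.mul_rpow_of_nonneg _ _ (by norm_num),
    ← ENNReal.rpow_mul]
  norm_num

lemma N2_add_le {f g : Plane → ℝ≥0∞} (hf : Measurable f) (hg : Measurable g) :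
    N2 (fun x => f x + g x) ≤ N2 f + N2 g :=
  ENNReal.lintegral_Lp_add_le hf.aemeasurable hg.aemeasurable one_le_two

lemma lintegral_mul_le_N2 {f g : Plane → ℝ≥0∞} (hf : Measurable f) (hg : Measurable g) :
    ∫⁻ x, f x * g x ≤ N2 f * N2 g :=
  ENNReal.lintegral_mul_le_Lp_mul_Lq volume Real.HolderConjugate.two_two hf.aemeasurable
    hg.aemeasurable

lemma N2_mul_le_sup {f g : Plane → ℝ≥0∞} {b : ℝ≥0∞} (hg : Measurable g) (h : ∀ x, f x ≤ b) :
    N2 (fun x => f x * g x) ≤ b * N2 g := by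
  rw [← N2_const_mul b hg]
  exact N2_mono fun x => by gcongr; exact h x

/-- Cauchy–Schwarz applied to the squares. The square root of the `N2` norm of a square is the `L⁴`
norm, so this is Hölder from `L⁴ × L⁴` to `L²`. -/
lemma N2_mul_le {f g : Plane → ℝ≥0∞} (hf : Measurable f) (hg : Measurable g) :
    N2 (fun x => f x * g x) ≤
      (N2 fun x => f x ^ (2 : ℝ)) ^ (1 / 2 : ℝ) * (N2 fun x => g x ^ (2 : ℝ)) ^ (1 / 2 : ℝ) := by
  rw [← ENNReal.mul_rpow_of_nonneg _ _ (by norm_num)]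
  refine ENNReal.rpow_le_rpow ?_ (by norm_num)
  simp_rw [ENNReal.mul_rpow_of_nonneg _ _ (zero_le_two : (0 : ℝ) ≤ 2)]
  exact lintegral_mul_le_N2 (hf.pow_const _) (hg.pow_const _)

lemma N2_comp_sub_right (f : Plane → ℝ≥0∞) (a : Plane) : N2 (fun x => f (x - a)) = N2 f := by
  unfold N2
  rw [lintegral_sub_right_eq_self (fun x => f x ^ (2 : ℝ)) a]

lemma N2_enorm (f : Plane → ℂ) : N2 (fun x => ‖f x‖ₑ) = eLpNorm f 2 volume := by
  rw [eLpNorm_eq_lintegral_rpow_enorm_toReal two_ne_zero ENNReal.ofNat_ne_top]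
  simp [N2]

/-- The Riesz potential `∫ |x - y|⁻¹ h(y) dy`. -/
def riesz (h : Plane → ℝ≥0∞) (x : Plane) : ℝ≥0∞ := ∫⁻ y, ‖x - y‖ₑ⁻¹ * h y

/-- The singular part of the kernel `|z|⁻¹`. -/
def nearK : Plane → ℝ≥0∞ := (Metric.ball (0 : Plane) 1).indicator fun z => ‖z‖ₑ⁻¹

/-- The part of the kernel `|z|⁻¹` at infinity. -/
def farK : Plane → ℝ≥0∞ := (Metric.ball (0 : Plane) 1)ᶜ.indicator fun z => ‖z‖ₑ⁻¹

lemma measurable_nearK : Measurable nearK :=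
  (measurable_enorm.inv).indicator measurableSet_ball

lemma measurable_farK : Measurable farK :=
  (measurable_enorm.inv).indicator measurableSet_ball.compl

lemma nearK_add_farK (z : Plane) : nearK z + farK z = ‖z‖ₑ⁻¹ :=
  Set.indicator_self_add_compl_apply _ _ _

lemma farK_le_one (z : Plane) : farK z ≤ 1 := by
  refine Set.indicator_apply_le' (fun h => ?_) fun _ => zero_le
  rw [Set.mem_compl_iff, mem_ball_zero_iff, not_lt] at h
  rw [ENNReal.inv_le_one, ← ofReal_norm]
  exact ENNReal.one_le_ofReal.mpr h

lemma lintegral_nearK_lt_top : ∫⁻ z, nearK z < ∞ := by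
  have h : IntegrableOn (fun z : Plane => ‖z‖⁻¹) (Metric.ball 0 1) :=
    integrableOn_ball_of_norm_le_rpow (C := 1) (α := 1) (by simp) (by simp)
      (Eventually.of_forall fun x => by simp [Real.rpow_neg_one])
      (measurable_norm.inv).aestronglyMeasurable
  rw [nearK, lintegral_indicator measurableSet_ball]
  refine lt_of_le_of_lt (lintegral_mono_ae ?_) h.2
  have h0 : ∀ᵐ z : Plane ∂(volume.restrict (Metric.ball 0 1)), z ≠ 0 :=
    ae_restrict_of_ae (Measure.ae_ne volume 0)
  filter_upwards [h0] with z hz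
  rw [enorm_inv (norm_ne_zero_iff.mpr hz), enorm_norm]

/-- In the plane `|z|⁻¹` is not square-integrable at infinity, but its fourth power is integrable
there; hence the use of `L⁴` for everything paired with the far part. The factor `16` is `2⁴`, from
`1 + |z| ≤ 2|z|` off the unit ball. -/
lemma N2_farK_sq_lt_top : N2 (fun z => farK z ^ (2 : ℝ)) < ∞ := by
  unfold N2
  refine ENNReal.rpow_lt_top_of_nonneg (by norm_num) (ne_of_lt ?_)
  have h := finite_integral_one_add_norm (E := Plane) (μ := volume) (r := 4) (by simp; norm_num)
  refine lt_of_le_of_lt (lintegral_mono fun z => ?_)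
    (lt_of_eq_of_lt (lintegral_const_mul (16 : ℝ≥0∞) (by fun_prop))
      (ENNReal.mul_lt_top (by norm_num) h))
  by_cases hz : z ∈ (Metric.ball (0 : Plane) 1)ᶜ
  · simp only [farK, Set.indicator_of_mem hz]
    rw [Set.mem_compl_iff, mem_ball_zero_iff, not_lt] at hz
    have h0 : 0 < ‖z‖ := by linarith
    rw [← ENNReal.rpow_mul, ← ofReal_norm, ← ENNReal.ofReal_inv_of_pos h0,
      ENNReal.ofReal_rpow_of_pos (by positivity),
      show (16 : ℝ≥0∞) = ENNReal.ofReal 16 by norm_num, ← ENNReal.ofReal_mul (by norm_num)]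
    refine ENNReal.ofReal_le_ofReal ?_
    rw [Real.rpow_neg (by positivity), show (2 * 2 : ℝ) = ((4 : ℕ) : ℝ) by norm_num,
      show (4 : ℝ) = ((4 : ℕ) : ℝ) by norm_num, Real.rpow_natCast, Real.rpow_natCast, inv_pow,
      ← div_eq_mul_inv, inv_eq_one_div, div_le_div_iff₀ (by positivity) (by positivity), one_mul]
    calc (1 + ‖z‖) ^ 4 ≤ (2 * ‖z‖) ^ 4 := by gcongr; linarith
      _ = 16 * ‖z‖ ^ 4 := by ring
  · simp [farK, Set.indicator_of_notMem hz]

/-- A constant controlling both parts of the kernel. -/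
def kerConst : ℝ≥0∞ := (∫⁻ z, nearK z) + (N2 fun z => farK z ^ (2 : ℝ)) ^ (1 / 2 : ℝ) + 1

lemma kerConst_lt_top : kerConst < ∞ := by
  simp only [kerConst, ENNReal.add_lt_top, lintegral_nearK_lt_top, ENNReal.one_lt_top, and_true,
    true_and]
  exact ENNReal.rpow_lt_top_of_nonneg (by norm_num) N2_farK_sq_lt_top.ne

lemma lintegral_nearK_le : ∫⁻ z, nearK z ≤ kerConst := by
  rw [kerConst, add_assoc]
  exact le_self_add

lemma rpow_N2_farK_le : (N2 fun z => farK z ^ (2 : ℝ)) ^ (1 / 2 : ℝ) ≤ kerConst := by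
  rw [kerConst, add_right_comm]
  exact le_add_self

lemma one_le_kerConst : 1 ≤ kerConst := le_add_self

lemma measurable_riesz {h : Plane → ℝ≥0∞} (hh : Measurable h) : Measurable (riesz h) := by
  unfold riesz
  exact Measurable.lintegral_prod_right' (f := fun p : Plane × Plane => ‖p.1 - p.2‖ₑ⁻¹ * h p.2)
    (by fun_prop)

lemma riesz_mono {h h' : Plane → ℝ≥0∞} (hh : ∀ x, h x ≤ h' x) (x : Plane) :
    riesz h x ≤ riesz h' x := by
  unfold riesz
  gcongr with y
  exact hh y

lemma riesz_split {h : Plane → ℝ≥0∞} (hh : Measurable h) (x : Plane) :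
    riesz h x = (∫⁻ z, nearK z * h (x - z)) + ∫⁻ y, farK (x - y) * h y := by
  unfold riesz
  have hn := measurable_nearK
  have hf := measurable_farK
  simp_rw [← nearK_add_farK, add_mul]
  rw [lintegral_add_left (by fun_prop)]
  congr 1
  rw [← lintegral_sub_left_eq_self (fun y => nearK (x - y) * h y) x]
  simp

/-- The integrable near part is paired with the sup of `h`, and the far part, which is at most `1`,
with its integral. -/
lemma riesz_le {h : Plane → ℝ≥0∞} (hh : Measurable h) {b : ℝ≥0∞} (hb : ∀ x, h x ≤ b) (x : Plane) :
    riesz h x ≤ kerConst * (b + ∫⁻ y, h y) := by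
  rw [riesz_split hh, mul_add]
  gcongr
  · calc ∫⁻ z, nearK z * h (x - z) ≤ ∫⁻ z, nearK z * b := by gcongr; exact hb _
      _ = (∫⁻ z, nearK z) * b := lintegral_mul_const _ measurable_nearK
      _ ≤ kerConst * b := by gcongr; exact lintegral_nearK_le
  · calc ∫⁻ y, farK (x - y) * h y ≤ ∫⁻ y, 1 * h y := by gcongr; exact farK_le_one _
      _ = 1 * ∫⁻ y, h y := by simp
      _ ≤ _ := by gcongr; exact one_le_kerConst

lemma lintegral_mul_riesz_comm {f h : Plane → ℝ≥0∞} (hf : Measurable f) (hh : Measurable h) :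
    ∫⁻ x, f x * riesz h x = ∫⁻ y, h y * riesz f y := by
  unfold riesz
  have h1 : ∀ x, f x * ∫⁻ y, ‖x - y‖ₑ⁻¹ * h y = ∫⁻ y, f x * (‖x - y‖ₑ⁻¹ * h y) := fun x =>
    (lintegral_const_mul _ (by fun_prop)).symm
  have h2 : ∀ y, h y * ∫⁻ x, ‖y - x‖ₑ⁻¹ * f x = ∫⁻ x, h y * (‖y - x‖ₑ⁻¹ * f x) := fun x =>
    (lintegral_const_mul _ (by fun_prop)).symm
  simp_rw [h1, h2]
  rw [lintegral_lintegral_swap (by fun_prop)]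
  refine lintegral_congr fun y => lintegral_congr fun x => ?_
  rw [← enorm_neg, neg_sub]
  ring

/-- The near part of the potential is an average of translates of `h` with integrable weight, so a
bound for the pairing of `f` with `h` that is uniform in the translation suffices. -/
lemma lintegral_mul_near_le {f h : Plane → ℝ≥0∞} (hf : Measurable f) (hh : Measurable h)
    {b : ℝ≥0∞} (hb : ∀ z, ∫⁻ x, f x * h (x - z) ≤ b) :
    ∫⁻ x, f x * ∫⁻ z, nearK z * h (x - z) ≤ kerConst * b := by
  have hn := measurable_nearK
  have h1 : ∀ x, f x * ∫⁻ z, nearK z * h (x - z) = ∫⁻ z, f x * (nearK z * h (x - z)) := fun x =>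
    (lintegral_const_mul _ (by fun_prop)).symm
  simp_rw [h1]
  rw [lintegral_lintegral_swap (by fun_prop)]
  calc ∫⁻ z, ∫⁻ x, f x * (nearK z * h (x - z)) = ∫⁻ z, nearK z * ∫⁻ x, f x * h (x - z) := by
        refine lintegral_congr fun z => ?_
        rw [← lintegral_const_mul _ (by fun_prop)]
        refine lintegral_congr fun x => ?_
        ring
    _ ≤ ∫⁻ z, nearK z * b := by gcongr; exact hb _
    _ = (∫⁻ z, nearK z) * b := lintegral_mul_const _ measurable_nearK
    _ ≤ kerConst * b := by gcongr; exact lintegral_nearK_le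

/-- By Fubini the kernel is moved onto `f`, so that nothing beyond the `L¹` norm of `h` is needed.
-/
lemma lintegral_mul_far_le {f h : Plane → ℝ≥0∞} (hf : Measurable f) (hh : Measurable h)
    {b : ℝ≥0∞} (hb : ∀ y, ∫⁻ x, f x * farK (x - y) ≤ b) :
    ∫⁻ x, f x * ∫⁻ y, farK (x - y) * h y ≤ b * ∫⁻ y, h y := by
  have hn := measurable_farK
  have h1 : ∀ x, f x * ∫⁻ y, farK (x - y) * h y = ∫⁻ y, f x * (farK (x - y) * h y) := fun x =>
    (lintegral_const_mul _ (by fun_prop)).symm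
  simp_rw [h1]
  rw [lintegral_lintegral_swap (by fun_prop), ← lintegral_const_mul _ hh]
  refine lintegral_mono fun y => ?_
  simp_rw [← mul_assoc]
  rw [lintegral_mul_const _ (by fun_prop)]
  gcongr
  exact hb y

lemma lintegral_mul_riesz_split {f h : Plane → ℝ≥0∞} (hf : Measurable f) (hh : Measurable h) :
    ∫⁻ x, f x * riesz h x =
      (∫⁻ x, f x * ∫⁻ z, nearK z * h (x - z)) + ∫⁻ x, f x * ∫⁻ y, farK (x - y) * h y := by
  have hn := measurable_nearK
  rw [← lintegral_add_left]
  · simp_rw [← mul_add, ← riesz_split hh]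
  · exact hf.mul (Measurable.lintegral_prod_right'
      (f := fun p : Plane × Plane => nearK p.2 * h (p.1 - p.2)) (by fun_prop))

/-- A nonnegative weight of size `η` in `L^∞` and in `L⁴`. -/
structure IsWeight (W : Plane → ℝ≥0∞) (η : ℝ≥0∞) : Prop where
  measurable : Measurable W
  le_sup : ∀ x, W x ≤ η
  le_four : (N2 fun x => W x ^ (2 : ℝ)) ^ (1 / 2 : ℝ) ≤ η

/-- Hölder with exponents `4, 4, 2` for the weight, the far kernel and `f`. -/
lemma lintegral_weight_far_le {W f : Plane → ℝ≥0∞} {η : ℝ≥0∞} (hW : IsWeight W η)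
    (hf : Measurable f) (y : Plane) :
    ∫⁻ x, (W x * f x) * farK (x - y) ≤ kerConst * η * N2 f := by
  have hk := measurable_farK
  have hWm := hW.measurable
  calc ∫⁻ x, (W x * f x) * farK (x - y) = ∫⁻ x, (W x * farK (x - y)) * f x := by
        refine lintegral_congr fun x => ?_
        ring
    _ ≤ N2 (fun x => W x * farK (x - y)) * N2 f := lintegral_mul_le_N2 (by fun_prop) hf
    _ ≤ (kerConst * η) * N2 f := by
      gcongr
      refine (N2_mul_le hWm (by fun_prop)).trans ?_
      rw [mul_comm kerConst]
      gcongr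
      · exact hW.le_four
      · rw [N2_comp_sub_right (fun z => farK z ^ (2 : ℝ)) y]
        exact rpow_N2_farK_le

/-- For `h` in `L¹ ∩ L²` the potential need not be bounded, so the product is estimated as a whole:
Cauchy–Schwarz between `f` and a translate of `h` near the singularity, the `L⁴` norm of the weight
far from it. -/
lemma lintegral_weight_mul_riesz_le {W f h : Plane → ℝ≥0∞} {η : ℝ≥0∞} (hW : IsWeight W η)
    (hf : Measurable f) (hh : Measurable h) :
    ∫⁻ x, W x * f x * riesz h x ≤ kerConst * η * N2 f * (N2 h + ∫⁻ y, h y) := by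
  have hWm := hW.measurable
  rw [lintegral_mul_riesz_split (f := fun x => W x * f x) (hWm.mul hf) hh, mul_add]
  gcongr
  · rw [mul_assoc, mul_assoc]
    refine lintegral_mul_near_le (hWm.mul hf) hh fun z => ?_
    calc ∫⁻ x, W x * f x * h (x - z) ≤ ∫⁻ x, η * (f x * h (x - z)) := by
          refine lintegral_mono fun x => ?_
          rw [mul_assoc]
          gcongr
          exact hW.le_sup x
      _ = η * ∫⁻ x, f x * h (x - z) := lintegral_const_mul _ (by fun_prop)
      _ ≤ η * (N2 f * N2 h) := by
        gcongr
        rw [← N2_comp_sub_right h z]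
        exact lintegral_mul_le_N2 hf (by fun_prop)
  · exact lintegral_mul_far_le (hWm.mul hf) hh (lintegral_weight_far_le hW hf)

/-- The variant for `h` that is merely integrable, as is the gradient of the current, which contains
products of two first derivatives. The missing `L²` norm of `h` is compensated by the sup of `f`. -/
lemma lintegral_weight_mul_riesz_le_of_bdd {W f h : Plane → ℝ≥0∞} {η b : ℝ≥0∞}
    (hW : IsWeight W η) (hf : Measurable f) (hb : ∀ x, f x ≤ b) (hh : Measurable h) :
    ∫⁻ x, W x * f x * riesz h x ≤ kerConst * η * (b + N2 f) * ∫⁻ y, h y := by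
  have hWm := hW.measurable
  rw [lintegral_mul_riesz_split (f := fun x => W x * f x) (hWm.mul hf) hh, mul_add, add_mul]
  gcongr
  · rw [mul_assoc, mul_assoc]
    refine lintegral_mul_near_le (hWm.mul hf) hh fun z => ?_
    calc ∫⁻ x, W x * f x * h (x - z) ≤ ∫⁻ x, (η * b) * h (x - z) := by
          gcongr with x
          · exact hW.le_sup x
          · exact hb x
      _ = η * b * ∫⁻ x, h (x - z) := lintegral_const_mul _ (by fun_prop)
      _ = η * (b * ∫⁻ y, h y) := by rw [lintegral_sub_right_eq_self h z, mul_assoc]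
  · exact lintegral_mul_far_le (hWm.mul hf) hh (lintegral_weight_far_le hW hf)

/-- The variant in which the multiplier `Q` is controlled only in `L²`; here `f` supplies the
boundedness near the singularity. -/
lemma lintegral_L2_mul_riesz_le {Q f h : Plane → ℝ≥0∞} {b : ℝ≥0∞} (hQ : Measurable Q)
    (hf : Measurable f) (hb : ∀ x, f x ≤ b) (hh : Measurable h) :
    ∫⁻ x, Q x * f x * riesz h x ≤ kerConst * N2 Q * (b * N2 h + N2 f * ∫⁻ y, h y) := by
  rw [lintegral_mul_riesz_split (f := fun x => Q x * f x) (hQ.mul hf) hh, mul_add]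
  have hk := measurable_farK
  gcongr
  · rw [mul_assoc]
    refine lintegral_mul_near_le (hQ.mul hf) hh fun z => ?_
    calc ∫⁻ x, Q x * f x * h (x - z) ≤ ∫⁻ x, b * (Q x * h (x - z)) := by
          refine lintegral_mono fun x => ?_
          rw [mul_comm (Q x), mul_assoc]
          gcongr
          exact hb x
      _ = b * ∫⁻ x, Q x * h (x - z) := lintegral_const_mul _ (by fun_prop)
      _ ≤ b * (N2 Q * N2 h) := by
        gcongr
        rw [← N2_comp_sub_right h z]
        exact lintegral_mul_le_N2 hQ (by fun_prop)
      _ = N2 Q * (b * N2 h) := by ring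
  · rw [← mul_assoc]
    refine lintegral_mul_far_le (hQ.mul hf) hh fun y => ?_
    calc ∫⁻ x, Q x * f x * farK (x - y) ≤ ∫⁻ x, Q x * f x * 1 := by gcongr; exact farK_le_one _
      _ ≤ N2 Q * N2 f := by simpa using lintegral_mul_le_N2 hQ hf
      _ ≤ kerConst * N2 Q * N2 f := by
        rw [mul_assoc]
        exact le_mul_of_one_le_left zero_le one_le_kerConst


/-! ### Pointwise bounds for functions and their derivatives -/

section CBound

lemma enorm_add_le_add {F : Type*} [NormedAddCommGroup F] {a b : F} {u v : ℝ≥0∞} (ha : ‖a‖ₑ ≤ u)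
    (hb : ‖b‖ₑ ≤ v) : ‖a + b‖ₑ ≤ u + v :=
  (enorm_add_le a b).trans (add_le_add ha hb)

lemma enorm_mul_le_mul {𝔸 : Type*} [NormedRing 𝔸] {a b : 𝔸} {u v : ℝ≥0∞} (ha : ‖a‖ₑ ≤ u)
    (hb : ‖b‖ₑ ≤ v) : ‖a * b‖ₑ ≤ u * v := by
  refine le_trans ?_ (mul_le_mul' ha hb)
  simp only [enorm_eq_nnnorm]
  exact_mod_cast nnnorm_mul_le a b

variable {E : Type*} [NormedAddCommGroup E] [NormedSpace ℝ E]

lemma enorm_smul_le_mul {𝔸 F : Type*} [NormedRing 𝔸] [NormedAddCommGroup F] [Module 𝔸 F]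
    [IsBoundedSMul 𝔸 F] {a : 𝔸} {b : F} {u v : ℝ≥0∞} (ha : ‖a‖ₑ ≤ u) (hb : ‖b‖ₑ ≤ v) :
    ‖a • b‖ₑ ≤ u * v := by
  refine le_trans ?_ (mul_le_mul' ha hb)
  simp only [enorm_eq_nnnorm]
  exact_mod_cast nnnorm_smul_le a b

/-- `f` is differentiable, with pointwise bounds `u` for `f` and `u'` for its derivative. -/
structure CBound (f : Plane → E) (u u' : Plane → ℝ≥0∞) : Prop where
  diff : Differentiable ℝ f
  le : ∀ x, ‖f x‖ₑ ≤ u x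
  le' : ∀ x, ‖fderiv ℝ f x‖ₑ ≤ u' x

namespace CBound

lemma mono {f : Plane → E} {u u' w w' : Plane → ℝ≥0∞} (h : CBound f u u') (hu : ∀ x, u x ≤ w x)
    (hu' : ∀ x, u' x ≤ w' x) : CBound f w w' :=
  ⟨h.diff, fun x => (h.le x).trans (hu x), fun x => (h.le' x).trans (hu' x)⟩

lemma add {f g : Plane → E} {u u' w w' : Plane → ℝ≥0∞} (hf : CBound f u u') (hg : CBound g w w') :
    CBound (fun x => f x + g x) (fun x => u x + w x) (fun x => u' x + w' x) := by
  refine ⟨hf.diff.add hg.diff, fun x => ?_, fun x => ?_⟩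
  · exact enorm_add_le_add (hf.le x) (hg.le x)
  · rw [fderiv_fun_add (hf.diff x) (hg.diff x)]
    exact enorm_add_le_add (hf.le' x) (hg.le' x)

lemma neg {f : Plane → E} {u u' : Plane → ℝ≥0∞} (hf : CBound f u u') :
    CBound (fun x => -f x) u u' := by
  refine ⟨hf.diff.neg, fun x => ?_, fun x => ?_⟩
  · rw [enorm_neg]
    exact hf.le x
  · rw [fderiv_fun_neg, enorm_neg]
    exact hf.le' x

lemma sub {f g : Plane → E} {u u' w w' : Plane → ℝ≥0∞} (hf : CBound f u u') (hg : CBound g w w') :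
    CBound (fun x => f x - g x) (fun x => u x + w x) (fun x => u' x + w' x) := by
  simpa only [sub_eq_add_neg] using hf.add hg.neg

lemma clm_comp {F : Type*} [NormedAddCommGroup F] [NormedSpace ℝ F] {f : Plane → E}
    {u u' : Plane → ℝ≥0∞} (hf : CBound f u u') (L : E →L[ℝ] F) :
    CBound (fun x => L (f x)) (fun x => ‖L‖ₑ * u x) (fun x => ‖L‖ₑ * u' x) := by
  refine ⟨L.differentiable.comp hf.diff, fun x => ?_, fun x => ?_⟩
  · refine (L.le_opENorm _).trans ?_
    gcongr
    exact hf.le x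
  · rw [show (fun x => L (f x)) = L ∘ f from rfl,
      (L.hasFDerivAt.comp x (hf.diff x).hasFDerivAt).fderiv]
    refine le_trans ?_ (mul_le_mul' le_rfl (hf.le' x))
    simp only [enorm_eq_nnnorm]
    exact_mod_cast L.opNNNorm_comp_le _

lemma clm_comp_of_norm_le_one {F : Type*} [NormedAddCommGroup F] [NormedSpace ℝ F] {f : Plane → E}
    {u u' : Plane → ℝ≥0∞} (hf : CBound f u u') (L : E →L[ℝ] F) (hL : ‖L‖ ≤ 1) :
    CBound (fun x => L (f x)) u u' := by
  have h : ‖L‖ₑ ≤ 1 := by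
    rw [← ofReal_norm]
    exact ENNReal.ofReal_le_one.mpr hL
  exact (hf.clm_comp L).mono (fun x => mul_le_of_le_one_left' h) fun x => mul_le_of_le_one_left' h

lemma ofReal {f : Plane → ℝ} {u u' : Plane → ℝ≥0∞} (hf : CBound f u u') :
    CBound (fun x => (f x : ℂ)) u u' :=
  hf.clm_comp_of_norm_le_one Complex.ofRealCLM (by simp)

lemma im {f : Plane → ℂ} {u u' : Plane → ℝ≥0∞} (hf : CBound f u u') :
    CBound (fun x => (f x).im) u u' :=
  hf.clm_comp_of_norm_le_one Complex.imCLM (by simp)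

lemma re {f : Plane → ℂ} {u u' : Plane → ℝ≥0∞} (hf : CBound f u u') :
    CBound (fun x => (f x).re) u u' :=
  hf.clm_comp_of_norm_le_one Complex.reCLM (by simp)

lemma star {f : Plane → ℂ} {u u' : Plane → ℝ≥0∞} (hf : CBound f u u') :
    CBound (fun x => (starRingEnd ℂ) (f x)) u u' :=
  hf.clm_comp_of_norm_le_one (Complex.conjCLE : ℂ →L[ℝ] ℂ) (by simp)

lemma mul {𝔸 : Type*} [RCLike 𝔸] {f g : Plane → 𝔸}
    {u u' w w' : Plane → ℝ≥0∞} (hf : CBound f u u')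
    (hg : CBound g w w') :
    CBound (fun x => f x * g x) (fun x => u x * w x) (fun x => u x * w' x + w x * u' x) := by
  refine ⟨hf.diff.mul hg.diff, fun x => ?_, fun x => ?_⟩
  · exact enorm_mul_le_mul (hf.le x) (hg.le x)
  · rw [fderiv_fun_mul (hf.diff x) (hg.diff x)]
    have h1 : ‖f x • fderiv ℝ g x‖ₑ ≤ u x * w' x := enorm_smul_le_mul (hf.le x) (hg.le' x)
    have h2 : ‖g x • fderiv ℝ f x‖ₑ ≤ w x * u' x := enorm_smul_le_mul (hg.le x) (hf.le' x)
    exact enorm_add_le_add h1 h2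

lemma const_mul {𝔸 : Type*} [RCLike 𝔸] {f : Plane → 𝔸}
    {u u' : Plane → ℝ≥0∞} (hf : CBound f u u')
    (c : 𝔸) : CBound (fun x => c * f x) (fun x => ‖c‖ₑ * u x) (fun x => ‖c‖ₑ * u' x) := by
  have hc : CBound (fun _ : Plane => c) (fun _ => ‖c‖ₑ) (fun _ => 0) :=
    ⟨differentiable_const c, fun x => le_rfl, fun x => by simp [enorm_eq_nnnorm]⟩
  exact (hc.mul hf).mono (fun x => le_rfl) fun x => by simp

lemma const_mul_of_norm_le {𝔸 : Type*} [RCLike 𝔸] {f : Plane → 𝔸}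
    {u u' : Plane → ℝ≥0∞}
    (hf : CBound f u u') (c : 𝔸) (hc : ‖c‖ ≤ 1) : CBound (fun x => c * f x) u u' := by
  have h : ‖c‖ₑ ≤ 1 := by
    rw [← ofReal_norm]
    exact ENNReal.ofReal_le_one.mpr hc
  exact (hf.const_mul c).mono (fun x => mul_le_of_le_one_left' h) fun x => mul_le_of_le_one_left' h

end CBound

/-! ### Classes of differentiable functions with decay or boundedness -/

/-- The decaying weight `(1 + |x|)⁻³`. -/
def wt (x : Plane) : ℝ≥0∞ := ENNReal.ofReal ((1 + ‖x‖) ^ (-3 : ℝ))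

lemma measurable_wt : Measurable wt := by
  unfold wt
  fun_prop

lemma wt_le_one (x : Plane) : wt x ≤ 1 := by
  refine ENNReal.ofReal_le_one.mpr (Real.rpow_le_one_of_one_le_of_nonpos ?_ (by norm_num))
  linarith [norm_nonneg x]

lemma lintegral_wt_lt_top : ∫⁻ x, wt x < ∞ :=
  finite_integral_one_add_norm (by simp; norm_num)

/-- A unit translation changes `1 + |x|` by a factor of at most `2`, and `8 = 2³`. This provides a
dominating function for differentiation under the integral. -/
lemma wt_sub_le {x x₀ z : Plane} (hx : ‖x - x₀‖ ≤ 1) : wt (x - z) ≤ 8 * wt (x₀ - z) := by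
  unfold wt
  rw [show (8 : ℝ≥0∞) = ENNReal.ofReal 8 by norm_num, ← ENNReal.ofReal_mul (by norm_num)]
  refine ENNReal.ofReal_le_ofReal ?_
  have h1 : ‖x₀ - z‖ ≤ ‖x - z‖ + 1 := by
    calc ‖x₀ - z‖ = ‖(x - z) - (x - x₀)‖ := by congr 1; abel
      _ ≤ ‖x - z‖ + ‖x - x₀‖ := norm_sub_le _ _
      _ ≤ _ := by gcongr
  have h0 := norm_nonneg (x - z)
  have h0' := norm_nonneg (x₀ - z)
  calc (1 + ‖x - z‖) ^ (-3 : ℝ) ≤ ((1 + ‖x₀ - z‖) / 2) ^ (-3 : ℝ) :=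
        Real.rpow_le_rpow_of_nonpos (by positivity) (by linarith) (by norm_num)
    _ = 8 * (1 + ‖x₀ - z‖) ^ (-3 : ℝ) := by
      rw [Real.div_rpow (by positivity) (by norm_num),
        show (2 : ℝ) ^ (-3 : ℝ) = 1 / 8 by
          rw [Real.rpow_neg (by norm_num), show (3 : ℝ) = ((3 : ℕ) : ℝ) by norm_num,
            Real.rpow_natCast]
          norm_num]
      ring

/-- `f` and its derivative are `O((1 + |x|)⁻³)`. -/
def Rapid (f : Plane → E) : Prop :=
  ∃ C : NNReal, CBound f (fun x => C * wt x) (fun x => C * wt x)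

/-- `f` and its derivative are bounded. -/
def BddC1 (f : Plane → E) : Prop :=
  ∃ C : NNReal, CBound f (fun _ => C) (fun _ => C)

lemma Rapid.bddC1 {f : Plane → E} (hf : Rapid f) : BddC1 f := by
  obtain ⟨C, hC⟩ := hf
  exact ⟨C, hC.mono (fun x => mul_le_of_le_one_right' (wt_le_one x))
    fun x => mul_le_of_le_one_right' (wt_le_one x)⟩

lemma Rapid.add {f g : Plane → E} (hf : Rapid f) (hg : Rapid g) : Rapid fun x => f x + g x := by
  obtain ⟨C, hC⟩ := hf
  obtain ⟨D, hD⟩ := hg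
  refine ⟨C + D, (hC.add hD).mono (fun x => ?_) fun x => ?_⟩ <;>
  · push_cast
    rw [add_mul]

lemma BddC1.add {f g : Plane → E} (hf : BddC1 f) (hg : BddC1 g) : BddC1 fun x => f x + g x := by
  obtain ⟨C, hC⟩ := hf
  obtain ⟨D, hD⟩ := hg
  exact ⟨C + D, (hC.add hD).mono (fun x => by push_cast; rfl) fun x => by push_cast; rfl⟩

lemma Rapid.clm_comp {F : Type*} [NormedAddCommGroup F] [NormedSpace ℝ F] {f : Plane → E}
    (hf : Rapid f) (L : E →L[ℝ] F) : Rapid fun x => L (f x) := by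
  obtain ⟨C, hC⟩ := hf
  refine ⟨‖L‖₊ * C, (hC.clm_comp L).mono (fun x => ?_) fun x => ?_⟩ <;>
  · push_cast
    rw [mul_assoc]
    rfl

lemma BddC1.clm_comp {F : Type*} [NormedAddCommGroup F] [NormedSpace ℝ F] {f : Plane → E}
    (hf : BddC1 f) (L : E →L[ℝ] F) : BddC1 fun x => L (f x) := by
  obtain ⟨C, hC⟩ := hf
  refine ⟨‖L‖₊ * C, (hC.clm_comp L).mono (fun x => ?_) fun x => ?_⟩ <;>
  · push_cast
    rfl

lemma BddC1.mul_rapid {𝔸 : Type*} [RCLike 𝔸] {f g : Plane → 𝔸}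
    (hf : BddC1 f) (hg : Rapid g) : Rapid fun x => f x * g x := by
  obtain ⟨C, hC⟩ := hf
  obtain ⟨D, hD⟩ := hg
  refine ⟨2 * C * D, (hC.mul hD).mono (fun x => ?_) fun x => ?_⟩
  · push_cast
    rw [mul_assoc 2, mul_assoc 2, mul_assoc]
    refine le_mul_of_one_le_left zero_le (by norm_num)
  · push_cast
    refine le_of_eq ?_
    ring

lemma Rapid.const_mul {𝔸 : Type*} [RCLike 𝔸] {f : Plane → 𝔸}
    (hf : Rapid f) (c : 𝔸) : Rapid fun x => c * f x := by
  refine BddC1.mul_rapid (f := fun _ => c) ⟨‖c‖₊, differentiable_const c, fun x => ?_, fun x => ?_⟩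
    hf
  · rfl
  · simp

lemma Rapid.integrable {f : Plane → E} [SecondCountableTopology E] [MeasurableSpace E]
    [BorelSpace E] (hf : Rapid f) : Integrable f := by
  obtain ⟨C, hC⟩ := hf
  refine ⟨hC.diff.continuous.aestronglyMeasurable, ?_⟩
  refine lt_of_le_of_lt (lintegral_mono hC.le) ?_
  rw [lintegral_const_mul _ measurable_wt]
  exact ENNReal.mul_lt_top ENNReal.coe_lt_top lintegral_wt_lt_top

end CBound

/-! ### Differentiability and bounds for the gradient of the Newtonian potential -/

lemma enorm_kernel_le (k : Fin 2) (z : Plane) : ‖z k / ‖z‖ ^ 2‖ₑ ≤ ‖z‖ₑ⁻¹ := by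
  rcases eq_or_ne z 0 with rfl | hz
  · simp
  · have h0 : 0 < ‖z‖ := norm_pos_iff.mpr hz
    rw [← ofReal_norm, ← ofReal_norm, ← ENNReal.ofReal_inv_of_pos h0]
    refine ENNReal.ofReal_le_ofReal ?_
    rw [norm_div, norm_pow, norm_norm, div_le_iff₀ (by positivity), pow_two, inv_mul_cancel_left₀
      h0.ne']
    exact PiLp.norm_apply_le z k

lemma enorm_two_pi_inv_le : ‖(2 * Real.pi)⁻¹‖ₑ ≤ 1 := by
  rw [← ofReal_norm, Real.norm_of_nonneg (by positivity)]
  refine ENNReal.ofReal_le_one.mpr (inv_le_one_of_one_le₀ ?_)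
  linarith [Real.pi_gt_three]

lemma enorm_gradInvLaplacian_le (k : Fin 2) (h : Plane → ℝ) (x : Plane) :
    ‖gradInvLaplacian k h x‖ₑ ≤ riesz (fun y => ‖h y‖ₑ) x := by
  unfold gradInvLaplacian
  rw [enorm_mul]
  refine (mul_le_of_le_one_left' enorm_two_pi_inv_le).trans
    ((enorm_integral_le_lintegral_enorm _).trans (lintegral_mono fun y => ?_))
  rw [enorm_mul]
  gcongr
  exact enorm_kernel_le k (x - y)

lemma measurable_kernel (k : Fin 2) : Measurable fun z : Plane => z k / ‖z‖ ^ 2 := by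
  fun_prop

lemma gradInvLaplacian_eq_integral_sub (k : Fin 2) (h : Plane → ℝ) (x : Plane) :
    gradInvLaplacian k h x = (2 * Real.pi)⁻¹ * ∫ z : Plane, z k / ‖z‖ ^ 2 * h (x - z) := by
  unfold gradInvLaplacian
  rw [← integral_sub_left_eq_self (fun z : Plane => z k / ‖z‖ ^ 2 * h (x - z)) volume x]
  simp

instance : SecondCountableTopology (Plane →L[ℝ] ℝ) :=
  have : ProperSpace (Plane →L[ℝ] ℝ) := FiniteDimensional.proper ℝ _
  inferInstance

/-- After the translation of the variable the derivative falls on `h`, and the kernel `|z|⁻¹` is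
never differentiated. -/
lemma hasFDerivAt_gradInvLaplacian (k : Fin 2) {h : Plane → ℝ} (hh : Rapid h) (x₀ : Plane) :
    HasFDerivAt (gradInvLaplacian k h)
      ((2 * Real.pi)⁻¹ • ∫ z : Plane, (z k / ‖z‖ ^ 2) • fderiv ℝ h (x₀ - z)) x₀ := by
  obtain ⟨C, hC⟩ := hh
  have hk := measurable_kernel k
  have hhm : Measurable h := hC.diff.continuous.measurable
  have hdm := measurable_fderiv ℝ h
  have hlt : ∫⁻ z, ‖z‖ₑ⁻¹ * (8 * (C * wt (x₀ - z))) < ∞ := by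
    have h1 : ∫⁻ z, ‖z‖ₑ⁻¹ * (8 * (C * wt (x₀ - z))) = riesz (fun y => 8 * (C * wt y)) x₀ := by
      unfold riesz
      rw [← lintegral_sub_left_eq_self (fun z => ‖z‖ₑ⁻¹ * (8 * (C * wt (x₀ - z)))) x₀]
      simp
    rw [h1]
    have hm := measurable_wt
    refine (riesz_le (b := 8 * (C * 1)) (by fun_prop) (fun x => ?_) x₀).trans_lt ?_
    · gcongr
      exact wt_le_one x
    · rw [lintegral_const_mul _ (by fun_prop), lintegral_const_mul _ hm]
      refine ENNReal.mul_lt_top kerConst_lt_top (ENNReal.add_lt_top.mpr ⟨?_, ?_⟩)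
      · exact ENNReal.mul_lt_top (by norm_num) (by simp)
      · exact ENNReal.mul_lt_top (by norm_num)
          (ENNReal.mul_lt_top ENNReal.coe_lt_top lintegral_wt_lt_top)
  -- Domination uniform in `x` within distance `1` of `x₀`; the resulting bound is a Riesz potential
  -- at `x₀`, finite by `hlt`.
  have hbd : ∀ {z x : Plane}, x ∈ Metric.ball x₀ 1 → C * wt (x - z) ≤ 8 * (C * wt (x₀ - z)) := by
    intro z x hx
    rw [mul_left_comm]
    gcongr
    refine wt_sub_le ?_
    rw [← dist_eq_norm]
    exact (Metric.mem_ball.mp hx).le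
  have hfun : gradInvLaplacian k h =
      fun x => (2 * Real.pi)⁻¹ * ∫ z : Plane, z k / ‖z‖ ^ 2 * h (x - z) :=
    funext (gradInvLaplacian_eq_integral_sub k h)
  rw [hfun]
  refine HasFDerivAt.const_smul (R := ℝ) ?_ (2 * Real.pi)⁻¹
  refine hasFDerivAt_integral_of_dominated_of_fderiv_le
    (bound := fun z => (‖z‖ₑ⁻¹ * (8 * (C * wt (x₀ - z)))).toReal)
    (F' := fun x z => (z k / ‖z‖ ^ 2) • fderiv ℝ h (x - z)) (Metric.ball_mem_nhds x₀ one_pos)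
    (Eventually.of_forall fun x => ?_) ⟨?_, ?_⟩ ?_ ?_ ?_ ?_
  · exact (hk.mul (hhm.comp (measurable_const.sub measurable_id))).aestronglyMeasurable
  · exact (hk.mul (hhm.comp (measurable_const.sub measurable_id))).aestronglyMeasurable
  · refine lt_of_le_of_lt (lintegral_mono fun z => ?_) hlt
    rw [enorm_mul]
    gcongr
    · exact enorm_kernel_le k z
    · exact (hC.le _).trans (hbd (Metric.mem_ball_self one_pos))
  · exact (hk.aestronglyMeasurable).smul
      (hdm.comp (measurable_const.sub measurable_id)).aestronglyMeasurable
  · have hne : ∀ᵐ z : Plane, z ≠ 0 := Measure.ae_ne volume 0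
    filter_upwards [hne] with z hz x hx
    have htop : ‖z‖ₑ⁻¹ * (8 * (C * wt (x₀ - z))) ≠ ∞ :=
      ENNReal.mul_ne_top (by simpa using hz) (ENNReal.mul_ne_top (by norm_num)
        (ENNReal.mul_ne_top ENNReal.coe_ne_top ENNReal.ofReal_ne_top))
    rw [← toReal_enorm]
    refine ENNReal.toReal_mono htop ?_
    rw [enorm_smul]
    gcongr
    · exact enorm_kernel_le k z
    · exact (hC.le' _).trans (hbd hx)
  · have hm := measurable_wt
    exact integrable_toReal_of_lintegral_ne_top (by fun_prop) hlt.ne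
  · refine Eventually.of_forall fun z x _ => ?_
    have := (hC.diff (x - z)).hasFDerivAt.comp x ((hasFDerivAt_id x).sub_const z)
    exact this.const_smul (z k / ‖z‖ ^ 2)

/-- Since the derivative falls on `h`, the gradient of the potential is majorized by the Riesz
potential of the majorant of the gradient. The decay hypothesis enters only qualitatively, to permit
the differentiation. -/
lemma CBound.gradInvLaplacian (k : Fin 2) {h : Plane → ℝ} {u u' : Plane → ℝ≥0∞}
    (hh : CBound h u u') (hr : Rapid h) :
    CBound (gradInvLaplacian k h) (riesz u) (riesz u') := by
  refine ⟨fun x => (hasFDerivAt_gradInvLaplacian k hr x).differentiableAt, fun x => ?_,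
    fun x => ?_⟩
  · exact (enorm_gradInvLaplacian_le k h x).trans (riesz_mono hh.le x)
  · rw [(hasFDerivAt_gradInvLaplacian k hr x).fderiv, enorm_smul]
    refine (mul_le_of_le_one_left' enorm_two_pi_inv_le).trans
      ((enorm_integral_le_lintegral_enorm _).trans ?_)
    unfold riesz
    rw [← lintegral_sub_left_eq_self _ x]
    refine lintegral_mono fun y => ?_
    rw [enorm_smul]
    gcongr
    · exact enorm_kernel_le k _
    · simpa using hh.le' y

lemma Rapid.bddC1_gradInvLaplacian (k : Fin 2) {h : Plane → ℝ} (hh : Rapid h) :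
    BddC1 (CSS.gradInvLaplacian k h) := by
  obtain ⟨C, hC⟩ := id hh
  have hm := measurable_wt
  have hlt : kerConst * (C * 1 + ∫⁻ y, C * wt y) < ∞ := by
    rw [lintegral_const_mul _ hm]
    exact ENNReal.mul_lt_top kerConst_lt_top (ENNReal.add_lt_top.mpr
      ⟨by simp, ENNReal.mul_lt_top ENNReal.coe_lt_top lintegral_wt_lt_top⟩)
  have hle : ∀ x, riesz (fun x => C * wt x) x ≤ kerConst * (C * 1 + ∫⁻ y, C * wt y) :=
    riesz_le (by fun_prop) fun x => by gcongr; exact wt_le_one x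
  refine ⟨(kerConst * (C * 1 + ∫⁻ y, C * wt y)).toNNReal, (hC.gradInvLaplacian k hh).mono ?_ ?_⟩ <;>
  · intro x
    rw [ENNReal.coe_toNNReal hlt.ne]
    exact hle x


/-! ### Bounds for the nonlinearity of a smooth function -/

/-- The Biot-Savart potential generated by a function `V`. -/
def potA (V : Plane → ℂ) (j : Fin 2) (x : Plane) : ℝ :=
  if j = 0 then 1 / 2 * gradInvLaplacian 1 (fun y => ‖V y‖ ^ 2) x
  else -(1 / 2) * gradInvLaplacian 0 (fun y => ‖V y‖ ^ 2) x

/-- The current of a function `V` with gradient `P`. -/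
def cur (V : Plane → ℂ) (P : Fin 2 → Plane → ℂ) (k : Fin 2) (x : Plane) : ℝ :=
  (conj (V x) * (P k x + Complex.I * (potA V k x : ℂ) * V x)).im

/-- The temporal potential of a function `V` with gradient `P`. -/
def potA0 (V : Plane → ℂ) (P : Fin 2 → Plane → ℂ) (x : Plane) : ℝ :=
  gradInvLaplacian 0 (cur V P 1) x - gradInvLaplacian 1 (cur V P 0) x

/-- The nonlinearity for a function `V` with gradient `P`. -/
def nl (g : ℂ) (V : Plane → ℂ) (P : Fin 2 → Plane → ℂ) (x : Plane) : ℂ :=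
  -Complex.I * (potA0 V P x : ℂ) * V x
    - 2 * ∑ l : Fin 2, (potA V l x : ℂ) * P l x
    - Complex.I * ∑ l : Fin 2, (potA V l x : ℂ) ^ 2 * V x
    + Complex.I * g * ((‖V x‖ ^ 2 : ℝ) : ℂ) * V x

/-- The majorant of the potential. -/
def majA (v : Plane → ℝ≥0∞) : Plane → ℝ≥0∞ := riesz fun x => v x * v x

/-- The majorant of the gradient of the potential. -/
def majA' (v p : Plane → ℝ≥0∞) : Plane → ℝ≥0∞ := riesz fun x => v x * p x + v x * p x

/-- The majorant of the current. -/
def majJ (v p : Plane → ℝ≥0∞) (x : Plane) : ℝ≥0∞ := v x * (p x + majA v x * v x)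

/-- The majorant of the gradient of the current. -/
def majJ' (v p s : Plane → ℝ≥0∞) (x : Plane) : ℝ≥0∞ :=
  v x * (s x + (majA v x * p x + v x * majA' v p x)) + (p x + majA v x * v x) * p x

/-- The majorant of the nonlinearity. -/
def majN (g : ℂ) (v p : Plane → ℝ≥0∞) (x : Plane) : ℝ≥0∞ :=
  (riesz (majJ v p) x + riesz (majJ v p) x) * v x
    + 2 * (majA v x * p x + majA v x * p x)
    + (majA v x * majA v x * v x + majA v x * majA v x * v x)
    + ‖g‖ₑ * (v x * v x) * v x

/-- The majorant of the gradient of the nonlinearity. -/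
def majN' (g : ℂ) (v p s : Plane → ℝ≥0∞) (x : Plane) : ℝ≥0∞ :=
  ((riesz (majJ v p) x + riesz (majJ v p) x) * p x
    + v x * (riesz (majJ' v p s) x + riesz (majJ' v p s) x))
    + 2 * ((majA v x * s x + p x * majA' v p x) + (majA v x * s x + p x * majA' v p x))
    + ((majA v x * majA v x * p x
        + v x * (majA v x * majA' v p x + majA v x * majA' v p x))
      + (majA v x * majA v x * p x
        + v x * (majA v x * majA' v p x + majA v x * majA' v p x)))
    + (‖g‖ₑ * (v x * v x) * p x + v x * (‖g‖ₑ * (v x * p x + v x * p x)))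

section Majorants

variable {V : Plane → ℂ} {P : Fin 2 → Plane → ℂ} {v p s : Plane → ℝ≥0∞}

lemma sq_norm_eq_re (z : ℂ) : ‖z‖ ^ 2 = (conj z * z).re := by
  rw [← Complex.normSq_eq_conj_mul_self, Complex.ofReal_re, Complex.normSq_eq_norm_sq]

lemma CBound.normSq (hV : CBound V v p) :
    CBound (fun y => ‖V y‖ ^ 2) (fun y => v y * v y) fun y => v y * p y + v y * p y := by
  simp_rw [sq_norm_eq_re]
  exact (hV.star.mul hV).re

lemma Rapid.star (hV : Rapid V) : Rapid fun x => conj (V x) :=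
  hV.clm_comp (Complex.conjCLE : ℂ →L[ℝ] ℂ)

lemma Rapid.normSq (hV : Rapid V) : Rapid fun y => ‖V y‖ ^ 2 := by
  simp_rw [sq_norm_eq_re]
  exact (hV.star.bddC1.mul_rapid hV).clm_comp Complex.reCLM

lemma CBound.potA (hV : CBound V v p) (hr : Rapid V) (j : Fin 2) :
    CBound (potA V j) (majA v) (majA' v p) := by
  unfold CSS.potA
  fin_cases j
  · simp only [Fin.zero_eta, if_true]
    exact (hV.normSq.gradInvLaplacian 1 hr.normSq).const_mul_of_norm_le _ (by norm_num)
  · simp only [Fin.mk_one, Fin.isValue, one_ne_zero, if_false]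
    exact (hV.normSq.gradInvLaplacian 0 hr.normSq).const_mul_of_norm_le _ (by norm_num)

lemma BddC1.const_mul {f : Plane → ℝ} (hf : BddC1 f) (c : ℝ) : BddC1 fun x => c * f x := by
  have := hf.clm_comp (c • ContinuousLinearMap.id ℝ ℝ)
  simpa using this

lemma BddC1.ofReal {f : Plane → ℝ} (hf : BddC1 f) : BddC1 fun x => (f x : ℂ) :=
  hf.clm_comp Complex.ofRealCLM

lemma Rapid.bddC1_potA (hr : Rapid V) (j : Fin 2) : BddC1 (CSS.potA V j) := by
  unfold CSS.potA
  fin_cases j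
  · simp only [Fin.zero_eta, if_true]
    exact (hr.normSq.bddC1_gradInvLaplacian 1).const_mul _
  · simp only [Fin.mk_one, Fin.isValue, one_ne_zero, if_false]
    exact (hr.normSq.bddC1_gradInvLaplacian 0).const_mul _

lemma CBound.cur (hV : CBound V v p) (hP : ∀ l, CBound (P l) p s) (hr : Rapid V) (k : Fin 2) :
    CBound (cur V P k) (majJ v p) (majJ' v p s) := by
  unfold CSS.cur
  have hA := ((hV.potA hr k).ofReal.const_mul_of_norm_le Complex.I (by simp)).mul hV
  refine ((hV.star.mul ((hP k).add hA)).im).mono (fun x => ?_) fun x => ?_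
  · rfl
  · rfl

lemma Rapid.cur (hr : Rapid V) (hrP : ∀ l, Rapid (P l)) (k : Fin 2) : Rapid (CSS.cur V P k) := by
  unfold CSS.cur
  have hA := (((hr.bddC1_potA k).ofReal).mul_rapid hr).const_mul Complex.I
  simp_rw [← mul_assoc] at hA
  exact (hr.star.bddC1.mul_rapid ((hrP k).add hA)).clm_comp Complex.imCLM

lemma CBound.potA0 (hV : CBound V v p) (hP : ∀ l, CBound (P l) p s) (hr : Rapid V)
    (hrP : ∀ l, Rapid (P l)) :
    CBound (potA0 V P) (fun x => riesz (majJ v p) x + riesz (majJ v p) x)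
      fun x => riesz (majJ' v p s) x + riesz (majJ' v p s) x :=
  ((hV.cur hP hr 1).gradInvLaplacian 0 (hr.cur hrP 1)).sub
    ((hV.cur hP hr 0).gradInvLaplacian 1 (hr.cur hrP 0))

lemma Rapid.bddC1_potA0 (hr : Rapid V) (hrP : ∀ l, Rapid (P l)) : BddC1 (CSS.potA0 V P) := by
  have h1 := (hr.cur hrP 1).bddC1_gradInvLaplacian 0
  have h2 := ((hr.cur hrP 0).bddC1_gradInvLaplacian 1).const_mul (-1)
  unfold CSS.potA0
  convert h1.add h2 using 2
  ring

/-- The majorants are literally what the Leibniz rule produces term by term, so the comparison at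
the end is reflexive. Signs, and constants of modulus at most one, are discarded on the way. -/
lemma CBound.nl (g : ℂ) (hV : CBound V v p) (hP : ∀ l, CBound (P l) p s) (hr : Rapid V)
    (hrP : ∀ l, Rapid (P l)) : CBound (nl g V P) (majN g v p) (majN' g v p s) := by
  have h1 := ((hV.potA0 hP hr hrP).ofReal.const_mul_of_norm_le (-Complex.I) (by simp)).mul hV
  have h2 := (((hV.potA hr 0).ofReal.mul (hP 0)).add ((hV.potA hr 1).ofReal.mul (hP 1))).const_mul 2
  have hA : ∀ l, CBound (fun x => (CSS.potA V l x : ℂ) ^ 2 * V x)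
      (fun x => majA v x * majA v x * v x) (fun x => majA v x * majA v x * p x
        + v x * (majA v x * majA' v p x + majA v x * majA' v p x)) := fun l => by
    simp_rw [pow_two]
    exact ((hV.potA hr l).ofReal.mul (hV.potA hr l).ofReal).mul hV
  have h3 := ((hA 0).add (hA 1)).const_mul_of_norm_le Complex.I (by simp)
  have h4 := ((hV.normSq.ofReal).const_mul (Complex.I * g)).mul hV
  have hIg : ‖Complex.I * g‖ₑ = ‖g‖ₑ := by simp [enorm_eq_nnnorm]
  have h2e : ‖(2 : ℂ)‖ₑ = 2 := by simp [enorm_eq_nnnorm]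
  have h := ((h1.sub h2).sub h3).add h4
  unfold CSS.nl
  simp only [Fin.sum_univ_two, hIg, h2e] at h ⊢
  exact h.mono (fun x => le_rfl) fun x => le_rfl

/-- Every term is a product of bounded potentials with one factor that decays, `V` or a component of
`P`. This justifies the integration by parts; its quantitative content is not used. -/
lemma Rapid.nl (g : ℂ) (hr : Rapid V) (hrP : ∀ l, Rapid (P l)) : Rapid (CSS.nl g V P) := by
  have h1 := ((hr.bddC1_potA0 hrP).ofReal.mul_rapid hr).const_mul (-Complex.I)
  have h2 := ((((hr.bddC1_potA 0).ofReal).mul_rapid (hrP 0)).add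
    (((hr.bddC1_potA 1).ofReal).mul_rapid (hrP 1))).const_mul (-2)
  have hA : ∀ l, Rapid fun x => (CSS.potA V l x : ℂ) ^ 2 * V x := fun l => by
    simp_rw [pow_two, mul_assoc]
    exact (hr.bddC1_potA l).ofReal.mul_rapid ((hr.bddC1_potA l).ofReal.mul_rapid hr)
  have h3 := ((hA 0).add (hA 1)).const_mul (-Complex.I)
  have h4 := ((hr.normSq.bddC1.ofReal).mul_rapid hr).const_mul (Complex.I * g)
  have h := ((h1.add h2).add h3).add h4
  unfold CSS.nl
  simp only [Fin.sum_univ_two] at h ⊢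
  refine (congrArg Rapid (funext fun x => ?_)).mp h
  ring

end Majorants

/-! ### Integral bounds for the majorants -/

/-- The size of the data entering the majorants. -/
structure MajData (K : ℝ≥0∞) (v p : Plane → ℝ≥0∞) : Prop where
  mv : Measurable v
  mp : Measurable p
  sup : ∀ x, v x ≤ K
  v2 : N2 v ≤ K
  p2 : N2 p ≤ K

namespace MajData

variable {K : ℝ≥0∞} {v p s : Plane → ℝ≥0∞}

lemma measurable_majA (h : MajData K v p) : Measurable (majA v) :=
  measurable_riesz (h.mv.mul h.mv)

lemma measurable_majA' (h : MajData K v p) : Measurable (majA' v p) :=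
  measurable_riesz ((h.mv.mul h.mp).add (h.mv.mul h.mp))

lemma measurable_majJ (h : MajData K v p) : Measurable (majJ v p) :=
  h.mv.mul (h.mp.add (h.measurable_majA.mul h.mv))

lemma measurable_majJ' (h : MajData K v p) (hs : Measurable s) : Measurable (majJ' v p s) := by
  have h0 := h.mv
  have h1 := h.mp
  have h2 := h.measurable_majA
  have h3 := h.measurable_majA'
  unfold majJ'
  fun_prop

lemma lintegral_mul_le {f g : Plane → ℝ≥0∞} {a b : ℝ≥0∞} (hf : Measurable f) (hg : Measurable g)
    (ha : N2 f ≤ a) (hb : N2 g ≤ b) : ∫⁻ x, f x * g x ≤ a * b :=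
  (lintegral_mul_le_N2 hf hg).trans (mul_le_mul' ha hb)

lemma N2_mul_le_of_le {f g : Plane → ℝ≥0∞} {a b : ℝ≥0∞} (hg : Measurable g)
    (ha : ∀ x, f x ≤ a) (hb : N2 g ≤ b) : N2 (fun x => f x * g x) ≤ a * b :=
  (N2_mul_le_sup hg ha).trans (mul_le_mul' le_rfl hb)

lemma N2_add_le_of_le {f g : Plane → ℝ≥0∞} {a b : ℝ≥0∞} (hf : Measurable f) (hg : Measurable g)
    (ha : N2 f ≤ a) (hb : N2 g ≤ b) : N2 (fun x => f x + g x) ≤ a + b :=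
  (N2_add_le hf hg).trans (add_le_add ha hb)

lemma majA_le (h : MajData K v p) (x : Plane) : majA v x ≤ kerConst * (K * K + K * K) := by
  refine (riesz_le (h.mv.mul h.mv) (fun y => mul_le_mul' (h.sup y) (h.sup y)) x).trans ?_
  gcongr
  exact lintegral_mul_le h.mv h.mv h.v2 h.v2

lemma N2_covD_le (h : MajData K v p) :
    N2 (fun x => p x + majA v x * v x) ≤ K + kerConst * (K * K + K * K) * K :=
  N2_add_le_of_le h.mp (h.measurable_majA.mul h.mv) h.p2 (N2_mul_le_of_le h.mv h.majA_le h.v2)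

lemma lintegral_majJ_le (h : MajData K v p) :
    ∫⁻ x, majJ v p x ≤ K * (K + kerConst * (K * K + K * K) * K) :=
  lintegral_mul_le h.mv (h.mp.add (h.measurable_majA.mul h.mv)) h.v2 h.N2_covD_le

lemma N2_majJ_le (h : MajData K v p) :
    N2 (majJ v p) ≤ K * (K + kerConst * (K * K + K * K) * K) :=
  N2_mul_le_of_le (h.mp.add (h.measurable_majA.mul h.mv)) h.sup h.N2_covD_le

/-- The current is quadratic, so its gradient contains products of two functions in `L²` and is
bounded here in `L¹` only. -/
lemma lintegral_majJ'_le (h : MajData K v p) (hs : Measurable s) (s2 : N2 s ≤ K) :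
    ∫⁻ x, majJ' v p s x ≤ K * (K + kerConst * (K * K + K * K) * K)
      + (K * K + K * K) * (kerConst * (K * K + K * K))
      + K * (K + kerConst * (K * K + K * K) * K) := by
  have h0 := h.mv
  have h1 := h.mp
  have h2 := h.measurable_majA
  have h3 := h.measurable_majA'
  have e : ∀ x, majJ' v p s x = (v x * (s x + majA v x * p x) + v x * v x * majA' v p x)
      + (p x + majA v x * v x) * p x := fun x => by
    unfold majJ'
    ring
  simp_rw [e]
  rw [lintegral_add_left (by fun_prop), lintegral_add_left (by fun_prop)]
  gcongr
  · exact lintegral_mul_le h0 (by fun_prop) h.v2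
      (N2_add_le_of_le hs (by fun_prop) s2 (N2_mul_le_of_le h.mp h.majA_le h.p2))
  -- The gradient of the potential need not be bounded. By symmetry of the Riesz kernel it is
  -- replaced by the potential of `v²`, which is.
  · unfold majA'
    rw [lintegral_mul_riesz_comm (f := fun x => v x * v x) (by fun_prop) (by fun_prop)]
    calc ∫⁻ y, (v y * p y + v y * p y) * riesz (fun x => v x * v x) y
        ≤ ∫⁻ y, (v y * p y + v y * p y) * (kerConst * (K * K + K * K)) := by
          gcongr with y
          exact h.majA_le y
      _ = (∫⁻ y, (v y * p y + v y * p y)) * (kerConst * (K * K + K * K)) :=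
          lintegral_mul_const _ (by fun_prop)
      _ ≤ _ := by
        rw [lintegral_add_left (by fun_prop)]
        gcongr <;> exact lintegral_mul_le h0 h1 h.v2 h.p2
  · rw [mul_comm K]
    exact lintegral_mul_le (by fun_prop) h1 h.N2_covD_le h.p2

lemma N2_vp_le (h : MajData K v p) : N2 (fun x => v x * p x + v x * p x) ≤ K * K + K * K :=
  N2_add_le_of_le (h.mv.mul h.mp) (h.mv.mul h.mp) (N2_mul_le_of_le h.mp h.sup h.p2)
    (N2_mul_le_of_le h.mp h.sup h.p2)

lemma lintegral_vp_le (h : MajData K v p) : ∫⁻ x, (v x * p x + v x * p x) ≤ K * K + K * K := by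
  rw [lintegral_add_left (f := fun x => v x * p x) (h.mv.mul h.mp)]
  gcongr <;> exact lintegral_mul_le h.mv h.mp h.v2 h.p2

/-- The constant in the bounds of the nonlinearity. -/
def const (g : ℂ) : ℝ≥0∞ := 100 * (kerConst ^ 2 + kerConst + ‖g‖ₑ)

lemma const_lt_top (g : ℂ) : const g < ∞ := by
  unfold const
  refine ENNReal.mul_lt_top (by norm_num) ?_
  simp [ENNReal.add_lt_top, kerConst_lt_top]

/-- `Q` stands for the multiplier of the oscillatory integral, which is in `L²`. The local terms are
Cauchy–Schwarz with a bounded potential; only the term with `A₀` needs the bilinear Riesz bound. -/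
lemma lintegral_majN_le (g : ℂ) (h : MajData K v p) {Q : Plane → ℝ≥0∞} (hQ : Measurable Q) :
    ∫⁻ x, Q x * majN g v p x ≤ const g * N2 Q * (K ^ 3 + K ^ 5) := by
  have h0 := h.mv
  have h1 := h.mp
  have h2 := h.measurable_majA
  have h3 := h.measurable_majJ
  have h4 := measurable_riesz h3
  have e : ∀ x, Q x * majN g v p x = 2 * (Q x * v x * riesz (majJ v p) x)
      + 4 * (Q x * (majA v x * p x)) + 2 * (Q x * ((majA v x * majA v x) * v x))
      + ‖g‖ₑ * (Q x * ((v x * v x) * v x)) := fun x => by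
    unfold majN
    ring
  simp_rw [e]
  rw [lintegral_add_left (by fun_prop), lintegral_add_left (by fun_prop),
    lintegral_add_left (by fun_prop), lintegral_const_mul _ (by fun_prop),
    lintegral_const_mul _ (by fun_prop), lintegral_const_mul _ (by fun_prop),
    lintegral_const_mul _ (by fun_prop)]
  have b1 : ∫⁻ x, Q x * v x * riesz (majJ v p) x ≤ kerConst * N2 Q *
      (K * (K * (K + kerConst * (K * K + K * K) * K))
        + K * (K * (K + kerConst * (K * K + K * K) * K))) := by
    refine (lintegral_L2_mul_riesz_le hQ h0 h.sup h3).trans ?_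
    gcongr
    · exact h.N2_majJ_le
    · exact h.v2
    · exact h.lintegral_majJ_le
  have b2 : ∫⁻ x, Q x * (majA v x * p x) ≤ N2 Q * (kerConst * (K * K + K * K) * K) :=
    lintegral_mul_le hQ (by fun_prop) le_rfl (N2_mul_le_of_le h.mp h.majA_le h.p2)
  have b3 : ∫⁻ x, Q x * ((majA v x * majA v x) * v x) ≤
      N2 Q * ((kerConst * (K * K + K * K)) * (kerConst * (K * K + K * K)) * K) :=
    lintegral_mul_le hQ (by fun_prop) le_rfl
      (N2_mul_le_of_le h.mv (fun x => mul_le_mul' (h.majA_le x) (h.majA_le x)) h.v2)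
  have b4 : ∫⁻ x, Q x * ((v x * v x) * v x) ≤ N2 Q * ((K * K) * K) :=
    lintegral_mul_le hQ (by fun_prop) le_rfl
      (N2_mul_le_of_le h.mv (fun x => mul_le_mul' (h.sup x) (h.sup x)) h.v2)
  refine (add_le_add (add_le_add (add_le_add (mul_le_mul_right b1 _) (mul_le_mul_right b2 _))
    (mul_le_mul_right b3 _)) (mul_le_mul_right b4 _)).trans ?_
  calc _ = N2 Q * ((12 * kerConst + ‖g‖ₑ) * K ^ 3 + (16 * kerConst ^ 2) * K ^ 5) := by ring
    _ ≤ N2 Q * (const g * K ^ 3 + const g * K ^ 5) := by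
      unfold const
      gcongr
      · rw [mul_add, mul_add, add_assoc]
        refine le_add_of_nonneg_of_le zero_le (add_le_add ?_ ?_)
        · gcongr; norm_num
        · exact le_mul_of_one_le_left zero_le (by norm_num)
      · norm_num
      · exact le_self_add.trans le_self_add
    _ = _ := by ring

/-- Each term of the gradient is `W` times a function times a Riesz potential, with a bounded
potential as a possible further factor, or is local. Second derivatives occur only next to `A` and
inside the gradient of the current, so `s` is needed in `L²` alone. -/
lemma lintegral_majN'_le (g : ℂ) (h : MajData K v p) (hs : Measurable s) (s2 : N2 s ≤ K)
    {W : Plane → ℝ≥0∞} {η : ℝ≥0∞} (hW : IsWeight W η) :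
    ∫⁻ x, W x * majN' g v p s x ≤ const g * η * (K ^ 3 + K ^ 5) := by
  have h0 := h.mv
  have h1 := h.mp
  have h2 := h.measurable_majA
  have h2' := h.measurable_majA'
  have h3 := h.measurable_majJ
  have h3' := h.measurable_majJ' hs
  have h4 := measurable_riesz h3
  have h4' := measurable_riesz h3'
  have hWm := hW.measurable
  have e : ∀ x, W x * majN' g v p s x = 2 * (W x * p x * riesz (majJ v p) x)
      + 2 * (W x * v x * riesz (majJ' v p s) x)
      + 4 * (W x * s x * majA v x) + 4 * (W x * p x * majA' v p x)
      + 2 * (majA v x * (W x * p x * majA v x)) + 4 * (majA v x * (W x * v x * majA' v p x))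
      + 3 * ‖g‖ₑ * (W x * (v x * (v x * p x))) := fun x => by
    unfold majN'
    ring
  simp_rw [e]
  rw [lintegral_add_left (by fun_prop), lintegral_add_left (by fun_prop),
    lintegral_add_left (by fun_prop), lintegral_add_left (by fun_prop),
    lintegral_add_left (by fun_prop), lintegral_add_left (by fun_prop),
    lintegral_const_mul _ (by fun_prop), lintegral_const_mul _ (by fun_prop),
    lintegral_const_mul _ (by fun_prop), lintegral_const_mul _ (by fun_prop),
    lintegral_const_mul _ (by fun_prop), lintegral_const_mul _ (by fun_prop),
    lintegral_const_mul _ (by fun_prop)]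
  have hvv : N2 (fun x => v x * v x) + ∫⁻ x, v x * v x ≤ K * K + K * K :=
    add_le_add (N2_mul_le_of_le h0 h.sup h.v2) (lintegral_mul_le h0 h0 h.v2 h.v2)
  have hvp : N2 (fun x => v x * p x + v x * p x) + ∫⁻ x, (v x * p x + v x * p x) ≤
      (K * K + K * K) + (K * K + K * K) := add_le_add h.N2_vp_le h.lintegral_vp_le
  have w : ∀ {f h : Plane → ℝ≥0∞} {b : ℝ≥0∞}, Measurable f → Measurable h → N2 f ≤ K →
      N2 h + ∫⁻ y, h y ≤ b → ∫⁻ x, W x * f x * riesz h x ≤ kerConst * η * K * b :=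
    fun hf hh hfK hb => (lintegral_weight_mul_riesz_le hW hf hh).trans (by gcongr)
  have wA : ∀ {f : Plane → ℝ≥0∞} {b : ℝ≥0∞}, Measurable f → ∫⁻ x, f x ≤ b →
      ∫⁻ x, majA v x * f x ≤ kerConst * (K * K + K * K) * b := fun {f b} hf hb => by
    calc ∫⁻ x, majA v x * f x ≤ ∫⁻ x, kerConst * (K * K + K * K) * f x := by
          gcongr with x
          exact h.majA_le x
      _ = kerConst * (K * K + K * K) * ∫⁻ x, f x := lintegral_const_mul _ hf
      _ ≤ _ := by gcongr
  have b1 : ∫⁻ x, W x * p x * riesz (majJ v p) x ≤ kerConst * η * K *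
      (K * (K + kerConst * (K * K + K * K) * K) + K * (K + kerConst * (K * K + K * K) * K)) :=
    w h1 h3 h.p2 (add_le_add h.N2_majJ_le h.lintegral_majJ_le)
  -- The gradient of the current is controlled in `L¹` only, so this term takes the variant in which
  -- the other factor is bounded.
  have b2 : ∫⁻ x, W x * v x * riesz (majJ' v p s) x ≤ kerConst * η * (K + K) *
      (K * (K + kerConst * (K * K + K * K) * K) + (K * K + K * K) * (kerConst * (K * K + K * K))
      + K * (K + kerConst * (K * K + K * K) * K)) := by
    refine (lintegral_weight_mul_riesz_le_of_bdd hW h0 h.sup h3').trans ?_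
    gcongr
    · exact h.v2
    · exact h.lintegral_majJ'_le hs s2
  have b3 : ∫⁻ x, W x * s x * majA v x ≤ kerConst * η * K * (K * K + K * K) :=
    w hs (h0.mul h0) s2 hvv
  have b4 : ∫⁻ x, W x * p x * majA' v p x ≤
      kerConst * η * K * ((K * K + K * K) + (K * K + K * K)) :=
    w h1 ((h0.mul h1).add (h0.mul h1)) h.p2 hvp
  have b5 : ∫⁻ x, majA v x * (W x * p x * majA v x) ≤
      kerConst * (K * K + K * K) * (kerConst * η * K * (K * K + K * K)) :=
    wA (by fun_prop) (w h1 (h0.mul h0) h.p2 hvv)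
  have b6 : ∫⁻ x, majA v x * (W x * v x * majA' v p x) ≤ kerConst * (K * K + K * K) *
      (kerConst * η * K * ((K * K + K * K) + (K * K + K * K))) :=
    wA (by fun_prop) (w h0 ((h0.mul h1).add (h0.mul h1)) h.v2 hvp)
  have b7 : ∫⁻ x, W x * (v x * (v x * p x)) ≤ η * (K * (K * K)) := by
    calc ∫⁻ x, W x * (v x * (v x * p x)) ≤ ∫⁻ x, η * (K * (v x * p x)) := by
          gcongr with x
          · exact hW.le_sup x
          · exact h.sup x
      _ = η * (K * ∫⁻ x, v x * p x) := by
        rw [lintegral_const_mul _ (by fun_prop), lintegral_const_mul _ (by fun_prop)]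
      _ ≤ _ := by
        gcongr
        exact lintegral_mul_le h0 h1 h.v2 h.p2
  refine (add_le_add (add_le_add (add_le_add (add_le_add (add_le_add (add_le_add
    (mul_le_mul_right b1 _) (mul_le_mul_right b2 _)) (mul_le_mul_right b3 _))
    (mul_le_mul_right b4 _)) (mul_le_mul_right b5 _)) (mul_le_mul_right b6 _))
    (mul_le_mul_right b7 _)).trans ?_
  calc _ = η * ((36 * kerConst + 3 * ‖g‖ₑ) * K ^ 3 + (80 * kerConst ^ 2) * K ^ 5) := by ring
    _ ≤ η * (const g * K ^ 3 + const g * K ^ 5) := by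
      unfold const
      gcongr
      · rw [mul_add, mul_add, add_assoc]
        refine le_add_of_nonneg_of_le zero_le (add_le_add ?_ ?_)
        · gcongr; norm_num
        · gcongr; norm_num
      · norm_num
      · exact le_self_add.trans le_self_add
    _ = _ := by ring

end MajData


/-! ### Oscillatory integrals with a quadratic phase -/

/-- The multiplier `(1 + 2 i c s)⁻¹`. -/
def qf (c s : ℝ) : ℂ := (1 + 2 * Complex.I * c * s)⁻¹

lemma qf_den_ne_zero (c s : ℝ) : (1 + 2 * Complex.I * c * s : ℂ) ≠ 0 := by
  intro h
  have := congrArg Complex.re h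
  simp at this

lemma norm_qf_sq (c s : ℝ) : ‖qf c s‖ ^ 2 = (1 + 4 * c ^ 2 * s ^ 2)⁻¹ := by
  unfold qf
  rw [norm_inv, inv_pow, ← Complex.normSq_eq_norm_sq, Complex.normSq_apply]
  congr 1
  simp
  ring

lemma norm_qf_le_one (c s : ℝ) : ‖qf c s‖ ≤ 1 := by
  rw [← sq_le_one_iff₀ (norm_nonneg _), norm_qf_sq]
  exact inv_le_one_of_one_le₀ (by nlinarith [mul_nonneg (sq_nonneg c) (sq_nonneg s)])

lemma abs_mul_norm_qf_le (c s : ℝ) : 2 * |c| * |s| * ‖qf c s‖ ≤ 1 := by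
  rw [← sq_le_one_iff₀ (by positivity), mul_pow, norm_qf_sq, mul_pow, mul_pow, sq_abs, sq_abs,
    ← div_eq_mul_inv, div_le_one (by positivity)]
  linarith

lemma hasDerivAt_qf (c s : ℝ) :
    HasDerivAt (qf c) (-(2 * Complex.I * c) * qf c s ^ 2) s := by
  unfold qf
  have h1 : HasDerivAt (fun s : ℝ => (1 + 2 * Complex.I * c * s : ℂ)) (2 * Complex.I * c) s := by
    simpa using ((Complex.ofRealCLM.hasDerivAt (x := s)).const_mul (2 * Complex.I * c)).const_add 1
  convert! h1.inv (qf_den_ne_zero c s) using 1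
  rw [inv_pow, div_eq_mul_inv]

/-- The quadratic phase `e^{i c |x - x₀|²}`. -/
def phase (c : ℝ) (x₀ x : Plane) : ℂ := Complex.exp (Complex.I * c * (‖x - x₀‖ ^ 2 : ℝ))

lemma norm_phase (c : ℝ) (x₀ x : Plane) : ‖phase c x₀ x‖ = 1 := by
  unfold phase
  rw [mul_assoc, ← Complex.ofReal_mul, mul_comm Complex.I]
  exact Complex.norm_exp_ofReal_mul_I _

/-- The derivative of `|x - x₀|²`. -/
def dsq (x₀ x : Plane) : Plane →L[ℝ] ℝ := 2 • innerSL ℝ (x - x₀)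

lemma hasFDerivAt_sq (x₀ x : Plane) : HasFDerivAt (fun x => ‖x - x₀‖ ^ 2) (dsq x₀ x) x := by
  have := ((hasFDerivAt_id x).sub_const x₀).norm_sq
  convert! this using 1

lemma dsq_apply (x₀ x : Plane) (k : Fin 2) : dsq x₀ x (e k) = 2 * (x - x₀) k := by
  simp [dsq, e, EuclideanSpace.inner_single_right]

lemma norm_dsq_le (x₀ x : Plane) : ‖dsq x₀ x‖ ≤ 2 * ‖x - x₀‖ := by
  unfold dsq
  rw [← Nat.cast_smul_eq_nsmul ℝ]
  refine (norm_smul_le _ _).trans ?_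
  rw [innerSL_apply_norm]
  simp

lemma hasFDerivAt_phase (c : ℝ) (x₀ x : Plane) :
    HasFDerivAt (phase c x₀) ((phase c x₀ x * (Complex.I * c)) •
      Complex.ofRealCLM.comp (dsq x₀ x)) x := by
  unfold phase
  have h := ((Complex.ofRealCLM.hasFDerivAt.comp x (hasFDerivAt_sq x₀ x)).const_mul
    (Complex.I * c)).cexp
  convert! h using 1
  rw [smul_smul]
  rfl

lemma hasFDerivAt_qf (c : ℝ) (x₀ x : Plane) :
    HasFDerivAt (fun x => qf c (‖x - x₀‖ ^ 2))
      ((dsq x₀ x).smulRight (-(2 * Complex.I * c) * qf c (‖x - x₀‖ ^ 2) ^ 2)) x := by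
  have h := (hasDerivAt_qf c (‖x - x₀‖ ^ 2)).hasFDerivAt.comp x (hasFDerivAt_sq x₀ x)
  convert! h using 1

/-- The size of the multiplier. -/
def Qw (c : ℝ) (y : Plane) : ℝ≥0∞ := ‖qf c (‖y‖ ^ 2)‖ₑ

/-- The size of the multiplier times the distance. -/
def Ww (c : ℝ) (y : Plane) : ℝ≥0∞ := ‖y‖ₑ * Qw c y

lemma continuous_qf (c : ℝ) : Continuous (qf c) :=
  continuous_iff_continuousAt.mpr fun s => (hasDerivAt_qf c s).continuousAt

lemma measurable_Qw (c : ℝ) : Measurable (Qw c) :=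
  (((continuous_qf c).comp (by fun_prop)).enorm).measurable

lemma measurable_Ww (c : ℝ) : Measurable (Ww c) := measurable_enorm.mul (measurable_Qw c)

/-- The coordinate multipliers `(x - x₀)ₖ (1 + 2 i c |x - x₀|²)⁻¹`. -/
def qk (c : ℝ) (x₀ : Plane) (k : Fin 2) (x : Plane) : ℂ :=
  (((x - x₀) k : ℝ) : ℂ) * qf c (‖x - x₀‖ ^ 2)

/-- Differentiating the coordinate costs `|q|`. Differentiating `q` costs `4|c| r² |q|²`, which is
at most `2|q|` because `2|c| r² |q| ≤ 1`; hence the factor `3`. -/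
lemma CBound.qk (c : ℝ) (x₀ : Plane) (k : Fin 2) :
    CBound (qk c x₀ k) (fun x => Ww c (x - x₀)) fun x => 3 * Qw c (x - x₀) := by
  have hd : ∀ x, HasFDerivAt (fun x : Plane => (((x - x₀) k : ℝ) : ℂ))
      (Complex.ofRealCLM.comp (EuclideanSpace.proj k : Plane →L[ℝ] ℝ)) x := fun x =>
    Complex.ofRealCLM.hasFDerivAt.comp x
      ((EuclideanSpace.proj k : Plane →L[ℝ] ℝ).hasFDerivAt.comp x ((hasFDerivAt_id x).sub_const x₀))
  have hnk : ∀ x : Plane, ‖(((x - x₀) k : ℝ) : ℂ)‖ ≤ ‖x - x₀‖ := fun x => by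
    rw [Complex.norm_real]
    exact PiLp.norm_apply_le (x - x₀) k
  have hproj : ‖(EuclideanSpace.proj k : Plane →L[ℝ] ℝ)‖ ≤ 1 :=
    ContinuousLinearMap.opNorm_le_bound _ zero_le_one fun x => by
      simpa using PiLp.norm_apply_le x k
  have hd' := fun x => (hd x).fun_mul (hasFDerivAt_qf c x₀ x)
  refine ⟨fun x => (hd' x).differentiableAt, fun x => ?_, fun x => ?_⟩
  · unfold CSS.qk Ww Qw
    refine enorm_mul_le_mul ?_ le_rfl
    rw [← ofReal_norm, ← ofReal_norm]
    exact ENNReal.ofReal_le_ofReal (hnk x)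
  · unfold CSS.qk Qw
    rw [(hd' x).fderiv, ← ofReal_norm, ← ofReal_norm (qf c _),
      show (3 : ℝ≥0∞) = ENNReal.ofReal 3 by norm_num, ← ENNReal.ofReal_mul (by norm_num)]
    refine ENNReal.ofReal_le_ofReal ?_
    set q := qf c (‖x - x₀‖ ^ 2)
    have hq := abs_mul_norm_qf_le c (‖x - x₀‖ ^ 2)
    rw [abs_of_nonneg (by positivity : (0 : ℝ) ≤ ‖x - x₀‖ ^ 2)] at hq
    refine (norm_add_le _ _).trans ?_
    have h1 : ‖(((x - x₀) k : ℝ) : ℂ) • (dsq x₀ x).smulRight (-(2 * Complex.I * c) * q ^ 2)‖ ≤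
        ‖x - x₀‖ * (2 * ‖x - x₀‖ * (2 * |c| * ‖q‖ ^ 2)) := by
      refine (ContinuousLinearMap.opNorm_smul_le _ _).trans ?_
      rw [ContinuousLinearMap.norm_smulRight_apply]
      gcongr
      · exact hnk x
      · exact norm_dsq_le x₀ x
      · simp
    have h2 : ‖q • Complex.ofRealCLM.comp (EuclideanSpace.proj k : Plane →L[ℝ] ℝ)‖ ≤ ‖q‖ * 1 := by
      refine (ContinuousLinearMap.opNorm_smul_le _ _).trans ?_
      gcongr
      refine (ContinuousLinearMap.opNorm_comp_le _ _).trans ?_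
      simpa using hproj
    have h3 : ‖x - x₀‖ * (2 * ‖x - x₀‖ * (2 * |c| * ‖q‖ ^ 2)) =
        2 * ‖q‖ * (2 * |c| * ‖x - x₀‖ ^ 2 * ‖q‖) := by ring
    have h4 : 2 * ‖q‖ * (2 * |c| * ‖x - x₀‖ ^ 2 * ‖q‖) ≤ 2 * ‖q‖ * 1 := by gcongr
    linarith

/-- The Euler field gives `(x - x₀) · ∇(phase) = 2ic|x - x₀|² phase`, so the phase plus this
derivative is `q⁻¹` times the phase. Unlike division by the derivative of the phase alone, this is
not singular at the stationary point. -/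
lemma phase_identity (c : ℝ) (x₀ x : Plane) :
    phase c x₀ x = qf c (‖x - x₀‖ ^ 2) * phase c x₀ x
      + ∑ k : Fin 2, fderiv ℝ (phase c x₀) x (e k) * qk c x₀ k x := by
  have h : (1 + 2 * Complex.I * c * (‖x - x₀‖ ^ 2 : ℝ)) * qf c (‖x - x₀‖ ^ 2) = 1 :=
    mul_inv_cancel₀ (qf_den_ne_zero c _)
  have hn : (‖x - x₀‖ ^ 2 : ℝ) = (x - x₀) 0 ^ 2 + (x - x₀) 1 ^ 2 := by
    rw [EuclideanSpace.norm_sq_eq]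
    simp
  rw [Fin.sum_univ_two, (hasFDerivAt_phase c x₀ x).fderiv]
  simp only [qk, smul_eq_mul, smul_apply, ContinuousLinearMap.comp_apply,
    dsq_apply, Complex.ofRealCLM_apply]
  rw [← hn.symm] at h ⊢
  push_cast at h ⊢
  linear_combination (-phase c x₀ x) * h

/-- Interpolation between `|q| ≤ 1` and `2|c| r² |q| ≤ 1`. -/
lemma Ww_sq_le (c : ℝ) (hc : c ≠ 0) (y : Plane) :
    Ww c y ≤ ENNReal.ofReal ((Real.sqrt |c|)⁻¹) := by
  unfold Ww Qw
  rw [← ofReal_norm, ← ofReal_norm, ← ENNReal.ofReal_mul (norm_nonneg _)]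
  refine ENNReal.ofReal_le_ofReal ?_
  have hc' : 0 < |c| := abs_pos.mpr hc
  rw [← abs_of_nonneg (by positivity : 0 ≤ ‖y‖ * ‖qf c (‖y‖ ^ 2)‖), ← Real.sqrt_inv]
  refine Real.abs_le_sqrt ?_
  have h1 := abs_mul_norm_qf_le c (‖y‖ ^ 2)
  have h2 := norm_qf_le_one c (‖y‖ ^ 2)
  rw [abs_of_nonneg (by positivity : (0 : ℝ) ≤ ‖y‖ ^ 2)] at h1
  rw [inv_eq_one_div, le_div_iff₀ hc']
  nlinarith [norm_nonneg (qf c (‖y‖ ^ 2)), mul_nonneg (abs_nonneg c) (sq_nonneg ‖y‖),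
    mul_nonneg (mul_nonneg (abs_nonneg c) (sq_nonneg ‖y‖)) (norm_nonneg (qf c (‖y‖ ^ 2)))]

lemma CBound.integrable_of_le {f : Plane → ℂ} (hf : Measurable f) {C : NNReal}
    (h : ∀ x, ‖f x‖ₑ ≤ C * wt x) : Integrable f := by
  refine ⟨hf.aestronglyMeasurable, (lintegral_mono h).trans_lt ?_⟩
  rw [lintegral_const_mul _ measurable_wt]
  exact ENNReal.mul_lt_top ENNReal.coe_lt_top lintegral_wt_lt_top

/-- `phase_identity` followed by one integration by parts in each coordinate. The `7` is `1 + 2 ·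
3`: one from the undifferentiated term, three from the derivative of each coordinate multiplier; the
`2` counts the coordinates. -/
lemma enorm_integral_phase_mul_le {c : ℝ} (hc : c ≠ 0) (x₀ : Plane) {n : Plane → ℂ}
    {u u' : Plane → ℝ≥0∞} (hn : CBound n u u') (hr : Rapid n) (hu : Measurable u)
    (hu' : Measurable u') :
    ‖∫ x, phase c x₀ x * n x‖ₑ ≤
      7 * (∫⁻ x, Qw c (x - x₀) * u x) + 2 * ∫⁻ x, Ww c (x - x₀) * u' x := by
  have hQ := measurable_Qw c
  have hW := measurable_Ww c
  obtain ⟨C, hC⟩ := id hr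
  set G : Fin 2 → Plane → ℂ := fun k x => qk c x₀ k x * n x with hG
  have hGb : ∀ k, CBound (G k) _ _ := fun k => (CBound.qk c x₀ k).mul hn
  have hqkb : ∀ k, BddC1 (qk c x₀ k) := fun k => by
    refine ⟨(Real.sqrt |c|)⁻¹.toNNReal + 3, (CBound.qk c x₀ k).mono (fun x => ?_) fun x => ?_⟩
    · refine (Ww_sq_le c hc _).trans ?_
      push_cast
      exact le_self_add
    · have : Qw c (x - x₀) ≤ 1 := by
        unfold Qw
        rw [← ofReal_norm]
        exact ENNReal.ofReal_le_one.mpr (norm_qf_le_one _ _)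
      push_cast
      calc 3 * Qw c (x - x₀) ≤ 3 * 1 := by gcongr
        _ ≤ _ := by rw [mul_one]; exact le_add_self
  have hGr : ∀ k, Rapid (G k) := fun k => (hqkb k).mul_rapid hr
  have hpm : Measurable (phase c x₀) :=
    (continuous_iff_continuousAt.mpr fun x => (hasFDerivAt_phase c x₀ x).continuousAt).measurable
  have hpe : ∀ x, ‖phase c x₀ x‖ₑ = 1 := fun x => by
    rw [← ofReal_norm, norm_phase, ENNReal.ofReal_one]
  have hek : ∀ k : Fin 2, ‖e k‖ₑ ≤ 1 := fun k => by
    simp [e, ← ofReal_norm]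
  have hder : ∀ (k : Fin 2) (L : Plane →L[ℝ] ℂ), ‖L (e k)‖ₑ ≤ ‖L‖ₑ := fun k L =>
    (L.le_opENorm _).trans (mul_le_of_le_one_right' (hek k))
  have hnm : Measurable n := hn.diff.continuous.measurable
  have hGm : ∀ k, Measurable (G k) := fun k => (hGb k).diff.continuous.measurable
  have hdGm : ∀ k, Measurable fun x => fderiv ℝ (G k) x (e k) := fun k =>
    measurable_fderiv_apply_const ℝ _ _
  have hqm : Measurable fun x => qf c (‖x - x₀‖ ^ 2) :=
    ((continuous_qf c).comp (by fun_prop)).measurable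
  have hdpm : ∀ k, Measurable fun x => fderiv ℝ (phase c x₀) x (e k) := fun k =>
    measurable_fderiv_apply_const ℝ _ _
  have hdp : ∀ k x, ‖fderiv ℝ (phase c x₀) x (e k) * qk c x₀ k x‖ ≤ 1 := fun k x => by
    rw [(hasFDerivAt_phase c x₀ x).fderiv]
    simp only [qk, smul_eq_mul, smul_apply, ContinuousLinearMap.comp_apply,
      dsq_apply, Complex.ofRealCLM_apply, norm_mul, norm_phase, Complex.norm_I, one_mul,
      Complex.norm_real, Real.norm_eq_abs, Complex.ofReal_mul, Complex.ofReal_ofNat,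
      Complex.norm_ofNat]
    have h1 := abs_mul_norm_qf_le c (‖x - x₀‖ ^ 2)
    have h2 : |(x - x₀) k| ≤ ‖x - x₀‖ := PiLp.norm_apply_le (x - x₀) k
    rw [abs_of_nonneg (by positivity : (0 : ℝ) ≤ ‖x - x₀‖ ^ 2)] at h1
    calc |c| * (2 * |(x - x₀) k|) * (|(x - x₀) k| * ‖qf c (‖x - x₀‖ ^ 2)‖)
        ≤ |c| * (2 * ‖x - x₀‖) * (‖x - x₀‖ * ‖qf c (‖x - x₀‖ ^ 2)‖) := by gcongr
      _ = 2 * |c| * ‖x - x₀‖ ^ 2 * ‖qf c (‖x - x₀‖ ^ 2)‖ := by ring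
      _ ≤ 1 := h1
  have i1 : ∀ k, Integrable fun x => fderiv ℝ (phase c x₀) x (e k) * G k x := fun k => by
    refine CBound.integrable_of_le ((hdpm k).mul (hGm k)) (C := C) fun x => ?_
    rw [hG, ← mul_assoc]
    refine (enorm_mul_le_mul (u := 1) ?_ (hC.le x)).trans (by rw [one_mul])
    rw [← ofReal_norm]
    exact ENNReal.ofReal_le_one.mpr (hdp k x)
  have i2 : ∀ k, Integrable fun x => phase c x₀ x * fderiv ℝ (G k) x (e k) := fun k => by
    obtain ⟨D, hD⟩ := hGr k
    refine CBound.integrable_of_le (hpm.mul (hdGm k)) (C := D) fun x => ?_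
    refine (enorm_mul_le_mul (hpe x).le ((hder k _).trans (hD.le' x))).trans (by rw [one_mul])
  have i3 : ∀ k, Integrable fun x => phase c x₀ x * G k x := fun k => by
    obtain ⟨D, hD⟩ := hGr k
    refine CBound.integrable_of_le (hpm.mul (hGm k)) (C := D) fun x => ?_
    refine (enorm_mul_le_mul (hpe x).le (hD.le x)).trans (by rw [one_mul])
  have i0 : Integrable fun x => qf c (‖x - x₀‖ ^ 2) * phase c x₀ x * n x := by
    refine CBound.integrable_of_le ((hqm.mul hpm).mul hnm) (C := C) fun x => ?_
    refine (enorm_mul_le_mul (u := 1 * 1) (enorm_mul_le_mul ?_ (hpe x).le) (hC.le x)).trans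
      (by rw [one_mul, one_mul])
    rw [← ofReal_norm]
    exact ENNReal.ofReal_le_one.mpr (norm_qf_le_one _ _)
  have ibp : ∀ k, ∫ x, fderiv ℝ (phase c x₀) x (e k) * G k x =
      -∫ x, phase c x₀ x * fderiv ℝ (G k) x (e k) := fun k => by
    rw [integral_mul_fderiv_eq_neg_fderiv_mul_of_integrable (i1 k) (i2 k) (i3 k)
      (fun x _ => (hasFDerivAt_phase c x₀ x).differentiableAt) (fun x _ => (hGb k).diff x), neg_neg]
  have hsplit : ∫ x, phase c x₀ x * n x = (∫ x, qf c (‖x - x₀‖ ^ 2) * phase c x₀ x * n x)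
      + ((-∫ x, phase c x₀ x * fderiv ℝ (G 0) x (e 0))
        + -∫ x, phase c x₀ x * fderiv ℝ (G 1) x (e 1)) := by
    have i11 : Integrable fun x => fderiv ℝ (phase c x₀) x (e 0) * G 0 x +
        fderiv ℝ (phase c x₀) x (e 1) * G 1 x := (i1 0).add (i1 1)
    rw [← ibp, ← ibp, ← integral_add (i1 0) (i1 1), ← integral_add i0 i11]
    refine integral_congr_ae (Eventually.of_forall fun x => ?_)
    have := phase_identity c x₀ x
    rw [Fin.sum_univ_two] at this
    simp only [hG]
    linear_combination n x * this
  have hum : Measurable fun x => Qw c (x - x₀) * u x := by fun_prop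
  have hum' : Measurable fun x => Ww c (x - x₀) * u' x := by fun_prop
  have t0 : ‖∫ x, qf c (‖x - x₀‖ ^ 2) * phase c x₀ x * n x‖ₑ ≤ ∫⁻ x, Qw c (x - x₀) * u x := by
    refine (enorm_integral_le_lintegral_enorm _).trans (lintegral_mono fun x => ?_)
    refine enorm_mul_le_mul ?_ (hn.le x)
    exact (enorm_mul_le_mul (le_refl _) (hpe x).le).trans (by rw [mul_one]; rfl)
  have t1 : ∀ k, ‖-∫ x, phase c x₀ x * fderiv ℝ (G k) x (e k)‖ₑ ≤
      (∫⁻ x, Ww c (x - x₀) * u' x) + 3 * ∫⁻ x, Qw c (x - x₀) * u x := fun k => by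
    rw [enorm_neg, ← lintegral_const_mul _ hum, ← lintegral_add_left hum']
    refine (enorm_integral_le_lintegral_enorm _).trans (lintegral_mono fun x => ?_)
    refine (enorm_mul_le_mul (hpe x).le ((hder k _).trans ((hGb k).le' x))).trans (le_of_eq ?_)
    ring
  rw [hsplit]
  refine (enorm_add_le_add t0 (enorm_add_le_add (t1 0) (t1 1))).trans (le_of_eq ?_)
  ring

/-! ### The size of the weights -/

lemma lintegral_comp_smul_plane (f : Plane → ℝ≥0∞) {r : ℝ} (hr : r ≠ 0) :
    ∫⁻ x, f (r • x) = ENNReal.ofReal ((r ^ 2)⁻¹) * ∫⁻ x, f x := by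
  have h := Measure.map_addHaar_smul (volume : Measure Plane) hr
  simp only [finrank_euclideanSpace, Fintype.card_fin] at h
  rw [abs_of_nonneg (by positivity)] at h
  rw [← smul_eq_mul, ← lintegral_smul_measure, ← h]
  exact ((Homeomorph.smulOfNeZero r hr).measurableEmbedding.lintegral_map _).symm

/-- The `L²` norm of the multiplier at `c = 1`. -/
def qConst : ℝ≥0∞ := N2 (Qw 1)

lemma qConst_lt_top : qConst < ∞ := by
  unfold qConst N2
  refine ENNReal.rpow_lt_top_of_nonneg (by norm_num) (ne_of_lt ?_)
  refine lt_of_le_of_lt (lintegral_mono fun x => ?_) (lt_of_eq_of_lt (lintegral_const_mul 4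
    measurable_wt) (ENNReal.mul_lt_top (by norm_num) lintegral_wt_lt_top))
  unfold Qw wt
  rw [← ofReal_norm, ENNReal.ofReal_rpow_of_nonneg (norm_nonneg _) (by norm_num),
    show (4 : ℝ≥0∞) = ENNReal.ofReal 4 by norm_num, ← ENNReal.ofReal_mul (by norm_num)]
  refine ENNReal.ofReal_le_ofReal ?_
  rw [Real.rpow_two, norm_qf_sq, Real.rpow_neg (by positivity),
    show (3 : ℝ) = ((3 : ℕ) : ℝ) by norm_num, Real.rpow_natCast, inv_eq_one_div,
    ← div_eq_mul_inv, div_le_div_iff₀ (by positivity) (by positivity)]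
  have := norm_nonneg x
  nlinarith [sq_nonneg (‖x‖ ^ 2 - ‖x‖), sq_nonneg (‖x‖ - 1), sq_nonneg (‖x‖ ^ 2 - 1),
    mul_nonneg this (sq_nonneg (‖x‖ - 1))]

lemma Qw_eq_smul (c : ℝ) (y : Plane) : Qw c y = Qw 1 (Real.sqrt |c| • y) := by
  unfold Qw
  rw [← ofReal_norm, ← ofReal_norm]
  congr 1
  rw [← sq_eq_sq₀ (norm_nonneg _) (norm_nonneg _), norm_qf_sq, norm_qf_sq, norm_smul, mul_pow,
    Real.norm_of_nonneg (Real.sqrt_nonneg _), Real.sq_sqrt (abs_nonneg c), mul_pow, sq_abs]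
  ring

/-- `Q` at parameter `c` is `Q` at parameter `1` dilated by `√|c|`, in two dimensions. -/
lemma N2_Qw {c : ℝ} (hc : c ≠ 0) : N2 (Qw c) = ENNReal.ofReal ((Real.sqrt |c|)⁻¹) * qConst := by
  have hc' : 0 < Real.sqrt |c| := Real.sqrt_pos.mpr (abs_pos.mpr hc)
  unfold N2 qConst
  simp_rw [Qw_eq_smul c]
  rw [lintegral_comp_smul_plane (fun x => Qw 1 x ^ (2 : ℝ)) hc'.ne',
    ENNReal.mul_rpow_of_nonneg _ _ (by norm_num), ENNReal.ofReal_rpow_of_pos (by positivity),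
    ← inv_pow, ← Real.sqrt_eq_rpow, Real.sqrt_sq (by positivity), N2]

/-- The function `|y| |q|` decays only like `|y|⁻¹` and is not in `L²`. This bound of its square by
`|q|` puts it in `L⁴`, which is why weights are measured in `L⁴`. -/
lemma Ww_sq_le_Qw (c : ℝ) (hc : c ≠ 0) (y : Plane) :
    Ww c y ^ (2 : ℝ) ≤ ENNReal.ofReal |c|⁻¹ * Qw c y := by
  have hc' : 0 < |c| := abs_pos.mpr hc
  unfold Ww Qw
  rw [← ofReal_norm, ← ofReal_norm, ← ENNReal.ofReal_mul (norm_nonneg _),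
    ENNReal.ofReal_rpow_of_nonneg (by positivity) (by norm_num),
    ← ENNReal.ofReal_mul (by positivity)]
  refine ENNReal.ofReal_le_ofReal ?_
  have h1 := abs_mul_norm_qf_le c (‖y‖ ^ 2)
  rw [abs_of_nonneg (by positivity : (0 : ℝ) ≤ ‖y‖ ^ 2)] at h1
  rw [Real.rpow_two, inv_mul_eq_div, le_div_iff₀ hc']
  calc (‖y‖ * ‖qf c (‖y‖ ^ 2)‖) ^ 2 * |c|
      = (2 * |c| * ‖y‖ ^ 2 * ‖qf c (‖y‖ ^ 2)‖) * (‖qf c (‖y‖ ^ 2)‖ / 2) := by ring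
    _ ≤ 1 * (‖qf c (‖y‖ ^ 2)‖ / 2) := by gcongr
    _ ≤ _ := by linarith [norm_nonneg (qf c (‖y‖ ^ 2))]

lemma isWeight_Ww {c : ℝ} (hc : 1 ≤ |c|) (x₀ : Plane) :
    IsWeight (fun x => Ww c (x - x₀)) (ENNReal.ofReal ((Real.sqrt |c|)⁻¹) * (1 + qConst)) := by
  have hc0 : c ≠ 0 := fun h => by
    rw [h, abs_zero] at hc
    linarith
  have hW := measurable_Ww c
  have hQ := measurable_Qw c
  refine ⟨by fun_prop, fun x => ?_, ?_⟩
  · refine (Ww_sq_le c hc0 _).trans (le_mul_of_one_le_right zero_le le_self_add)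
  · rw [N2_comp_sub_right (fun x => Ww c x ^ (2 : ℝ)) x₀]
    have h1 : N2 (fun x => Ww c x ^ (2 : ℝ)) ≤ ENNReal.ofReal |c|⁻¹ * (1 + qConst) := by
      refine (N2_mono (Ww_sq_le_Qw c hc0)).trans ?_
      rw [N2_const_mul _ hQ, N2_Qw hc0]
      gcongr
      refine le_trans (mul_le_of_le_one_left zero_le ?_) le_add_self
      refine ENNReal.ofReal_le_one.mpr (inv_le_one_of_one_le₀ ?_)
      exact Real.one_le_sqrt.mpr hc
    refine (ENNReal.rpow_le_rpow h1 (by norm_num)).trans ?_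
    rw [ENNReal.mul_rpow_of_nonneg _ _ (by norm_num), ENNReal.ofReal_rpow_of_nonneg (by positivity)
      (by norm_num), ← Real.sqrt_eq_rpow, Real.sqrt_inv]
    gcongr
    calc (1 + qConst) ^ (1 / 2 : ℝ) ≤ (1 + qConst) ^ (1 : ℝ) :=
          ENNReal.rpow_le_rpow_of_exponent_le le_self_add (by norm_num)
      _ = _ := ENNReal.rpow_one _

/-- The constant in the oscillatory estimate of the nonlinearity. -/
def coreConst (g : ℂ) : ℝ≥0∞ := 9 * MajData.const g * (1 + qConst)

lemma coreConst_lt_top (g : ℂ) : coreConst g < ∞ := by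
  unfold coreConst
  refine ENNReal.mul_lt_top (ENNReal.mul_lt_top (by norm_num) (MajData.const_lt_top g)) ?_
  simp [qConst_lt_top]

/-- The oscillatory integral of the nonlinearity against a quadratic phase. -/
lemma enorm_integral_phase_mul_nl_le (g : ℂ) {c : ℝ} (hc : 1 ≤ |c|) (x₀ : Plane) {V : Plane → ℂ}
    {P : Fin 2 → Plane → ℂ} {v p s : Plane → ℝ≥0∞} {K : ℝ≥0∞} (hV : CBound V v p)
    (hP : ∀ l, CBound (P l) p s) (hr : Rapid V) (hrP : ∀ l, Rapid (P l)) (h : MajData K v p)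
    (hs : Measurable s) (s2 : N2 s ≤ K) :
    ‖∫ x, phase c x₀ x * nl g V P x‖ₑ ≤
      coreConst g * ENNReal.ofReal ((Real.sqrt |c|)⁻¹) * (K ^ 3 + K ^ 5) := by
  have hc0 : c ≠ 0 := fun h => by
    rw [h, abs_zero] at hc
    linarith
  have h0 := h.mv
  have h1 := h.mp
  have h2 := h.measurable_majA
  have h2' := h.measurable_majA'
  have h4 := measurable_riesz h.measurable_majJ
  have h4' := measurable_riesz (h.measurable_majJ' hs)
  have hQ := measurable_Qw c
  refine (enorm_integral_phase_mul_le hc0 x₀ (hV.nl g hP hr hrP) (hr.nl g hrP)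
    (by unfold majN; fun_prop) (by unfold majN'; fun_prop)).trans ?_
  have b1 := h.lintegral_majN_le g (Q := fun x => Qw c (x - x₀)) (by fun_prop)
  have b2 := h.lintegral_majN'_le g hs s2 (isWeight_Ww hc x₀)
  rw [N2_comp_sub_right (Qw c), N2_Qw hc0] at b1
  have hq : qConst ≤ 1 + qConst := le_add_self
  calc _ ≤ 7 * (MajData.const g * (ENNReal.ofReal ((Real.sqrt |c|)⁻¹) * (1 + qConst))
          * (K ^ 3 + K ^ 5))
        + 2 * (MajData.const g * (ENNReal.ofReal ((Real.sqrt |c|)⁻¹) * (1 + qConst))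
          * (K ^ 3 + K ^ 5)) := by
        refine add_le_add (mul_le_mul_right (b1.trans ?_) _) (mul_le_mul_right b2 _)
        gcongr
    _ = _ := by
      unfold coreConst
      ring



/-! ### The quadratic chirp and the free propagator on the Schwartz space -/

/-- The chirp `e^{i c |x|²}`. -/
def chirp (c : ℝ) (x : Plane) : ℂ := Complex.exp (Complex.I * ((c * ‖x‖ ^ 2 : ℝ) : ℂ))

lemma norm_chirp (c : ℝ) (x : Plane) : ‖chirp c x‖ = 1 := by
  unfold chirp
  rw [mul_comm]
  exact Complex.norm_exp_ofReal_mul_I _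

lemma chirp_mul_neg (c : ℝ) : chirp c * chirp (-c) = 1 := by
  ext x
  simp only [Pi.mul_apply, chirp, ← Complex.exp_add, Pi.one_apply]
  rw [← Complex.exp_zero]
  congr 1
  push_cast
  ring

lemma chirp_mul_neg_apply (c : ℝ) (x : Plane) : chirp c x * chirp (-c) x = 1 :=
  congrFun (chirp_mul_neg c) x

lemma hasTemperateGrowth_exp_I_mul :
    Function.HasTemperateGrowth fun s : ℝ => Complex.exp (Complex.I * s) := by
  have h : ∀ n : ℕ, iteratedDeriv n (fun s : ℝ => Complex.exp (Complex.I * s)) =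
      fun s : ℝ => Complex.I ^ n * Complex.exp (Complex.I * s) := by
    intro n
    induction n with
    | zero => simp
    | succ n ih =>
      rw [iteratedDeriv_succ, ih]
      ext s
      have h1 : HasDerivAt (fun s : ℝ => Complex.I * (s : ℂ)) Complex.I s := by
        simpa using (Complex.ofRealCLM.hasDerivAt (x := s)).const_mul Complex.I
      rw [(h1.cexp.const_mul (Complex.I ^ n)).deriv]
      ring
  have hc : ContDiff ℝ (⊤ : ℕ∞) fun s : ℝ => (s : ℂ) := Complex.ofRealCLM.contDiff
  refine ⟨(contDiff_const.mul hc).cexp, fun n => ⟨0, 1, fun s => ?_⟩⟩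
  rw [norm_iteratedFDeriv_eq_norm_iteratedDeriv, h]
  simp only [mul_comm Complex.I]
  simp [Complex.norm_exp_ofReal_mul_I]

@[fun_prop]
lemma hasTemperateGrowth_chirp (c : ℝ) : Function.HasTemperateGrowth (chirp c) := by
  have h : Function.HasTemperateGrowth fun x : Plane => c * ‖x‖ ^ 2 := by
    have := Function.hasTemperateGrowth_norm_sq (H := Plane)
    fun_prop
  exact hasTemperateGrowth_exp_I_mul.comp h

lemma continuous_chirp (c : ℝ) : Continuous (chirp c) := by
  unfold chirp
  fun_prop

/-- The coordinate `x_k` as a complex function. -/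
def coord (k : Fin 2) (x : Plane) : ℂ := ((x k : ℝ) : ℂ)

lemma coord_eq (k : Fin 2) : coord k =
    fun x => (Complex.ofRealCLM.comp (EuclideanSpace.proj k : Plane →L[ℝ] ℝ)) x := rfl

@[fun_prop]
lemma hasTemperateGrowth_coord (k : Fin 2) : Function.HasTemperateGrowth (coord k) := by
  rw [coord_eq]
  exact ContinuousLinearMap.hasTemperateGrowth _

lemma norm_coord_le (k : Fin 2) (x : Plane) : ‖coord k x‖ ≤ ‖x‖ := by
  unfold coord
  rw [Complex.norm_real]
  exact PiLp.norm_apply_le x k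

lemma phase_eq_chirp (c : ℝ) (x y : Plane) : phase c x y = chirp c (y - x) := by
  simp only [phase, chirp]
  congr 1
  push_cast
  ring

/-- Self-adjointness of the Fourier transform against a complex Gaussian. The condition `Re b > 0`
makes it integrable; the Fresnel kernel appears in the limit of purely imaginary `b`. -/
lemma gaussian_duality {b : ℂ} (hb : 0 < b.re) (f : 𝓢(Plane, ℂ)) (x : Plane) :
    ∫ v, Complex.exp (-b * ‖v‖ ^ 2 + 2 * Real.pi * Complex.I * (inner ℝ x v : ℝ)) * 𝓕 f v =
      ∫ y, (Real.pi / b * Complex.exp (-Real.pi ^ 2 * ‖x - y‖ ^ 2 / b)) * f y := by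
  have hg := GaussianFourier.integrable_cexp_neg_mul_sq_norm_add (V := Plane) hb
    (2 * Real.pi * Complex.I) x
  have h := VectorFourier.integral_bilin_fourierIntegral_eq_flip (L := innerₗ Plane)
    (ContinuousLinearMap.mul ℂ ℂ) Real.continuous_fourierChar continuous_inner hg
    (f.integrable (μ := volume))
  have h1 : ∀ w, VectorFourier.fourierIntegral Real.fourierChar volume (innerₗ Plane)
      (fun v => Complex.exp (-b * ‖v‖ ^ 2 + 2 * Real.pi * Complex.I * (inner ℝ x v : ℝ))) w =
      Real.pi / b * Complex.exp (-Real.pi ^ 2 * ‖x - w‖ ^ 2 / b) := fun w => by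
    have := fourier_gaussian_innerProductSpace' (V := Plane) hb x w
    rw [finrank_euclideanSpace, Fintype.card_fin] at this
    simpa using! this
  simp only [h1, flip_innerₗ] at h
  exact h.symm

/-- The free propagator on the Schwartz space is convolution with the Fresnel kernel. -/
lemma fourier_chirp_fourierInv_apply {τ : ℝ} (hτ : τ ≠ 0) (f : 𝓢(Plane, ℂ)) (x : Plane) :
    𝓕 (SchwartzMap.smulLeftCLM ℂ (chirp (-(4 * Real.pi ^ 2 * τ))) (𝓕⁻ f)) x =
      (4 * Real.pi * Complex.I * τ)⁻¹ * ∫ y, phase (1 / (4 * τ)) x y * f y := by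
  have hpi := Real.pi_pos
  have hpi' : (Real.pi : ℂ) ≠ 0 := by exact_mod_cast hpi.ne'
  have hτ' : (τ : ℂ) ≠ 0 := by exact_mod_cast hτ
  -- A damping `ε > 0` makes the oscillating exponent integrable. Both sides of the duality then
  -- converge as `ε → 0`, the second because `|b|` stays above `|Im b| = 4π²|τ|`.
  set b : ℝ → ℂ := fun ε => ε + 4 * Real.pi ^ 2 * τ * Complex.I with hb
  have hbc : Continuous b := by fun_prop
  have hb0 : b 0 = 4 * Real.pi ^ 2 * τ * Complex.I := by simp [hb]
  have hb0' : b 0 ≠ 0 := by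
    rw [hb0]
    simp [hpi', hτ']
  have hbre : ∀ ε, (b ε).re = ε := fun ε => by
    have : 4 * (Real.pi : ℂ) ^ 2 * τ = ((4 * Real.pi ^ 2 * τ : ℝ) : ℂ) := by push_cast; ring
    simp only [hb, this, Complex.add_re, Complex.ofReal_re, Complex.ofReal_im,
      Complex.mul_I_re, neg_zero, add_zero]
  have hbim : ∀ ε, (b ε).im = 4 * Real.pi ^ 2 * τ := fun ε => by
    have : 4 * (Real.pi : ℂ) ^ 2 * τ = ((4 * Real.pi ^ 2 * τ : ℝ) : ℂ) := by push_cast; ring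
    simp only [hb, this, Complex.add_im, Complex.ofReal_re, Complex.ofReal_im,
      Complex.mul_I_im, zero_add]
  have hpos : ∀ᶠ ε : ℝ in 𝓝[>] 0, 0 < ε := eventually_mem_nhdsWithin
  have key : ∀ᶠ ε : ℝ in 𝓝[>] 0,
      ∫ v, Complex.exp (-b ε * ‖v‖ ^ 2 + 2 * Real.pi * Complex.I * (inner ℝ x v : ℝ)) * 𝓕 f v =
      ∫ y, (Real.pi / b ε * Complex.exp (-Real.pi ^ 2 * ‖x - y‖ ^ 2 / b ε)) * f y := by
    filter_upwards [hpos] with ε hε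
    exact gaussian_duality (by rw [hbre]; exact hε) f x
  have bc0 : Tendsto b (𝓝[>] 0) (𝓝 (b 0)) := (hbc.tendsto 0).mono_left nhdsWithin_le_nhds
  have lim1 : Tendsto (fun ε => ∫ v, Complex.exp (-b ε * ‖v‖ ^ 2 +
      2 * Real.pi * Complex.I * (inner ℝ x v : ℝ)) * 𝓕 f v) (𝓝[>] 0)
      (𝓝 (∫ v, Complex.exp (-b 0 * ‖v‖ ^ 2 +
        2 * Real.pi * Complex.I * (inner ℝ x v : ℝ)) * 𝓕 f v)) := by
    refine tendsto_integral_filter_of_dominated_convergence (fun v => ‖𝓕 f v‖) ?_ ?_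
      ((𝓕 f).integrable (μ := volume)).norm ?_
    · refine Eventually.of_forall fun ε => Continuous.aestronglyMeasurable ?_
      have := (𝓕 f).continuous
      fun_prop
    · filter_upwards [hpos] with ε hε
      refine Eventually.of_forall fun v => ?_
      rw [norm_mul]
      refine mul_le_of_le_one_left (norm_nonneg _) ?_
      rw [Complex.norm_exp, Real.exp_le_one_iff]
      have e1 : (-b ε * ‖v‖ ^ 2 + 2 * Real.pi * Complex.I * (inner ℝ x v : ℝ)).re =
          -ε * ‖v‖ ^ 2 := by
        have h1 : -b ε * ‖v‖ ^ 2 = -b ε * ((‖v‖ ^ 2 : ℝ) : ℂ) := by push_cast; ring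
        have h2 : 2 * Real.pi * Complex.I * ((inner ℝ x v : ℝ) : ℂ) =
          ((2 * Real.pi * inner ℝ x v : ℝ) : ℂ) * Complex.I := by push_cast; ring
        rw [h1, h2, Complex.add_re, Complex.re_mul_ofReal, Complex.neg_re, hbre,
          Complex.re_ofReal_mul]
        simp
      rw [e1]
      have := mul_nonneg hε.le (sq_nonneg ‖v‖)
      linarith
    · refine Eventually.of_forall fun v => ?_
      exact ((Complex.continuous_exp.tendsto _).comp
        ((bc0.neg.mul_const _).add_const _)).mul_const _
  have lim2 : Tendsto (fun ε => ∫ y, (Real.pi / b ε *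
      Complex.exp (-Real.pi ^ 2 * ‖x - y‖ ^ 2 / b ε)) * f y) (𝓝[>] 0)
      (𝓝 (∫ y, (Real.pi / b 0 * Complex.exp (-Real.pi ^ 2 * ‖x - y‖ ^ 2 / b 0)) * f y)) := by
    refine tendsto_integral_filter_of_dominated_convergence
      (fun y => Real.pi / (4 * Real.pi ^ 2 * |τ|) * ‖f y‖) ?_ ?_
      ((f.integrable (μ := volume)).norm.const_mul _) ?_
    · refine Eventually.of_forall fun ε => Continuous.aestronglyMeasurable ?_
      have := f.continuous
      fun_prop
    · filter_upwards [hpos] with ε hε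
      refine Eventually.of_forall fun y => ?_
      rw [norm_mul, norm_mul, norm_div, Complex.norm_real, Real.norm_of_nonneg hpi.le]
      gcongr
      have e1 : 4 * Real.pi ^ 2 * |τ| ≤ ‖b ε‖ := by
        refine le_trans (le_of_eq ?_) (Complex.abs_im_le_norm _)
        rw [hbim, abs_mul, abs_of_nonneg (by positivity : 0 ≤ 4 * Real.pi ^ 2)]
      refine (mul_le_of_le_one_right (by positivity) ?_).trans
        (div_le_div_of_nonneg_left hpi.le (by positivity) e1)
      rw [Complex.norm_exp, Real.exp_le_one_iff]
      have h1 : -(Real.pi : ℂ) ^ 2 * ‖x - y‖ ^ 2 / b ε =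
          ((-(Real.pi ^ 2 * ‖x - y‖ ^ 2) : ℝ) : ℂ) * (b ε)⁻¹ := by
        push_cast
        ring
      rw [h1, Complex.re_ofReal_mul, Complex.inv_re, hbre]
      have : 0 ≤ ε / Complex.normSq (b ε) := div_nonneg hε.le (Complex.normSq_nonneg _)
      have h2 : 0 ≤ Real.pi ^ 2 * ‖x - y‖ ^ 2 := by positivity
      have := mul_nonneg h2 this
      linarith
    · refine Eventually.of_forall fun y => ?_
      exact ((tendsto_const_nhds.div bc0 hb0').mul ((Complex.continuous_exp.tendsto _).comp
        (tendsto_const_nhds.div bc0 hb0'))).mul_const _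
  have lim := tendsto_nhds_unique (lim1.congr' key) lim2
  have hl : 𝓕 (SchwartzMap.smulLeftCLM ℂ (chirp (-(4 * Real.pi ^ 2 * τ))) (𝓕⁻ f)) x =
      ∫ v, Complex.exp (-b 0 * ‖v‖ ^ 2 + 2 * Real.pi * Complex.I * (inner ℝ x v : ℝ)) * 𝓕 f v := by
    rw [SchwartzMap.fourier_coe, Real.fourier_eq', ← integral_neg_eq_self]
    refine integral_congr_ae (Eventually.of_forall fun v => ?_)
    simp only [smul_eq_mul]
    rw [SchwartzMap.smulLeftCLM_apply_apply (by fun_prop), SchwartzMap.fourierInv_coe,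
      Real.fourierInv_eq_fourier_neg, neg_neg, SchwartzMap.fourier_coe, smul_eq_mul, ← mul_assoc]
    congr 1
    rw [chirp, ← Complex.exp_add]
    congr 1
    rw [hb0, norm_neg, inner_neg_left, real_inner_comm]
    push_cast
    ring
  rw [hl, lim, ← integral_const_mul]
  refine integral_congr_ae (Eventually.of_forall fun y => ?_)
  simp only
  rw [← mul_assoc, phase, hb0, norm_sub_rev]
  congr 1
  congr 1
  · field_simp
  · congr 1
    push_cast
    field_simp
    linear_combination (-(‖y - x‖ : ℂ) ^ 2) * Complex.I_sq

/-! ### Factorization of the pseudoconformal dilation -/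

/-- The operator `G ↦ ρ⁻¹ (θ G)(x / ρ)` on the Schwartz space, with `ρ = 4 π τ` and
`θ = i e^{- 4 π² i τ |x|²}`. -/
def chirpDil {τ : ℝ} (hτ : τ ≠ 0) : 𝓢(Plane, ℂ) →L[ℂ] 𝓢(Plane, ℂ) :=
  (((4 * Real.pi * τ)⁻¹ : ℝ) * Complex.I : ℂ) •
    (SchwartzMap.compCLMOfContinuousLinearEquiv ℂ (ContinuousLinearEquiv.smulLeft
      (Units.mk0 (4 * Real.pi * τ)⁻¹ (by have := Real.pi_ne_zero; positivity) : ℝˣ)) ∘L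
      SchwartzMap.smulLeftCLM ℂ (chirp (-(4 * Real.pi ^ 2 * τ))))

lemma chirpDil_apply {τ : ℝ} (hτ : τ ≠ 0) (G : 𝓢(Plane, ℂ)) (x : Plane) :
    chirpDil hτ G x = (((4 * Real.pi * τ)⁻¹ : ℝ) * Complex.I : ℂ) *
      (chirp (-(4 * Real.pi ^ 2 * τ)) ((4 * Real.pi * τ)⁻¹ • x) * G ((4 * Real.pi * τ)⁻¹ • x)) := by
  have h : Function.HasTemperateGrowth (chirp (-(4 * Real.pi ^ 2 * τ))) := by fun_prop
  simp only [chirpDil, smul_apply, ContinuousLinearMap.comp_apply, smul_eq_mul,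
    SchwartzMap.compCLMOfContinuousLinearEquiv_apply, Function.comp_apply,
    SchwartzMap.smulLeftCLM_apply_apply h]
  rfl

lemma smulLeft_chirp_neg (c : ℝ) (f : 𝓢(Plane, ℂ)) :
    SchwartzMap.smulLeftCLM ℂ (chirp c) (SchwartzMap.smulLeftCLM ℂ (chirp (-c)) f) = f := by
  ext x
  rw [SchwartzMap.smulLeftCLM_apply_apply (by fun_prop),
    SchwartzMap.smulLeftCLM_apply_apply (by fun_prop), smul_smul, chirp_mul_neg_apply, one_smul]

/-- Expanding `|ρX - y|²/(4τ)` with `ρ = 4πτ`: the term in `|X|²` cancels the chirp, the one in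
`|y|²` becomes the chirp at `y`, and the cross term is `-2π X · y`, a Fourier character. -/
lemma phase_mul_chirp (τ : ℝ) (hτ : τ ≠ 0) (y X : Plane) :
    phase (1 / (4 * τ)) y ((4 * Real.pi * τ) • X) * chirp (-(4 * Real.pi ^ 2 * τ)) X =
      chirp (1 / (4 * τ)) y * Complex.exp (((-2 * Real.pi * inner ℝ X y : ℝ) : ℂ) * Complex.I) := by
  have hτ' : (τ : ℂ) ≠ 0 := by exact_mod_cast hτ
  rw [phase, chirp, chirp, ← Complex.exp_add, ← Complex.exp_add]
  congr 1
  rw [norm_sub_sq_real, norm_smul, mul_pow, Real.norm_eq_abs, sq_abs, inner_smul_left]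
  simp only [conj_trivial]
  push_cast
  field_simp
  ring

/-- The chirped Fourier transform factorizes through the free propagator and a dilation. -/
lemma fourier_chirp_fourierInv_chirpDil {τ : ℝ} (hτ : τ ≠ 0) (G : 𝓢(Plane, ℂ)) :
    𝓕 (SchwartzMap.smulLeftCLM ℂ (chirp (-(4 * Real.pi ^ 2 * τ))) (𝓕⁻ (chirpDil hτ G))) =
      SchwartzMap.smulLeftCLM ℂ (chirp (1 / (4 * τ))) (𝓕 G) := by
  have hpi := Real.pi_pos
  have hpi' : (Real.pi : ℂ) ≠ 0 := by exact_mod_cast hpi.ne'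
  have hτ' : (τ : ℂ) ≠ 0 := by exact_mod_cast hτ
  have hρ : 4 * Real.pi * τ ≠ 0 := by positivity
  ext y
  rw [fourier_chirp_fourierInv_apply hτ, SchwartzMap.smulLeftCLM_apply_apply (by fun_prop),
    SchwartzMap.fourier_coe, Real.fourier_eq']
  have h := Measure.integral_comp_smul (volume : Measure Plane)
    (fun z => phase (1 / (4 * τ)) y z * chirpDil hτ G z) (4 * Real.pi * τ)
  rw [finrank_euclideanSpace, Fintype.card_fin, abs_of_nonneg (by positivity)] at h
  have h2 : ∫ z, phase (1 / (4 * τ)) y z * chirpDil hτ G z = (((4 * Real.pi * τ) ^ 2 : ℝ) : ℂ) *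
      ∫ X, phase (1 / (4 * τ)) y ((4 * Real.pi * τ) • X) *
        chirpDil hτ G ((4 * Real.pi * τ) • X) := by
    rw [h, Complex.real_smul, ← mul_assoc, ← Complex.ofReal_mul, mul_inv_cancel₀ (by positivity)]
    simp
  rw [h2, ← integral_const_mul, ← integral_const_mul, smul_eq_mul, ← integral_const_mul]
  refine integral_congr_ae (Eventually.of_forall fun X => ?_)
  have h3 := phase_mul_chirp τ hτ y X
  simp only [chirpDil_apply, smul_smul, inv_mul_cancel₀ hρ, one_smul, smul_eq_mul]
  rw [← mul_assoc (chirp (1 / (4 * τ)) y), ← h3]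
  push_cast
  field_simp

lemma chirpDil_eq {τ : ℝ} (hτ : τ ≠ 0) (G : 𝓢(Plane, ℂ)) :
    chirpDil hτ G = 𝓕 (SchwartzMap.smulLeftCLM ℂ (chirp (4 * Real.pi ^ 2 * τ))
      (𝓕⁻ (SchwartzMap.smulLeftCLM ℂ (chirp (1 / (4 * τ))) (𝓕 G)))) := by
  rw [← fourier_chirp_fourierInv_chirpDil hτ, FourierTransform.fourierInv_fourier_eq,
    smulLeft_chirp_neg, FourierTransform.fourier_fourierInv_eq]

/-- The transposed form of the fact that the pseudoconformal transform turns `J_k` into a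
derivative: differentiating the dilated chirp produces the coordinate. -/
lemma chirpDil_lineDeriv {τ : ℝ} (hτ : τ ≠ 0) (k : Fin 2) (G : 𝓢(Plane, ℂ)) :
    chirpDil hτ (∂_{e k} G) = ((4 * Real.pi * τ : ℝ) : ℂ) • ∂_{e k} (chirpDil hτ G) +
      (2 * Real.pi * Complex.I) • SchwartzMap.smulLeftCLM ℂ (coord k) (chirpDil hτ G) := by
  have hpi := Real.pi_pos
  have hpi' : (Real.pi : ℂ) ≠ 0 := by exact_mod_cast hpi.ne'
  have hτ' : (τ : ℂ) ≠ 0 := by exact_mod_cast hτ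
  ext x
  set r : ℝ := (4 * Real.pi * τ)⁻¹ with hr
  have hfun : (chirpDil hτ G : Plane → ℂ) = fun x => ((r : ℝ) * Complex.I : ℂ) *
      (chirp (-(4 * Real.pi ^ 2 * τ)) (r • x) * G (r • x)) := funext (chirpDil_apply hτ G)
  have hs : HasFDerivAt (fun x : Plane => r • x) (r • ContinuousLinearMap.id ℝ Plane) x :=
    (hasFDerivAt_id x).const_smul r
  have hph := (hasFDerivAt_phase (-(4 * Real.pi ^ 2 * τ)) 0 (r • x)).comp x hs
  have hph' : phase (-(4 * Real.pi ^ 2 * τ)) 0 = chirp (-(4 * Real.pi ^ 2 * τ)) := by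
    ext y
    rw [phase_eq_chirp, sub_zero]
  have hG := (G.hasFDerivAt (r • x)).comp x hs
  have hd := (hph.fun_mul hG).const_mul ((r : ℝ) * Complex.I : ℂ)
  simp only [Function.comp_apply, hph'] at hd
  have hsum : ∀ (a b : 𝓢(Plane, ℂ)), (a + b) x = a x + b x := fun _ _ => rfl
  have hsm : ∀ (c : ℂ) (a : 𝓢(Plane, ℂ)), (c • a) x = c * a x := fun _ _ => rfl
  rw [hsum, hsm, hsm, SchwartzMap.smulLeftCLM_apply_apply (by fun_prop), chirpDil_apply,
    chirpDil_apply, SchwartzMap.lineDerivOp_apply_eq_fderiv,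
    SchwartzMap.lineDerivOp_apply_eq_fderiv, hfun, hd.fderiv]
  simp only [smul_apply, add_apply, ContinuousLinearMap.comp_apply, smul_eq_mul,
    ContinuousLinearMap.id_apply, map_smul, dsq_apply, Complex.real_smul, Complex.ofRealCLM_apply,
    sub_zero, PiLp.smul_apply, coord, ← hr]
  rw [hr]
  push_cast
  field_simp
  ring

/-! ### The free propagator on tempered distributions -/

/-- The inverse free propagator `e^{-iτΔ}` on tempered distributions. -/
def freeInv (τ : ℝ) (T : 𝓢'(Plane, ℂ)) : 𝓢'(Plane, ℂ) :=
  𝓕⁻ (TemperedDistribution.smulLeftCLM ℂ (chirp (4 * Real.pi ^ 2 * τ)) (𝓕 T))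

/-- The transpose of `chirpDil`: `T ↦ ρ θ T(ρ x)`. -/
def pseudoconf {τ : ℝ} (hτ : τ ≠ 0) : 𝓢'(Plane, ℂ) →L[ℂ] 𝓢'(Plane, ℂ) :=
  PointwiseConvergenceCLM.precomp _ (chirpDil hτ)

lemma pseudoconf_apply {τ : ℝ} (hτ : τ ≠ 0) (T : 𝓢'(Plane, ℂ)) (G : 𝓢(Plane, ℂ)) :
    pseudoconf hτ T G = T (chirpDil hτ G) := rfl

/-- The pseudoconformal transform is the Fourier transform of the chirped profile. -/
lemma pseudoconf_eq {τ : ℝ} (hτ : τ ≠ 0) (T : 𝓢'(Plane, ℂ)) :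
    pseudoconf hτ T =
      𝓕 (TemperedDistribution.smulLeftCLM ℂ (chirp (1 / (4 * τ))) (freeInv τ T)) := by
  ext G
  rw [pseudoconf_apply, chirpDil_eq]
  rfl

lemma lineDeriv_pseudoconf {τ : ℝ} (hτ : τ ≠ 0) (k : Fin 2) (T : 𝓢'(Plane, ℂ)) :
    ∂_{e k} (pseudoconf hτ T) = (-(2 * Real.pi * Complex.I)) • pseudoconf hτ (opJ τ k T) := by
  ext G
  have h1 : ∂_{e k} (pseudoconf hτ T) G = T (chirpDil hτ (-∂_{e k} G)) := rfl
  have h2 : ((-(2 * Real.pi * Complex.I)) • pseudoconf hτ (opJ τ k T)) G =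
    (-(2 * Real.pi * Complex.I)) * (T (SchwartzMap.smulLeftCLM ℂ (coord k) (chirpDil hτ G)) +
      (2 * Complex.I * (τ : ℂ)) * T (-∂_{e k} (chirpDil hτ G))) := rfl
  rw [h1, h2, map_neg, map_neg, chirpDil_lineDeriv, map_add, map_smul, map_smul, map_neg,
    smul_eq_mul, smul_eq_mul]
  push_cast
  linear_combination (-4 * (Real.pi : ℂ) * τ * T (∂_{e k} (chirpDil hτ G))) * Complex.I_sq

lemma smulLeft_chirp_neg' (c : ℝ) (T : 𝓢'(Plane, ℂ)) :
    TemperedDistribution.smulLeftCLM ℂ (chirp (-c))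
      (TemperedDistribution.smulLeftCLM ℂ (chirp c) T) = T := by
  ext G
  rw [TemperedDistribution.smulLeftCLM_apply_apply, TemperedDistribution.smulLeftCLM_apply_apply,
    smulLeft_chirp_neg]

lemma smulLeft_comm {g₁ g₂ : Plane → ℂ} (h₁ : g₁.HasTemperateGrowth) (h₂ : g₂.HasTemperateGrowth)
    (T : 𝓢'(Plane, ℂ)) : TemperedDistribution.smulLeftCLM ℂ g₁
      (TemperedDistribution.smulLeftCLM ℂ g₂ T) =
      TemperedDistribution.smulLeftCLM ℂ g₂ (TemperedDistribution.smulLeftCLM ℂ g₁ T) := by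
  rw [TemperedDistribution.smulLeftCLM_smulLeftCLM_apply h₂ h₁,
    TemperedDistribution.smulLeftCLM_smulLeftCLM_apply h₁ h₂, mul_comm]

lemma inner_e_eq_coord (k : Fin 2) : (fun x : Plane => ((inner ℝ x (e k) : ℝ) : ℂ)) = coord k := by
  ext x
  simp [coord, e, EuclideanSpace.inner_single_right]

/-- The free propagator conjugates multiplication by `x_k` to `J_k`. -/
lemma coord_smul_freeInv {τ : ℝ} (hτ : τ ≠ 0) (k : Fin 2) (T : 𝓢'(Plane, ℂ)) :
    TemperedDistribution.smulLeftCLM ℂ (coord k) (freeInv τ T) = freeInv τ (opJ τ k T) := by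
  have hpi' : (Real.pi : ℂ) ≠ 0 := by exact_mod_cast Real.pi_ne_zero
  have h := lineDeriv_pseudoconf hτ k T
  rw [pseudoconf_eq, pseudoconf_eq, TemperedDistribution.lineDerivOp_fourier_eq, inner_e_eq_coord,
    FourierTransform.fourier_smul] at h
  have h3 : 𝓕 (TemperedDistribution.smulLeftCLM ℂ (coord k)
      (TemperedDistribution.smulLeftCLM ℂ (chirp (1 / (4 * τ))) (freeInv τ T))) =
      𝓕 (TemperedDistribution.smulLeftCLM ℂ (chirp (1 / (4 * τ))) (freeInv τ (opJ τ k T))) := by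
    ext G
    have hG := DFunLike.congr_fun h G
    exact mul_left_cancel₀ (by simp [hpi'] : -(2 * (Real.pi : ℂ) * Complex.I) ≠ 0) hG
  have h4 := congrArg (fun S : 𝓢'(Plane, ℂ) => 𝓕⁻ S) h3
  simp only [FourierTransform.fourierInv_fourier_eq] at h4
  rw [smulLeft_comm (by fun_prop) (by fun_prop)] at h4
  -- The chirp commutes with the coordinate, so it can be stripped from both sides after Fourier
  -- inversion.
  have h5 := congrArg (TemperedDistribution.smulLeftCLM ℂ (chirp (-(1 / (4 * τ))))) h4
  rwa [smulLeft_chirp_neg', smulLeft_chirp_neg'] at h5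


/-! ### Square-integrable tempered distributions -/

lemma measurable_L2 (u : L2) : Measurable u := (Lp.stronglyMeasurable u).measurable

@[fun_prop]
lemma measurable_enorm_L2 (u : L2) : Measurable fun x => ‖u x‖ₑ := (measurable_L2 u).enorm

lemma enorm_L2_eq_N2 (u : L2) : ‖u‖ₑ = N2 fun x => ‖u x‖ₑ := by
  rw [Lp.enorm_def, N2_enorm]

lemma locallyIntegrable_L2 (u : L2) : LocallyIntegrable u :=
  (Lp.memLp u).locallyIntegrable one_le_two

lemma coe_injective {u v : L2} (h : (u : 𝓢'(Plane, ℂ)) = v) : u = v := by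
  have hk := Lp.ker_toTemperedDistributionCLM_eq_bot (E := Plane) (F := ℂ)
    (μ := volume) (p := 2)
  exact LinearMap.ker_eq_bot.mp hk h

lemma coe_add (u v : L2) : ((u + v : L2) : 𝓢'(Plane, ℂ)) = (u : 𝓢'(Plane, ℂ)) + v :=
  map_add (Lp.toTemperedDistributionCLM ℂ (volume : Measure Plane) 2) u v

lemma coe_smul (c : ℂ) (u : L2) : ((c • u : L2) : 𝓢'(Plane, ℂ)) = c • (u : 𝓢'(Plane, ℂ)) :=
  map_smul (Lp.toTemperedDistributionCLM ℂ (volume : Measure Plane) 2) c u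

lemma coe_sub (u v : L2) : ((u - v : L2) : 𝓢'(Plane, ℂ)) = (u : 𝓢'(Plane, ℂ)) - v :=
  map_sub (Lp.toTemperedDistributionCLM ℂ (volume : Measure Plane) 2) u v

lemma l2Rep_coe (u : L2) : l2Rep (u : 𝓢'(Plane, ℂ)) = u := by
  have h : ∃ v : L2, (v : 𝓢'(Plane, ℂ)) = u := ⟨u, rfl⟩
  unfold l2Rep
  rw [dif_pos h]
  exact coe_injective h.choose_spec

/-- An `L²` representative is unique, so the infimum is over a single function. -/
lemma l2Norm_coe (u : L2) : l2Norm (u : 𝓢'(Plane, ℂ)) = ‖u‖ₑ := by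
  unfold l2Norm
  refine le_antisymm ((iInf_le _ u).trans (iInf_le _ rfl)) (le_iInf₂ fun v hv => ?_)
  rw [coe_injective hv]

lemma exists_L2_of_l2Norm_lt_top {T : 𝓢'(Plane, ℂ)} (h : l2Norm T < ∞) :
    ∃ u : L2, (u : 𝓢'(Plane, ℂ)) = T := by
  by_contra hc
  push Not at hc
  refine h.ne ?_
  unfold l2Norm
  simp [hc]

lemma l2Norm_add_le (S T : 𝓢'(Plane, ℂ)) : l2Norm (S + T) ≤ l2Norm S + l2Norm T := by
  by_cases hS : l2Norm S < ∞
  · by_cases hT : l2Norm T < ∞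
    · obtain ⟨u, rfl⟩ := exists_L2_of_l2Norm_lt_top hS
      obtain ⟨v, rfl⟩ := exists_L2_of_l2Norm_lt_top hT
      rw [← coe_add, l2Norm_coe, l2Norm_coe, l2Norm_coe]
      exact enorm_add_le u v
    · simp [not_lt_top_iff.mp hT]
  · simp [not_lt_top_iff.mp hS]

lemma l2Norm_smul_le {c : ℂ} (hc : c ≠ 0) (T : 𝓢'(Plane, ℂ)) :
    l2Norm (c • T) ≤ ‖c‖ₑ * l2Norm T := by
  by_cases hT : l2Norm T < ∞
  · obtain ⟨v, rfl⟩ := exists_L2_of_l2Norm_lt_top hT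
    rw [← coe_smul, l2Norm_coe, l2Norm_coe, enorm_smul]
  · rw [not_lt_top_iff.mp hT, ENNReal.mul_top (by simpa using hc)]
    exact le_top

lemma ae_eq_of_integral_schwartz {u v : Plane → ℂ} (hu : LocallyIntegrable u)
    (hv : LocallyIntegrable v) (h : ∀ G : 𝓢(Plane, ℂ), ∫ x, G x * u x = ∫ x, G x * v x) :
    u =ᵐ[volume] v := by
  refine ae_eq_of_integral_contDiff_smul_eq hu hv fun g hg hc => ?_
  have hg₁ : HasCompactSupport (Complex.ofRealCLM ∘ g) := hc.comp_left rfl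
  have hg₂ : ContDiff ℝ (⊤ : ℕ∞) (Complex.ofRealCLM ∘ g) := by fun_prop
  have := h (hg₁.toSchwartzMap hg₂)
  simpa using! this

lemma coe_apply (u : L2) (G : 𝓢(Plane, ℂ)) : (u : 𝓢'(Plane, ℂ)) G = ∫ x, G x * u x :=
  Lp.toTemperedDistribution_apply u G

/-- If multiplication by `h` maps `u` to `v` in the sense of distributions, then it does so almost
everywhere. -/
lemma ae_eq_of_smulLeft_eq {h : Plane → ℂ} (hh : h.HasTemperateGrowth) {u v : L2}
    (H : TemperedDistribution.smulLeftCLM ℂ h (u : 𝓢'(Plane, ℂ)) = v) :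
    v =ᵐ[volume] fun x => h x * u x := by
  refine ae_eq_of_integral_schwartz (locallyIntegrable_L2 v) ?_ fun G => ?_
  · have := (locallyIntegrable_L2 u).mul_continuous hh.1.continuous
    simpa only [mul_comm] using this
  · rw [← coe_apply, ← H, TemperedDistribution.smulLeftCLM_apply_apply, coe_apply]
    refine integral_congr_ae (Eventually.of_forall fun x => ?_)
    simp only
    rw [SchwartzMap.smulLeftCLM_apply_apply hh, smul_eq_mul]
    ring

lemma smulLeft_coe_of_ae_eq {h : Plane → ℂ} (hh : h.HasTemperateGrowth) {u v : L2}
    (H : v =ᵐ[volume] fun x => h x * u x) :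
    TemperedDistribution.smulLeftCLM ℂ h (u : 𝓢'(Plane, ℂ)) = v := by
  ext G
  rw [TemperedDistribution.smulLeftCLM_apply_apply, coe_apply, coe_apply]
  refine integral_congr_ae ?_
  filter_upwards [H] with x hx
  rw [SchwartzMap.smulLeftCLM_apply_apply hh, smul_eq_mul, hx]
  ring

lemma memLp_chirp_mul (c : ℝ) (u : L2) : MemLp (fun x => chirp c x * u x) 2 :=
  (Lp.memLp u).of_le ((continuous_chirp c).aestronglyMeasurable.mul
    (Lp.aestronglyMeasurable u)) (Eventually.of_forall fun x => by
      rw [norm_mul, norm_chirp, one_mul])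

/-- Multiplication by a chirp on `L²`. -/
def chirpMul (c : ℝ) (u : L2) : L2 := (memLp_chirp_mul c u).toLp

lemma chirpMul_ae (c : ℝ) (u : L2) : chirpMul c u =ᵐ[volume] fun x => chirp c x * u x :=
  MemLp.coeFn_toLp _

lemma coe_chirpMul (c : ℝ) (u : L2) :
    TemperedDistribution.smulLeftCLM ℂ (chirp c) (u : 𝓢'(Plane, ℂ)) = chirpMul c u :=
  smulLeft_coe_of_ae_eq (hasTemperateGrowth_chirp c) (chirpMul_ae c u)

lemma enorm_chirpMul (c : ℝ) (u : L2) : ‖chirpMul c u‖ₑ = ‖u‖ₑ := by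
  unfold chirpMul
  rw [Lp.enorm_toLp, Lp.enorm_def]
  refine eLpNorm_congr_norm_ae (Eventually.of_forall fun x => ?_)
  rw [norm_mul, norm_chirp, one_mul]

/-- The inverse free propagator on `L²`. -/
def freeInvL2 (τ : ℝ) (u : L2) : L2 := 𝓕⁻ (chirpMul (4 * Real.pi ^ 2 * τ) (𝓕 u))

lemma coe_freeInvL2 (τ : ℝ) (u : L2) :
    (freeInvL2 τ u : 𝓢'(Plane, ℂ)) = freeInv τ (u : 𝓢'(Plane, ℂ)) := by
  unfold freeInvL2 freeInv
  rw [← Lp.fourierInv_toTemperedDistribution_eq, ← coe_chirpMul,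
    Lp.fourier_toTemperedDistribution_eq]

lemma fourier_freeInvL2 (τ : ℝ) (u : L2) :
    𝓕 (freeInvL2 τ u) = chirpMul (4 * Real.pi ^ 2 * τ) (𝓕 u) :=
  FourierTransform.fourier_fourierInv_eq _

lemma enorm_freeInvL2 (τ : ℝ) (u : L2) : ‖freeInvL2 τ u‖ₑ = ‖u‖ₑ := by
  have h1 : ‖freeInvL2 τ u‖ₑ = ‖chirpMul (4 * Real.pi ^ 2 * τ) (𝓕 u)‖ₑ := by
    rw [← ofReal_norm, ← ofReal_norm, ← fourier_freeInvL2, Lp.norm_fourier_eq]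
  rw [h1, enorm_chirpMul, ← ofReal_norm, ← ofReal_norm, Lp.norm_fourier_eq]

/-! ### The weighted norm of the profile and the operators `J_k` -/

/-- The norm `‖f‖ + ‖|y|² f‖`. -/
def wNorm (f : Plane → ℂ) : ℝ≥0∞ := N2 (fun y => ‖f y‖ₑ) + N2 fun y => ‖y‖ₑ ^ 2 * ‖f y‖ₑ

lemma enorm_sq_le (y : Plane) : ‖y‖ₑ ^ 2 = ‖coord 0 y ^ 2 + coord 1 y ^ 2‖ₑ := by
  have h : coord 0 y ^ 2 + coord 1 y ^ 2 = ((‖y‖ ^ 2 : ℝ) : ℂ) := by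
    rw [EuclideanSpace.norm_sq_eq, Fin.sum_univ_two]
    simp [coord]
  rw [h, ← ofReal_norm, ← ofReal_norm, Complex.norm_real, Real.norm_of_nonneg (by positivity),
    ENNReal.ofReal_pow (norm_nonneg _)]

lemma le_vecNorm {ι : Type} [Fintype ι] (a : ι → ℝ≥0∞) (i : ι) : a i ≤ vecNorm a := by
  unfold vecNorm
  calc a i = (a i ^ (2 : ℝ)) ^ (1 / 2 : ℝ) := by
        rw [← ENNReal.rpow_mul]
        norm_num
    _ ≤ _ := by
        gcongr
        exact Finset.single_le_sum (f := fun i => a i ^ (2 : ℝ)) (fun _ _ => zero_le)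
          (Finset.mem_univ i)

lemma l2Norm_freeInv_le (τ : ℝ) {T : 𝓢'(Plane, ℂ)} (h : l2Norm T < ∞) :
    ∃ g : L2, (g : 𝓢'(Plane, ℂ)) = freeInv τ T ∧ ‖g‖ₑ = l2Norm T := by
  obtain ⟨u, rfl⟩ := exists_L2_of_l2Norm_lt_top h
  exact ⟨freeInvL2 τ u, coe_freeInvL2 τ u, by rw [enorm_freeInvL2, l2Norm_coe]⟩

/-- Since `|y|² = y₁² + y₂²`, only the pure squares `J_k J_k` matter. The free propagator is unitary
and turns `J_k` into multiplication by `y_k`. -/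
lemma N2_sq_mul_le_of_l2Norm {τ : ℝ} (hτ : τ ≠ 0) (u : L2) {b : ℝ≥0∞} (hb : b < ∞)
    (h : ∀ k, l2Norm (opJ τ k (opJ τ k (u : 𝓢'(Plane, ℂ)))) ≤ b) :
    N2 (fun y => ‖y‖ₑ ^ 2 * ‖freeInvL2 τ u y‖ₑ) ≤ 2 * b := by
  have hk : ∀ k : Fin 2, ∃ g : L2, ‖g‖ₑ ≤ b ∧
      g =ᵐ[volume] fun y => coord k y ^ 2 * freeInvL2 τ u y := by
    intro k
    obtain ⟨g, hg, hgn⟩ := l2Norm_freeInv_le τ ((h k).trans_lt hb)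
    refine ⟨g, hgn.le.trans (h k), ?_⟩
    refine ae_eq_of_smulLeft_eq (h := fun y => coord k y ^ 2) (by fun_prop) ?_
    rw [hg, ← coord_smul_freeInv hτ, ← coord_smul_freeInv hτ, ← coe_freeInvL2,
      TemperedDistribution.smulLeftCLM_smulLeftCLM_apply (by fun_prop) (by fun_prop)]
    congr 2
    ext y
    simp [sq]
  obtain ⟨g0, n0, h0⟩ := hk 0
  obtain ⟨g1, n1, h1⟩ := hk 1
  calc N2 (fun y => ‖y‖ₑ ^ 2 * ‖freeInvL2 τ u y‖ₑ)
      ≤ N2 (fun y => ‖g0 y‖ₑ + ‖g1 y‖ₑ) := by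
        refine N2_mono_ae ?_
        filter_upwards [h0, h1] with y e0 e1
        rw [e0, e1, enorm_sq_le, ← enorm_mul, add_mul]
        exact enorm_add_le _ _
    _ ≤ ‖g0‖ₑ + ‖g1‖ₑ := by
        rw [enorm_L2_eq_N2, enorm_L2_eq_N2]
        exact N2_add_le (by fun_prop) (by fun_prop)
    _ ≤ b + b := add_le_add n0 n1
    _ = 2 * b := (two_mul b).symm

lemma distrib_add_apply (S T : 𝓢'(Plane, ℂ)) (G : 𝓢(Plane, ℂ)) : (S + T) G = S G + T G := rfl

lemma distrib_smul_apply (c : ℂ) (T : 𝓢'(Plane, ℂ)) (G : 𝓢(Plane, ℂ)) : (c • T) G = c * T G := rfl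

lemma lineDeriv_opJ (t : ℝ) (k : Fin 2) (T : 𝓢'(Plane, ℂ)) :
    ∂_{e k} (opJ t k T) = T + opJ t k (∂_{e k} T) := by
  ext G
  have h1 : ∂_{e k} (opJ t k T) G =
    T (SchwartzMap.smulLeftCLM ℂ (coord k) (-∂_{e k} G)) +
      (2 * Complex.I * (t : ℂ)) * T (-∂_{e k} (-∂_{e k} G)) := rfl
  have h2 : (T + opJ t k (∂_{e k} T)) G = T G +
    (T (-∂_{e k} (SchwartzMap.smulLeftCLM ℂ (coord k) G)) +
      (2 * Complex.I * (t : ℂ)) * T (-∂_{e k} (-∂_{e k} G))) := rfl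
  have h3 : SchwartzMap.smulLeftCLM ℂ (coord k) (-∂_{e k} G) =
      G + -∂_{e k} (SchwartzMap.smulLeftCLM ℂ (coord k) G) := by
    ext x
    have hsum : ∀ (a b : 𝓢(Plane, ℂ)), (a + b) x = a x + b x := fun _ _ => rfl
    have hneg : ∀ (a : 𝓢(Plane, ℂ)), (-a) x = -a x := fun _ => rfl
    have hfun : (SchwartzMap.smulLeftCLM ℂ (coord k) G : Plane → ℂ) = fun x => coord k x * G x :=
      funext fun y => SchwartzMap.smulLeftCLM_apply_apply (by fun_prop) G y
    have hc : HasFDerivAt (coord k)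
        (Complex.ofRealCLM.comp (EuclideanSpace.proj k : Plane →L[ℝ] ℝ)) x :=
      (Complex.ofRealCLM.comp (EuclideanSpace.proj k : Plane →L[ℝ] ℝ)).hasFDerivAt
    rw [hsum, hneg, SchwartzMap.smulLeftCLM_apply_apply (by fun_prop), hneg,
      SchwartzMap.lineDerivOp_apply_eq_fderiv, SchwartzMap.lineDerivOp_apply_eq_fderiv, hfun,
      (hc.fun_mul (G.hasFDerivAt x)).fderiv]
    simp [e]
  rw [h1, h2, h3, map_add]
  ring

lemma opJ_add_time (t s : ℝ) (k : Fin 2) (T : 𝓢'(Plane, ℂ)) :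
    opJ (t + s) k T = opJ t k T + (2 * Complex.I * (s : ℂ)) • ∂_{e k} T := by
  ext G
  simp only [opJ, distrib_add_apply, distrib_smul_apply]
  push_cast
  ring

lemma opJ_add (t : ℝ) (k : Fin 2) (S T : 𝓢'(Plane, ℂ)) :
    opJ t k (S + T) = opJ t k S + opJ t k T := by
  unfold opJ
  rw [map_add, LineDeriv.lineDerivOp_add, smul_add]
  abel

lemma opJ_smul (t : ℝ) (k : Fin 2) (c : ℂ) (T : 𝓢'(Plane, ℂ)) :
    opJ t k (c • T) = c • opJ t k T := by
  unfold opJ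
  rw [map_smul, LineDeriv.lineDerivOp_smul, smul_add, smul_comm]

/-- `J_k` at time `t + s` is `J_k` at time `t` plus `2is ∂_k`. Squaring produces both orders of
`J_k` and `∂_k`, and their commutator accounts for the term `T`. -/
lemma opJ_opJ_add_time (t s : ℝ) (k : Fin 2) (T : 𝓢'(Plane, ℂ)) :
    opJ (t + s) k (opJ (t + s) k T) = opJ t k (opJ t k T)
      + ((2 * Complex.I * (s : ℂ)) • (T + (2 : ℂ) • opJ t k (∂_{e k} T))
        + (2 * Complex.I * (s : ℂ)) ^ 2 • ∂_{e k} (∂_{e k} T)) := by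
  rw [opJ_add_time, opJ_add_time t s k T, opJ_add, opJ_smul, LineDeriv.lineDerivOp_add,
    LineDeriv.lineDerivOp_smul, lineDeriv_opJ]
  ext G
  simp only [distrib_add_apply, distrib_smul_apply]
  ring

/-- The weighted bound on the profile given by the gauge bounds. -/
lemma GaugeBounds.wNorm_le {K t σ : ℝ} {u : L2} (hK : 0 ≤ K) (h : GaugeBounds K t u)
    (hσ : σ = 1 ∨ σ = -1) (hτ : t + σ ≠ 0) :
    wNorm (freeInvL2 (t + σ) u) ≤ ENNReal.ofReal (100 * K * Real.log (2 + |t|) ^ 2) := by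
  set L := Real.log (2 + |t|) with hL
  have hL2 : 1 / 2 ≤ L := by
    have h2 : Real.log 2 ≤ L := Real.log_le_log (by norm_num) (by linarith [abs_nonneg t])
    linarith [Real.log_two_gt_d9]
  have hs : ‖2 * Complex.I * (σ : ℂ)‖ₑ = 2 := by
    rw [← ofReal_norm]
    rcases hσ with rfl | rfl <;> simp
  have hs0 : 2 * Complex.I * (σ : ℂ) ≠ 0 := by
    rcases hσ with rfl | rfl <;> simp
  have b0 : l2Norm (u : 𝓢'(Plane, ℂ)) ≤ ENNReal.ofReal K :=
    (le_self_add.trans le_self_add).trans h.sobolev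
  have b1 : ∀ k, l2Norm (opJ t k (∂_{e k} (u : 𝓢'(Plane, ℂ)))) ≤ ENNReal.ofReal (K * L) := fun k =>
    ((le_vecNorm (fun p : Fin 2 × Fin 2 => l2Norm (opJ t p.1 (∂_{e p.2} (u : 𝓢'(Plane, ℂ)))))
      (k, k)).trans le_add_self).trans h.weighted
  have b2 : ∀ k, l2Norm (∂_{e k} (∂_{e k} (u : 𝓢'(Plane, ℂ)))) ≤ ENNReal.ofReal K := fun k =>
    ((le_vecNorm (fun p : Fin 2 × Fin 2 => l2Norm (∂_{e p.1} (∂_{e p.2} (u : 𝓢'(Plane, ℂ)))))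
      (k, k)).trans le_add_self).trans h.sobolev
  have b3 : ∀ k, l2Norm (opJ t k (opJ t k (u : 𝓢'(Plane, ℂ)))) ≤ ENNReal.ofReal (K * L ^ 2) :=
    fun k => (le_vecNorm (fun p : Fin 2 × Fin 2 =>
      l2Norm (opJ t p.1 (opJ t p.2 (u : 𝓢'(Plane, ℂ))))) (k, k)).trans h.weighted_two
  -- With `|s| = 1` the expansion gives `K(L² + 4L + 6)`. Since `L ≥ log 2 > 1/2`, one has `1 ≤ 4L²`
  -- and `L ≤ 2L²`, whence `1 + 8 + 24 = 33`.
  have b4 : ∀ k, l2Norm (opJ (t + σ) k (opJ (t + σ) k (u : 𝓢'(Plane, ℂ)))) ≤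
      ENNReal.ofReal (33 * (K * L ^ 2)) := by
    intro k
    rw [opJ_opJ_add_time]
    calc _ ≤ ENNReal.ofReal (K * L ^ 2)
          + (2 * (ENNReal.ofReal K + 2 * ENNReal.ofReal (K * L)) + 2 ^ 2 * ENNReal.ofReal K) := by
          refine (l2Norm_add_le _ _).trans (add_le_add (b3 k) ((l2Norm_add_le _ _).trans
            (add_le_add ?_ ?_)))
          · refine (l2Norm_smul_le hs0 _).trans ?_
            rw [hs]
            gcongr
            refine (l2Norm_add_le _ _).trans (add_le_add b0 ((l2Norm_smul_le two_ne_zero _).trans ?_))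
            refine mul_le_mul' (le_of_eq ?_) (b1 k)
            rw [← ofReal_norm]
            simp
          · refine (l2Norm_smul_le (pow_ne_zero 2 hs0) _).trans ?_
            rw [enorm_pow, hs]
            gcongr
            exact b2 k
      _ = ENNReal.ofReal (K * L ^ 2 + (2 * (K + 2 * (K * L)) + 2 ^ 2 * K)) := by
          have e2 : (2 : ℝ≥0∞) = ENNReal.ofReal 2 := by norm_num
          rw [e2, ← ENNReal.ofReal_pow (by norm_num), ← ENNReal.ofReal_mul (by norm_num),
            ← ENNReal.ofReal_add (by positivity) (by positivity),
            ← ENNReal.ofReal_mul (by norm_num), ← ENNReal.ofReal_mul (by norm_num),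
            ← ENNReal.ofReal_add (by positivity) (by positivity),
            ← ENNReal.ofReal_add (by positivity) (by positivity)]
      _ ≤ _ := by
          refine ENNReal.ofReal_le_ofReal ?_
          have h1 : 1 ≤ 4 * L ^ 2 := by nlinarith
          have h2 : L ≤ 2 * L ^ 2 := by nlinarith
          nlinarith [mul_le_mul_of_nonneg_left h1 hK, mul_le_mul_of_nonneg_left h2 hK]
  have h5 := N2_sq_mul_le_of_l2Norm hτ u ENNReal.ofReal_lt_top b4
  unfold wNorm
  rw [← enorm_L2_eq_N2, enorm_freeInvL2, ← l2Norm_coe]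
  refine (add_le_add b0 h5).trans ?_
  rw [show (2 : ℝ≥0∞) = ENNReal.ofReal 2 by norm_num, ← ENNReal.ofReal_mul (by norm_num),
    ← ENNReal.ofReal_add (by positivity) (by positivity)]
  refine ENNReal.ofReal_le_ofReal ?_
  have h1 : 1 ≤ 4 * L ^ 2 := by nlinarith
  nlinarith [mul_le_mul_of_nonneg_left h1 hK]


/-! ### The pseudoconformal transform of functions -/

lemma quasiMeasurePreserving_smul {r : ℝ} (hr : r ≠ 0) :
    Measure.QuasiMeasurePreserving (fun X : Plane => r • X) := by
  refine ⟨by fun_prop, ?_⟩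
  rw [Measure.map_addHaar_smul volume hr]
  exact Measure.smul_absolutelyContinuous

lemma ae_comp_smul {p : Plane → Prop} (h : ∀ᵐ x, p x) {r : ℝ} (hr : r ≠ 0) :
    ∀ᵐ X : Plane, p (r • X) :=
  (quasiMeasurePreserving_smul hr).ae h

lemma integral_comp_smul_plane (f : Plane → ℂ) {r : ℝ} (hr : r ≠ 0) :
    ∫ X, f (r • X) = (((r ^ 2)⁻¹ : ℝ) : ℂ) * ∫ x, f x := by
  have h := Measure.integral_comp_smul (volume : Measure Plane) f r
  rw [finrank_euclideanSpace, Fintype.card_fin, abs_of_nonneg (by positivity)] at h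
  rw [h, Complex.real_smul]

lemma integral_comp_smul_plane_real (f : Plane → ℝ) (r : ℝ) :
    ∫ X, f (r • X) = (r ^ 2)⁻¹ * ∫ x, f x := by
  have h := Measure.integral_comp_smul (volume : Measure Plane) f r
  rw [finrank_euclideanSpace, Fintype.card_fin, abs_of_nonneg (by positivity)] at h
  rw [h, smul_eq_mul]

/-- The pseudoconformal transform `ρ θ u(ρ ·)`, with `ρ = 4 π τ` and
`θ = i e^{- 4 π² i τ |X|²}`. -/
def psc (τ : ℝ) (u : Plane → ℂ) (X : Plane) : ℂ :=
  ((4 * Real.pi * τ : ℝ) : ℂ) *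
    (Complex.I * chirp (-(4 * Real.pi ^ 2 * τ)) X * u ((4 * Real.pi * τ) • X))

lemma rho_ne_zero {τ : ℝ} (hτ : τ ≠ 0) : 4 * Real.pi * τ ≠ 0 := by
  have := Real.pi_ne_zero
  positivity

lemma norm_psc (τ : ℝ) (u : Plane → ℂ) (X : Plane) :
    ‖psc τ u X‖ = |4 * Real.pi * τ| * ‖u ((4 * Real.pi * τ) • X)‖ := by
  rw [psc, norm_mul, norm_mul, norm_mul, Complex.norm_I, norm_chirp, Complex.norm_real,
    Real.norm_eq_abs, one_mul, one_mul]

lemma memLp_psc {τ : ℝ} (hτ : τ ≠ 0) (u : L2) : MemLp (psc τ u) 2 := by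
  have hρ := rho_ne_zero hτ
  have h1 : AEStronglyMeasurable (fun X => u ((4 * Real.pi * τ) • X)) volume :=
    (Lp.aestronglyMeasurable u).comp_quasiMeasurePreserving (quasiMeasurePreserving_smul hρ)
  refine MemLp.of_le_mul (g := fun X => u ((4 * Real.pi * τ) • X)) (c := |4 * Real.pi * τ|)
    ⟨h1, ?_⟩ ?_ (Eventually.of_forall fun X => (norm_psc τ u X).le)
  · rw [← N2_enorm]
    unfold N2
    rw [lintegral_comp_smul_plane (fun x => ‖u x‖ₑ ^ (2 : ℝ)) hρ]
    have h2 : N2 (fun x => ‖u x‖ₑ) < ∞ := by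
      rw [N2_enorm]
      exact (Lp.memLp u).2
    refine ENNReal.rpow_lt_top_of_nonneg (by norm_num) (ENNReal.mul_ne_top (by simp) ?_)
    intro h3
    unfold N2 at h2
    rw [h3, ENNReal.top_rpow_of_pos (by norm_num)] at h2
    exact h2.ne rfl
  · unfold psc
    exact aestronglyMeasurable_const.mul ((aestronglyMeasurable_const.mul
      (continuous_chirp _).aestronglyMeasurable).mul h1)

/-- The pseudoconformal transform on `L²`. -/
def pscL2 {τ : ℝ} (hτ : τ ≠ 0) (u : L2) : L2 := (memLp_psc hτ u).toLp

lemma pscL2_ae {τ : ℝ} (hτ : τ ≠ 0) (u : L2) : pscL2 hτ u =ᵐ[volume] psc τ u :=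
  MemLp.coeFn_toLp _

lemma coe_pscL2 {τ : ℝ} (hτ : τ ≠ 0) (u : L2) :
    (pscL2 hτ u : 𝓢'(Plane, ℂ)) = pseudoconf hτ (u : 𝓢'(Plane, ℂ)) := by
  have hρ := rho_ne_zero hτ
  have hρ' : ((4 * Real.pi * τ : ℝ) : ℂ) ≠ 0 := by exact_mod_cast hρ
  ext G
  rw [pseudoconf_apply, coe_apply, coe_apply]
  have h := integral_comp_smul_plane (fun x => chirpDil hτ G x * u x) hρ
  have h2 : ∫ x, chirpDil hτ G x * u x = (((4 * Real.pi * τ) ^ 2 : ℝ) : ℂ) *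
      ∫ X, chirpDil hτ G ((4 * Real.pi * τ) • X) * u ((4 * Real.pi * τ) • X) := by
    rw [h, ← mul_assoc, ← Complex.ofReal_mul, mul_inv_cancel₀ (by positivity)]
    simp
  rw [h2, ← integral_const_mul]
  refine integral_congr_ae ?_
  filter_upwards [pscL2_ae hτ u] with X hX
  rw [hX, chirpDil_apply, smul_smul, inv_mul_cancel₀ hρ, one_smul, psc, Complex.ofReal_inv,
    Complex.ofReal_pow]
  field_simp

/-- The pseudoconformal transform of an `H²` function and of its gradient, as Fourier transforms of
the chirped profile `w`. -/
lemma fourier_chirpMul_freeInvL2 {τ : ℝ} (hτ : τ ≠ 0) (u : L2) :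
    𝓕 (chirpMul (1 / (4 * τ)) (freeInvL2 τ u)) = pscL2 hτ u := by
  refine coe_injective ?_
  rw [coe_pscL2, pseudoconf_eq, ← Lp.fourier_toTemperedDistribution_eq, ← coe_chirpMul,
    coe_freeInvL2]

lemma coe_partialL2 {k : Fin 2} {u : L2} (h : l2Norm (∂_{e k} (u : 𝓢'(Plane, ℂ))) < ∞) :
    (partialL2 k u : 𝓢'(Plane, ℂ)) = ∂_{e k} (u : 𝓢'(Plane, ℂ)) := by
  obtain ⟨v, hv⟩ := exists_L2_of_l2Norm_lt_top h
  rw [partialL2, ← hv, l2Rep_coe]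

lemma freeInvL2_surjective (τ : ℝ) (g : L2) : ∃ v, freeInvL2 τ v = g := by
  refine ⟨𝓕⁻ (chirpMul (-(4 * Real.pi ^ 2 * τ)) (𝓕 g)), ?_⟩
  unfold freeInvL2
  rw [FourierTransform.fourier_fourierInv_eq]
  have : chirpMul (4 * Real.pi ^ 2 * τ) (chirpMul (-(4 * Real.pi ^ 2 * τ)) (𝓕 g)) = 𝓕 g := by
    ext1
    filter_upwards [chirpMul_ae (4 * Real.pi ^ 2 * τ) (chirpMul (-(4 * Real.pi ^ 2 * τ)) (𝓕 g)),
      chirpMul_ae (-(4 * Real.pi ^ 2 * τ)) (𝓕 g)] with x h1 h2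
    rw [h1, h2, ← mul_assoc, chirp_mul_neg_apply, one_mul]
  rw [this, FourierTransform.fourierInv_fourier_eq]

lemma freeInv_injective (τ : ℝ) {S T : 𝓢'(Plane, ℂ)} (h : freeInv τ S = freeInv τ T) : S = T := by
  unfold freeInv at h
  have h1 := congrArg (fun R : 𝓢'(Plane, ℂ) => 𝓕 R) h
  simp only [FourierTransform.fourier_fourierInv_eq] at h1
  have h2 := congrArg (TemperedDistribution.smulLeftCLM ℂ (chirp (-(4 * Real.pi ^ 2 * τ)))) h1
  rw [smulLeft_chirp_neg', smulLeft_chirp_neg'] at h2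
  have h3 := congrArg (fun R : 𝓢'(Plane, ℂ) => 𝓕⁻ R) h2
  simpa only [FourierTransform.fourierInv_fourier_eq] using h3

lemma distrib_sub_apply (S T : 𝓢'(Plane, ℂ)) (G : 𝓢(Plane, ℂ)) : (S - T) G = S G - T G := rfl

/-- The gradient of the pseudoconformal transform. -/
lemma fourier_coord_chirpMul_freeInvL2 {τ : ℝ} (hτ : τ ≠ 0) (u : L2) (k : Fin 2)
    (hu : l2Norm (∂_{e k} (u : 𝓢'(Plane, ℂ))) < ∞) {wk : L2}
    (hwk : wk =ᵐ[volume] fun y => coord k y * chirpMul (1 / (4 * τ)) (freeInvL2 τ u) y) :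
    (∀ᵐ X, (-(2 * Real.pi * Complex.I)) * (𝓕 wk : L2) X = psc τ (fun x =>
      ((4 * Real.pi * τ : ℝ) : ℂ) * partialL2 k u x - 2 * Real.pi * Complex.I * coord k x * u x) X)
    ∧ MemLp (fun x => coord k x * u x) 2 := by
  -- `v` is the function whose profile is `y_k` times that of `u`, so `v = J_k u`. Consequently `x_k
  -- u = v - 2iτ ∂_k u` is in `L²`, which is the second conclusion.
  obtain ⟨v, hv⟩ := freeInvL2_surjective τ (chirpMul (-(1 / (4 * τ))) wk)
  have hwv : chirpMul (1 / (4 * τ)) (freeInvL2 τ v) = wk := by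
    ext1
    rw [hv]
    filter_upwards [chirpMul_ae (1 / (4 * τ)) (chirpMul (-(1 / (4 * τ))) wk),
      chirpMul_ae (-(1 / (4 * τ))) wk] with x h1 h2
    rw [h1, h2, ← mul_assoc, chirp_mul_neg_apply, one_mul]
  have hfv : freeInvL2 τ v =ᵐ[volume] fun y => coord k y * freeInvL2 τ u y := by
    filter_upwards [chirpMul_ae (1 / (4 * τ)) (freeInvL2 τ v), hwk,
      chirpMul_ae (1 / (4 * τ)) (freeInvL2 τ u)] with y h1 h2 h3
    rw [← hwv, h1, h3] at h2
    have h4 := chirp_mul_neg_apply (1 / (4 * τ)) y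
    linear_combination chirp (-(1 / (4 * τ))) y * h2
      + (coord k y * freeInvL2 τ u y - freeInvL2 τ v y) * h4
  have hJ : (v : 𝓢'(Plane, ℂ)) = opJ τ k (u : 𝓢'(Plane, ℂ)) := by
    refine freeInv_injective τ ?_
    rw [← coord_smul_freeInv hτ, ← coe_freeInvL2, ← coe_freeInvL2]
    exact (smulLeft_coe_of_ae_eq (by fun_prop) hfv).symm
  have hxu : TemperedDistribution.smulLeftCLM ℂ (coord k) (u : 𝓢'(Plane, ℂ)) =
      ((v - (2 * Complex.I * (τ : ℂ)) • partialL2 k u : L2) : 𝓢'(Plane, ℂ)) := by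
    rw [coe_sub, coe_smul, coe_partialL2 hu, hJ]
    ext G
    rw [opJ]
    simp only [distrib_sub_apply, distrib_add_apply, distrib_smul_apply]
    rw [add_sub_cancel_right]
    rfl
  have hae := ae_eq_of_smulLeft_eq (hasTemperateGrowth_coord k) hxu
  refine ⟨?_, (memLp_congr_ae hae).mp (Lp.memLp _)⟩
  have hF : 𝓕 wk = pscL2 hτ v := by
    rw [← hwv, fourier_chirpMul_freeInvL2]
  rw [hF]
  have hvv : ∀ᵐ x, v x = coord k x * u x + 2 * Complex.I * (τ : ℂ) * partialL2 k u x := by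
    filter_upwards [hae, Lp.coeFn_sub v ((2 * Complex.I * (τ : ℂ)) • partialL2 k u),
      Lp.coeFn_smul (2 * Complex.I * (τ : ℂ)) (partialL2 k u)] with x h1 h2 h3
    rw [← h1, h2, Pi.sub_apply, h3, Pi.smul_apply, smul_eq_mul]
    ring
  filter_upwards [pscL2_ae hτ v, ae_comp_smul hvv (rho_ne_zero hτ)] with X h1 h2
  rw [h1, psc, psc, h2]
  push_cast
  linear_combination (-(4 * (Real.pi : ℂ) * τ) * Complex.I * chirp (-(4 * Real.pi ^ 2 * τ)) X
    * (4 * Real.pi * τ) * partialL2 k u ((4 * Real.pi * τ) • X)) * Complex.I_sq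


/-! ### Covariance of the nonlinearity under the pseudoconformal transform -/

lemma gradInvLaplacian_const_mul (k : Fin 2) (c : ℝ) (h : Plane → ℝ) (x : Plane) :
    gradInvLaplacian k (fun y => c * h y) x = c * gradInvLaplacian k h x := by
  unfold gradInvLaplacian
  simp_rw [mul_left_comm _ c]
  rw [integral_const_mul]
  ring

lemma gradInvLaplacian_congr_ae (k : Fin 2) {h h' : Plane → ℝ} (H : h =ᵐ[volume] h') (x : Plane) :
    gradInvLaplacian k h x = gradInvLaplacian k h' x := by
  unfold gradInvLaplacian
  congr 1
  refine integral_congr_ae ?_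
  filter_upwards [H] with y hy
  rw [hy]

/-- The kernel is homogeneous of degree `-1` and the Jacobian is `r²`. -/
lemma gradInvLaplacian_comp_smul (k : Fin 2) (h : Plane → ℝ) {r : ℝ} (hr : r ≠ 0) (X : Plane) :
    gradInvLaplacian k (fun y => h (r • y)) X = r⁻¹ * gradInvLaplacian k h (r • X) := by
  unfold gradInvLaplacian
  have h1 := integral_comp_smul_plane_real
    (fun z => (r • X - z) k / ‖r • X - z‖ ^ 2 * h z) r
  have h2 : ∀ y : Plane, (r • X - r • y) k / ‖r • X - r • y‖ ^ 2 * h (r • y) =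
      r⁻¹ * ((X - y) k / ‖X - y‖ ^ 2 * h (r • y)) := by
    intro y
    rw [← smul_sub, norm_smul, mul_pow, Real.norm_eq_abs, sq_abs, PiLp.smul_apply, smul_eq_mul]
    by_cases hz : ‖X - y‖ = 0
    · simp [hz]
    · field_simp
  simp_rw [h2] at h1
  rw [integral_const_mul] at h1
  have h3 : ∫ y, (X - y) k / ‖X - y‖ ^ 2 * h (r • y) = r⁻¹ *
      ∫ z, (r • X - z) k / ‖r • X - z‖ ^ 2 * h z := by
    have : r * (r⁻¹ * ∫ y, (X - y) k / ‖X - y‖ ^ 2 * h (r • y)) = r * ((r ^ 2)⁻¹ *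
      ∫ z, (r • X - z) k / ‖r • X - z‖ ^ 2 * h z) := by rw [h1]
    rw [← mul_assoc, mul_inv_cancel₀ hr, one_mul] at this
    rw [this]
    field_simp
  rw [h3]
  ring

/-- Integrability of the Biot-Savart kernels against `h` at the point `x`. -/
def KerInt (h : Plane → ℝ) (x : Plane) : Prop :=
  ∀ k : Fin 2, Integrable fun y => (x - y) k / ‖x - y‖ ^ 2 * h y

lemma gradInvLaplacian_sub (k : Fin 2) {h h' : Plane → ℝ} {x : Plane} (H : KerInt h x)
    (H' : KerInt h' x) : gradInvLaplacian k (fun y => h y - h' y) x =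
      gradInvLaplacian k h x - gradInvLaplacian k h' x := by
  unfold gradInvLaplacian
  simp_rw [mul_sub]
  rw [integral_sub (H k) (H' k), mul_sub]

lemma KerInt.const_mul {h : Plane → ℝ} {x : Plane} (H : KerInt h x) (c : ℝ) :
    KerInt (fun y => c * h y) x := fun k => by
  simp_rw [mul_left_comm _ c]
  exact (H k).const_mul c

/-- The rotational identity `∂₁Δ⁻¹(y₂ h) - ∂₂Δ⁻¹(y₁ h) = x₂ ∂₁Δ⁻¹ h - x₁ ∂₂Δ⁻¹ h`. -/
lemma gradInvLaplacian_coord_mul {h : Plane → ℝ} {x : Plane} (H : KerInt h x)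
    (H' : ∀ j : Fin 2, KerInt (fun y => y j * h y) x) :
    gradInvLaplacian 0 (fun y => y 1 * h y) x - gradInvLaplacian 1 (fun y => y 0 * h y) x =
      x 1 * gradInvLaplacian 0 h x - x 0 * gradInvLaplacian 1 h x := by
  have h1 : (∫ y, (x - y) 0 / ‖x - y‖ ^ 2 * (y 1 * h y)) -
      ∫ y, (x - y) 1 / ‖x - y‖ ^ 2 * (y 0 * h y) =
      x 1 * (∫ y, (x - y) 0 / ‖x - y‖ ^ 2 * h y) - x 0 * ∫ y, (x - y) 1 / ‖x - y‖ ^ 2 * h y := by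
    rw [← integral_sub (H' 1 0) (H' 0 1), ← integral_const_mul, ← integral_const_mul,
      ← integral_sub ((H 0).const_mul _) ((H 1).const_mul _)]
    -- Pointwise, `(x-y)₁ y₂ - (x-y)₂ y₁ = x₂ (x-y)₁ - x₁ (x-y)₂`; both sides equal `x₁ y₂ - x₂ y₁`.
    refine integral_congr_ae (Eventually.of_forall fun y => ?_)
    simp only [PiLp.sub_apply]
    ring
  unfold gradInvLaplacian
  linear_combination (2 * Real.pi)⁻¹ * h1

lemma sq_norm_psc (τ : ℝ) (u : Plane → ℂ) (X : Plane) :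
    ‖psc τ u X‖ ^ 2 = (4 * Real.pi * τ) ^ 2 * ‖u ((4 * Real.pi * τ) • X)‖ ^ 2 := by
  rw [norm_psc, mul_pow, sq_abs]

lemma potA_psc {τ : ℝ} (hτ : τ ≠ 0) (u : Plane → ℂ) (j : Fin 2) (X : Plane) :
    potA (psc τ u) j X = 4 * Real.pi * τ * potA u j ((4 * Real.pi * τ) • X) := by
  have hρ := rho_ne_zero hτ
  have h : ∀ k, gradInvLaplacian k (fun y => ‖psc τ u y‖ ^ 2) X =
      4 * Real.pi * τ * gradInvLaplacian k (fun y => ‖u y‖ ^ 2) ((4 * Real.pi * τ) • X) := by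
    intro k
    simp_rw [sq_norm_psc]
    rw [gradInvLaplacian_const_mul, gradInvLaplacian_comp_smul k (fun y => ‖u y‖ ^ 2) hρ]
    field_simp
  unfold potA
  rw [h, h]
  split_ifs <;> ring

/-- The gradient of the pseudoconformal transform of `u`, before transformation. -/
def pscGrad (τ : ℝ) (u : Plane → ℂ) (p : Fin 2 → Plane → ℂ) (l : Fin 2) (x : Plane) : ℂ :=
  ((4 * Real.pi * τ : ℝ) : ℂ) * p l x - 2 * Real.pi * Complex.I * coord l x * u x

/-- The gradient of the chirp adds `-2πi x_k u` to the transformed derivative, hence a multiple of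
`x_k |u|²` to the current. -/
lemma cur_psc {τ : ℝ} (hτ : τ ≠ 0) (u : Plane → ℂ) (p : Fin 2 → Plane → ℂ) (k : Fin 2)
    (X : Plane) : cur (psc τ u) (fun l => psc τ (pscGrad τ u p l)) k X =
      (4 * Real.pi * τ) ^ 3 * cur u p k ((4 * Real.pi * τ) • X) -
        2 * Real.pi * (4 * Real.pi * τ) ^ 2 *
          (((4 * Real.pi * τ) • X) k * ‖u ((4 * Real.pi * τ) • X)‖ ^ 2) := by
  unfold cur
  rw [potA_psc hτ]
  set r := 4 * Real.pi * τ with hr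
  set x := r • X
  set a := Complex.I * chirp (-(4 * Real.pi ^ 2 * τ)) X with ha
  have hna : conj a * a = 1 := by
    rw [mul_comm, Complex.mul_conj, Complex.normSq_eq_norm_sq, ha, norm_mul, norm_chirp,
      Complex.norm_I]
    simp
  have hu : conj (u x) * u x = ((‖u x‖ ^ 2 : ℝ) : ℂ) := by
    rw [mul_comm, Complex.mul_conj, Complex.normSq_eq_norm_sq]
  have h1 : conj (psc τ u X) * (psc τ (pscGrad τ u p k) X +
      Complex.I * ((r * potA u k x : ℝ) : ℂ) * psc τ u X) =
      ((r ^ 3 : ℝ) : ℂ) * (conj (u x) * (p k x + Complex.I * (potA u k x : ℂ) * u x)) -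
        ((2 * Real.pi * r ^ 2 * (x k * ‖u x‖ ^ 2) : ℝ) : ℂ) * Complex.I := by
    simp only [psc, pscGrad, ← hr, map_mul, Complex.conj_ofReal]
    rw [← map_mul, ← ha]
    change (r : ℂ) * (conj a * conj (u x)) * ((r : ℂ) * (a * ((r : ℂ) * p k x -
      2 * Real.pi * Complex.I * coord k x * u x)) +
      Complex.I * ((r * potA u k x : ℝ) : ℂ) * ((r : ℂ) * (a * u x))) = _
    have hu' : ((2 * Real.pi * r ^ 2 * (x k * ‖u x‖ ^ 2) : ℝ) : ℂ) =
        2 * Real.pi * (r : ℂ) ^ 2 * (coord k x * (conj (u x) * u x)) := by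
      rw [hu]
      push_cast
      rfl
    rw [hu']
    push_cast
    linear_combination ((r : ℂ) ^ 2 * conj (u x) * ((r : ℂ) * p k x -
      2 * Real.pi * Complex.I * coord k x * u x + Complex.I * r * potA u k x * u x)) * hna
  rw [h1, Complex.sub_im, Complex.im_ofReal_mul, Complex.im_ofReal_mul, Complex.I_im, mul_one]

/-- The extra current `x_k |u|²` enters `A₀` through exactly the combination of the rotational
identity, which turns it into `x · A`. The kernel hypotheses allow the integrals to be split at the
point considered. -/
lemma potA0_psc {τ : ℝ} (hτ : τ ≠ 0) (u : Plane → ℂ) (p : Fin 2 → Plane → ℂ) (X : Plane)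
    (H0 : KerInt (fun y => ‖u y‖ ^ 2) ((4 * Real.pi * τ) • X))
    (H1 : ∀ j, KerInt (cur u p j) ((4 * Real.pi * τ) • X))
    (H2 : ∀ j : Fin 2, KerInt (fun y => y j * ‖u y‖ ^ 2) ((4 * Real.pi * τ) • X)) :
    potA0 (psc τ u) (fun l => psc τ (pscGrad τ u p l)) X =
      (4 * Real.pi * τ) ^ 2 * potA0 u p ((4 * Real.pi * τ) • X) +
        4 * Real.pi * (4 * Real.pi * τ) * (((4 * Real.pi * τ) • X) 0 *
          potA u 0 ((4 * Real.pi * τ) • X) + ((4 * Real.pi * τ) • X) 1 *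
          potA u 1 ((4 * Real.pi * τ) • X)) := by
  have hρ := rho_ne_zero hτ
  have hc : ∀ k, cur (psc τ u) (fun l => psc τ (pscGrad τ u p l)) k = _ :=
    fun k => funext (cur_psc hτ u p k)
  have hrot := gradInvLaplacian_coord_mul H0 H2
  unfold potA0
  rw [hc, hc]
  have hg : ∀ k j, gradInvLaplacian k (fun X => (4 * Real.pi * τ) ^ 3 *
      cur u p j ((4 * Real.pi * τ) • X) - 2 * Real.pi * (4 * Real.pi * τ) ^ 2 *
          (((4 * Real.pi * τ) • X) j * ‖u ((4 * Real.pi * τ) • X)‖ ^ 2)) X =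
      (4 * Real.pi * τ)⁻¹ * ((4 * Real.pi * τ) ^ 3 *
        gradInvLaplacian k (cur u p j) ((4 * Real.pi * τ) • X) -
        2 * Real.pi * (4 * Real.pi * τ) ^ 2 *
          gradInvLaplacian k (fun y => y j * ‖u y‖ ^ 2) ((4 * Real.pi * τ) • X)) := by
    intro k j
    rw [gradInvLaplacian_comp_smul k (fun x => (4 * Real.pi * τ) ^ 3 * cur u p j x -
      2 * Real.pi * (4 * Real.pi * τ) ^ 2 * (x j * ‖u x‖ ^ 2)) hρ,
      gradInvLaplacian_sub k ((H1 j).const_mul _) ((H2 j).const_mul _),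
      gradInvLaplacian_const_mul, gradInvLaplacian_const_mul]
  rw [hg, hg]
  simp only [potA, if_true, one_ne_zero, if_false]
  set r := 4 * Real.pi * τ
  have e : ∀ a b c d : ℝ, r⁻¹ * (r ^ 3 * a - 2 * Real.pi * r ^ 2 * b) -
      r⁻¹ * (r ^ 3 * c - 2 * Real.pi * r ^ 2 * d) = r ^ 2 * (a - c) - 2 * Real.pi * r * (b - d) := by
    intro a b c d
    field_simp
    ring
  rw [e, hrot]
  ring

/-- The nonlinearity is covariant under the pseudoconformal transform. -/
lemma nl_psc (g : ℂ) {τ : ℝ} (hτ : τ ≠ 0) (u : Plane → ℂ) (p : Fin 2 → Plane → ℂ) (X : Plane)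
    (H0 : KerInt (fun y => ‖u y‖ ^ 2) ((4 * Real.pi * τ) • X))
    (H1 : ∀ j, KerInt (cur u p j) ((4 * Real.pi * τ) • X))
    (H2 : ∀ j : Fin 2, KerInt (fun y => y j * ‖u y‖ ^ 2) ((4 * Real.pi * τ) • X)) :
    nl g (psc τ u) (fun l => psc τ (pscGrad τ u p l)) X =
      ((4 * Real.pi * τ : ℝ) : ℂ) ^ 2 * psc τ (nl g u p) X := by
  unfold nl
  rw [potA0_psc hτ u p X H0 H1 H2, sq_norm_psc]
  simp only [potA_psc hτ, Fin.sum_univ_two]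
  -- The two terms in `x · A` now cancel: `-4πi` from `A₀`, and `+4πi` from the chirp part of the
  -- gradient in `-2 A · P`, with the same factor.
  simp only [psc, pscGrad, coord]
  set r := 4 * Real.pi * τ
  set a := chirp (-(4 * Real.pi ^ 2 * τ)) X
  push_cast
  ring

/-! ### Integrability of the kernels -/

/-- Tested against the positive weight `wt`, whose Riesz potential is bounded, the potential of an
integrable function has a finite integral. -/
lemma riesz_lt_top_ae {h : Plane → ℝ≥0∞} (hm : Measurable h) (hi : ∫⁻ y, h y < ∞) :
    ∀ᵐ x, riesz h x < ∞ := by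
  have h1 : ∫⁻ x, wt x * riesz h x < ∞ := by
    rw [lintegral_mul_riesz_comm measurable_wt hm]
    calc ∫⁻ y, h y * riesz wt y ≤ ∫⁻ y, h y * (kerConst * (1 + ∫⁻ y, wt y)) :=
          lintegral_mono fun y => by
            gcongr
            exact riesz_le measurable_wt wt_le_one y
      _ = (∫⁻ y, h y) * (kerConst * (1 + ∫⁻ y, wt y)) := lintegral_mul_const _ hm
      _ < ∞ := ENNReal.mul_lt_top hi (ENNReal.mul_lt_top kerConst_lt_top
          (ENNReal.add_lt_top.mpr ⟨ENNReal.one_lt_top, lintegral_wt_lt_top⟩))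
  have h2 := ae_lt_top (measurable_wt.mul (measurable_riesz hm)) h1.ne
  filter_upwards [h2] with x hx
  by_contra hc
  rw [Pi.mul_apply, top_le_iff.mp (not_lt.mp hc), ENNReal.mul_top] at hx
  · exact hx.ne rfl
  · unfold wt
    rw [ENNReal.ofReal_ne_zero_iff]
    positivity

lemma kerInt_of_riesz_lt_top {h : Plane → ℝ} (hm : Measurable h) {x : Plane}
    (hx : riesz (fun y => ‖h y‖ₑ) x < ∞) : KerInt h x := fun k => by
  have hk : Measurable fun y : Plane => (x - y) k / ‖x - y‖ ^ 2 := by fun_prop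
  refine ⟨(hk.mul hm).aestronglyMeasurable, lt_of_le_of_lt (lintegral_mono fun y => ?_) hx⟩
  rw [enorm_mul]
  gcongr
  exact enorm_kernel_le k (x - y)

lemma kerInt_ae {h : Plane → ℝ} (hm : Measurable h) (hi : ∫⁻ y, ‖h y‖ₑ < ∞) :
    ∀ᵐ x, KerInt h x := by
  filter_upwards [riesz_lt_top_ae hm.enorm hi] with x hx
  exact kerInt_of_riesz_lt_top hm hx

lemma measurable_gradInvLaplacian (k : Fin 2) {h : Plane → ℝ} (hm : Measurable h) :
    Measurable (gradInvLaplacian k h) := by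
  unfold gradInvLaplacian
  refine Measurable.const_mul ?_ _
  refine StronglyMeasurable.measurable (StronglyMeasurable.integral_prod_right
    (f := fun x y : Plane => (x - y) k / ‖x - y‖ ^ 2 * h y) (Measurable.stronglyMeasurable ?_))
  simp only [Function.uncurry_def]
  have : Measurable fun q : Plane × Plane => (q.1 - q.2) k := by fun_prop
  fun_prop

lemma measurable_potA {u : Plane → ℂ} (hu : Measurable u) (j : Fin 2) : Measurable (potA u j) := by
  unfold potA
  have h0 := measurable_gradInvLaplacian 0 (h := fun y => ‖u y‖ ^ 2) (by fun_prop)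
  have h1 := measurable_gradInvLaplacian 1 (h := fun y => ‖u y‖ ^ 2) (by fun_prop)
  split_ifs <;> fun_prop

lemma measurable_cur {u : Plane → ℂ} {p : Fin 2 → Plane → ℂ} (hu : Measurable u)
    (hp : ∀ l, Measurable (p l)) (k : Fin 2) : Measurable (cur u p k) := by
  unfold cur
  have h1 := hp k
  have h2 := measurable_potA hu k
  have h3 : Measurable fun x => conj (u x) := Complex.continuous_conj.measurable.comp hu
  fun_prop

lemma measurable_nl (g : ℂ) {u : Plane → ℂ} {p : Fin 2 → Plane → ℂ} (hu : Measurable u)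
    (hp : ∀ l, Measurable (p l)) : Measurable (nl g u p) := by
  unfold nl potA0
  have h1 := hp 0
  have h1' := hp 1
  have h2 := measurable_potA hu 0
  have h2' := measurable_potA hu 1
  have h3 := measurable_gradInvLaplacian 0 (measurable_cur hu hp 1)
  have h3' := measurable_gradInvLaplacian 1 (measurable_cur hu hp 0)
  simp only [Fin.sum_univ_two]
  fun_prop

lemma enorm_potA_le (u : Plane → ℂ) (j : Fin 2) (x : Plane) :
    ‖potA u j x‖ₑ ≤ riesz (fun y => ‖u y‖ₑ * ‖u y‖ₑ) x := by
  have h : ∀ k, ‖gradInvLaplacian k (fun y => ‖u y‖ ^ 2) x‖ₑ ≤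
      riesz (fun y => ‖u y‖ₑ * ‖u y‖ₑ) x := fun k => by
    refine (enorm_gradInvLaplacian_le k _ x).trans (riesz_mono (fun y => le_of_eq ?_) x)
    rw [sq, enorm_mul, enorm_norm]
  have h2 : ‖(1 / 2 : ℝ)‖ₑ ≤ 1 := by
    rw [← ofReal_norm]
    exact ENNReal.ofReal_le_one.mpr (by norm_num)
  unfold potA
  split_ifs
  · rw [enorm_mul]
    exact (mul_le_of_le_one_left' h2).trans (h 1)
  · rw [enorm_mul, enorm_neg]
    exact (mul_le_of_le_one_left' h2).trans (h 0)

lemma riesz_congr_ae {h h' : Plane → ℝ≥0∞} (H : h =ᵐ[volume] h') (x : Plane) :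
    riesz h x = riesz h' x := by
  unfold riesz
  refine lintegral_congr_ae ?_
  filter_upwards [H] with y hy
  rw [hy]

/-- The potential of a bounded square-integrable function is bounded. -/
lemma enorm_potA_le_of_bdd {u : Plane → ℂ} (hu : Measurable u) {b : ℝ≥0∞}
    (hb : ∀ᵐ x, ‖u x‖ₑ ≤ b) (j : Fin 2) (x : Plane) :
    ‖potA u j x‖ₑ ≤ kerConst * (b * b + ∫⁻ y, ‖u y‖ₑ * ‖u y‖ₑ) := by
  refine (enorm_potA_le u j x).trans ?_
  -- Truncation at `b` changes nothing almost everywhere and gives the bound at every point that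
  -- `riesz_le` asks for.
  have h : (fun y => ‖u y‖ₑ * ‖u y‖ₑ) =ᵐ[volume] fun y => min ‖u y‖ₑ b * min ‖u y‖ₑ b := by
    filter_upwards [hb] with y hy
    rw [min_eq_left hy]
  rw [riesz_congr_ae h, lintegral_congr_ae h]
  exact riesz_le (by fun_prop) (fun y => mul_le_mul' (min_le_right _ _) (min_le_right _ _)) x

lemma N2_sq_lintegral_lt_top (u v : L2) : ∫⁻ y, ‖u y‖ₑ * ‖v y‖ₑ < ∞ := by
  refine (lintegral_mul_le_N2 (by fun_prop) (by fun_prop)).trans_lt ?_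
  rw [← enorm_L2_eq_N2, ← enorm_L2_eq_N2]
  exact ENNReal.mul_lt_top enorm_lt_top enorm_lt_top

lemma kerInt_sq_ae (u : L2) : ∀ᵐ x, KerInt (fun y => ‖u y‖ ^ 2) x := by
  have hm := measurable_L2 u
  refine kerInt_ae (by fun_prop) ?_
  simp_rw [sq, enorm_mul, enorm_norm]
  exact N2_sq_lintegral_lt_top u u

lemma kerInt_cur_ae {u : L2} (p : Fin 2 → L2) {b : ℝ≥0∞} (hb : ∀ᵐ x, ‖u x‖ₑ ≤ b) (hb' : b < ∞)
    (k : Fin 2) : ∀ᵐ x, KerInt (cur u (fun l => p l) k) x := by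
  refine kerInt_ae (measurable_cur (measurable_L2 u) (fun l => measurable_L2 (p l)) k) ?_
  set A := kerConst * (b * b + ∫⁻ y, ‖u y‖ₑ * ‖u y‖ₑ) with hA
  have hA' : A < ∞ := ENNReal.mul_lt_top kerConst_lt_top
    (ENNReal.add_lt_top.mpr ⟨ENNReal.mul_lt_top hb' hb', N2_sq_lintegral_lt_top u u⟩)
  have h1 : ∀ x, ‖cur u (fun l => p l) k x‖ₑ ≤ ‖u x‖ₑ * ‖p k x‖ₑ + A * (‖u x‖ₑ * ‖u x‖ₑ) := by
    intro x
    unfold cur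
    have him : ∀ z : ℂ, ‖z.im‖ₑ ≤ ‖z‖ₑ := fun z => by
      rw [← ofReal_norm, ← ofReal_norm]
      exact ENNReal.ofReal_le_ofReal (Complex.abs_im_le_norm z)
    refine (him _).trans ?_
    rw [enorm_mul, ← ofReal_norm (conj (u x)), RCLike.norm_conj, ofReal_norm]
    calc _ ≤ ‖u x‖ₑ * (‖p k x‖ₑ + A * ‖u x‖ₑ) := by
          gcongr
          refine (enorm_add_le _ _).trans ?_
          gcongr
          rw [enorm_mul, enorm_mul, ← ofReal_norm Complex.I, Complex.norm_I, ENNReal.ofReal_one,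
            one_mul]
          gcongr
          rw [← ofReal_norm, Complex.norm_real, ofReal_norm]
          exact enorm_potA_le_of_bdd (measurable_L2 u) hb k x
      _ = _ := by ring
  refine (lintegral_mono h1).trans_lt ?_
  rw [lintegral_add_left (by fun_prop), lintegral_const_mul _ (by fun_prop)]
  exact ENNReal.add_lt_top.mpr ⟨N2_sq_lintegral_lt_top u (p k),
    ENNReal.mul_lt_top hA' (N2_sq_lintegral_lt_top u u)⟩

/-- `y_j |u|²` is the product of the two square-integrable functions `y_j u` and `u` up to a
conjugation, hence integrable. -/
lemma kerInt_coord_ae {u : L2} {j : Fin 2} (h : MemLp (fun x => coord j x * u x) 2) :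
    ∀ᵐ x, KerInt (fun y => y j * ‖u y‖ ^ 2) x := by
  have hm := measurable_L2 u
  refine kerInt_ae (by fun_prop) ?_
  refine lt_of_eq_of_lt (lintegral_congr_ae ?_) (N2_sq_lintegral_lt_top h.toLp u)
  filter_upwards [h.coeFn_toLp] with y hy
  rw [hy, sq, enorm_mul, enorm_mul, enorm_norm, enorm_mul, mul_assoc]
  congr 1
  rw [coord, ← ofReal_norm, ← ofReal_norm, Complex.norm_real]

/-! ### Almost everywhere equal functions -/

lemma potA_congr {u u' : Plane → ℂ} (h : u =ᵐ[volume] u') : potA u = potA u' := by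
  ext j x
  have h2 : (fun y => ‖u y‖ ^ 2) =ᵐ[volume] fun y => ‖u' y‖ ^ 2 := by
    filter_upwards [h] with y hy
    rw [hy]
  unfold potA
  rw [gradInvLaplacian_congr_ae 0 h2, gradInvLaplacian_congr_ae 1 h2]

lemma cur_congr {u u' : Plane → ℂ} {p p' : Fin 2 → Plane → ℂ} (h : u =ᵐ[volume] u')
    (hp : ∀ l, p l =ᵐ[volume] p' l) (k : Fin 2) : cur u p k =ᵐ[volume] cur u' p' k := by
  filter_upwards [h, hp k] with x h1 h2
  unfold cur
  rw [h1, h2, potA_congr h]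

lemma nl_congr (g : ℂ) {u u' : Plane → ℂ} {p p' : Fin 2 → Plane → ℂ} (h : u =ᵐ[volume] u')
    (hp : ∀ l, p l =ᵐ[volume] p' l) : nl g u p =ᵐ[volume] nl g u' p' := by
  filter_upwards [h, hp 0, hp 1] with x h1 h2 h3
  unfold nl potA0
  rw [h1, potA_congr h, gradInvLaplacian_congr_ae 0 (cur_congr h hp 1),
    gradInvLaplacian_congr_ae 1 (cur_congr h hp 0), Fin.sum_univ_two, Fin.sum_univ_two, Fin.sum_univ_two,
    h2, h3]

/-- For bounded `H¹` functions the nonlinearity has its classical expression. -/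
lemma nonlinearity_ae_eq (g : ℂ) {u : L2} {b : ℝ≥0∞} (hb : ∀ᵐ x, ‖u x‖ₑ ≤ b) (hb' : b < ∞)
    (hu : ∀ k, l2Norm (∂_{e k} (u : 𝓢'(Plane, ℂ))) < ∞) :
    nonlinearity g u =ᵐ[volume] nl g u fun l => partialL2 l u := by
  have hA : kerConst * (b * b + ∫⁻ y, ‖u y‖ₑ * ‖u y‖ₑ) < ∞ :=
    ENNReal.mul_lt_top kerConst_lt_top
      (ENNReal.add_lt_top.mpr ⟨ENNReal.mul_lt_top hb' hb', N2_sq_lintegral_lt_top u u⟩)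
  have hc : ∀ k, covDL2 u k u =ᵐ[volume]
      fun x => partialL2 k u x + Complex.I * (potA u k x : ℂ) * u x := by
    intro k
    -- Boundedness of the potential excludes the default value `0` of `toL2`, so that `covD` and
    -- `l2Rep` have their true meaning.
    have hm : MemLp (fun x => Complex.I * (gaugeA u k x : ℂ) * u x) 2 := by
      refine MemLp.of_le_mul (c := (kerConst * (b * b + ∫⁻ y, ‖u y‖ₑ * ‖u y‖ₑ)).toReal)
        (Lp.memLp u) ?_ (Eventually.of_forall fun x => ?_)
      · have h1 := measurable_potA (measurable_L2 u) k
        have h2 := measurable_L2 u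
        have h3 : Measurable fun x => Complex.I * (potA u k x : ℂ) * u x := by fun_prop
        exact h3.aestronglyMeasurable
      · rw [norm_mul, norm_mul, Complex.norm_I, one_mul, Complex.norm_real]
        gcongr
        have h4 := enorm_potA_le_of_bdd (measurable_L2 u) hb k x
        have h5 := ENNReal.toReal_mono hA.ne h4
        rwa [toReal_enorm] at h5
    have hcov : covD u k u = ((partialL2 k u + hm.toLp : L2) : 𝓢'(Plane, ℂ)) := by
      rw [covD, coe_add, coe_partialL2 (hu k), toL2, dif_pos hm]
    rw [covDL2, hcov, l2Rep_coe]
    filter_upwards [Lp.coeFn_add (partialL2 k u) hm.toLp, hm.coeFn_toLp] with x h1 h2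
    rw [h1, Pi.add_apply, h2]
    rfl
  have hcur : ∀ k, current u k =ᵐ[volume] cur u (fun l => partialL2 l u) k := by
    intro k
    filter_upwards [hc k] with x hx
    rw [current, hx]
    rfl
  -- The currents agree only almost everywhere, but they enter through integrals, so the two
  -- nonlinearities agree at every point.
  refine Eventually.of_forall fun x => ?_
  unfold nonlinearity nl gaugeA0 potA0
  rw [gradInvLaplacian_congr_ae 0 (hcur 1), gradInvLaplacian_congr_ae 1 (hcur 0)]
  rfl


/-! ### Fourier transforms of weighted Schwartz functions -/

lemma Rapid.of_schwartz (f : 𝓢(Plane, ℂ)) : Rapid f := by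
  have key : ∀ {F : Type} [NormedAddCommGroup F] [NormedSpace ℝ F] (f : 𝓢(Plane, F)),
      ∃ C : NNReal, ∀ x, ‖f x‖ₑ ≤ C * wt x := by
    intro F _ _ f
    set S := 2 ^ 3 * ((Finset.Iic (3, 0)).sup fun m : ℕ × ℕ => SchwartzMap.seminorm ℝ m.1 m.2) f
    refine ⟨S.toNNReal, fun x => ?_⟩
    have h := SchwartzMap.one_add_le_sup_seminorm_apply (𝕜 := ℝ) (m := (3, 0)) (k := 3) (n := 0)
      le_rfl le_rfl f x
    rw [norm_iteratedFDeriv_zero] at h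
    have hp : 0 < (1 + ‖x‖) ^ 3 := by positivity
    have hw : wt x = ENNReal.ofReal (((1 + ‖x‖) ^ 3)⁻¹) := by
      rw [wt, Real.rpow_neg (by positivity), show (3 : ℝ) = ((3 : ℕ) : ℝ) by norm_num,
        Real.rpow_natCast]
    rw [hw, ← ofReal_norm, ← ENNReal.ofReal, ← ENNReal.ofReal_mul' (by positivity)]
    refine ENNReal.ofReal_le_ofReal ?_
    rw [← div_eq_mul_inv, le_div_iff₀ hp, mul_comm]
    exact h
  obtain ⟨C, hC⟩ := key f
  obtain ⟨D, hD⟩ := key (SchwartzMap.fderivCLM ℝ Plane ℂ f)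
  refine ⟨C + D, f.differentiable, fun x => (hC x).trans ?_, fun x => (hD x).trans ?_⟩
  · push_cast
    gcongr
    exact le_self_add
  · push_cast
    gcongr
    exact le_add_self

/-- Multiplication of Schwartz functions by a coordinate. -/
def mulC (l : Fin 2) (f : 𝓢(Plane, ℂ)) : 𝓢(Plane, ℂ) := SchwartzMap.smulLeftCLM ℂ (coord l) f

lemma mulC_apply (l : Fin 2) (f : 𝓢(Plane, ℂ)) (x : Plane) : mulC l f x = coord l x * f x :=
  SchwartzMap.smulLeftCLM_apply_apply (by fun_prop) f x

/-- The derivative `∂_l 𝓕 f` of the Fourier transform. -/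
def gradF (l : Fin 2) (f : 𝓢(Plane, ℂ)) : 𝓢(Plane, ℂ) :=
  (-(2 * Real.pi * Complex.I)) • 𝓕 (mulC l f)

lemma gradF_apply (l : Fin 2) (f : 𝓢(Plane, ℂ)) (x : Plane) :
    gradF l f x = -(2 * Real.pi * Complex.I) * 𝓕 (mulC l f) x := rfl

lemma lineDeriv_fourier (l : Fin 2) (f : 𝓢(Plane, ℂ)) : ∂_{e l} (𝓕 f) = gradF l f := by
  have h : SchwartzMap.smulLeftCLM ℂ (fun x : Plane => (inner ℝ x (e l) : ℝ)) f = mulC l f := by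
    ext x
    rw [mulC_apply, SchwartzMap.smulLeftCLM_apply_apply (by fun_prop), Complex.real_smul]
    congr 1
    exact congrFun (inner_e_eq_coord l) x
  rw [SchwartzMap.lineDerivOp_fourier_eq, h]
  ext x
  rw [FourierTransform.fourier_smul]
  rfl

lemma lineDeriv_gradF (m l : Fin 2) (f : 𝓢(Plane, ℂ)) :
    ∂_{e m} (gradF l f) = (-(2 * Real.pi * Complex.I)) • gradF m (mulC l f) := by
  unfold gradF
  rw [LineDeriv.lineDerivOp_smul, lineDeriv_fourier]
  rfl

lemma enorm_two_pi_I : ‖-(2 * Real.pi * Complex.I)‖ₑ ≤ 7 := by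
  rw [enorm_neg, ← ofReal_norm, show (7 : ℝ≥0∞) = ENNReal.ofReal 7 by norm_num]
  refine ENNReal.ofReal_le_ofReal ?_
  simp only [norm_mul, Complex.norm_ofNat, Complex.norm_real, Complex.norm_I, mul_one,
    Real.norm_of_nonneg Real.pi_pos.le]
  linarith [Real.pi_lt_d2]

lemma enorm_fderiv_le (f : 𝓢(Plane, ℂ)) (x : Plane) :
    ‖fderiv ℝ f x‖ₑ ≤ ‖(∂_{e 0} f : 𝓢(Plane, ℂ)) x‖ₑ + ‖(∂_{e 1} f : 𝓢(Plane, ℂ)) x‖ₑ := by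
  rw [SchwartzMap.lineDerivOp_apply_eq_fderiv, SchwartzMap.lineDerivOp_apply_eq_fderiv,
    ← ofReal_norm, ← ofReal_norm (fderiv ℝ f x (e 0)), ← ofReal_norm (fderiv ℝ f x (e 1)),
    ← ENNReal.ofReal_add (norm_nonneg _) (norm_nonneg _)]
  refine ENNReal.ofReal_le_ofReal (ContinuousLinearMap.opNorm_le_bound _ (by positivity) fun v => ?_)
  have hv : v = v 0 • e 0 + v 1 • e 1 := by
    ext i
    fin_cases i <;> simp [e]
  have h0 : ‖v 0‖ ≤ ‖v‖ := PiLp.norm_apply_le v 0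
  have h1 : ‖v 1‖ ≤ ‖v‖ := PiLp.norm_apply_le v 1
  calc ‖fderiv ℝ f x v‖ = ‖v 0 • fderiv ℝ f x (e 0) + v 1 • fderiv ℝ f x (e 1)‖ := by
        conv_lhs => rw [hv, map_add, map_smul, map_smul]
    _ ≤ ‖v 0‖ * ‖fderiv ℝ f x (e 0)‖ + ‖v 1‖ * ‖fderiv ℝ f x (e 1)‖ := by
        refine (norm_add_le _ _).trans ?_
        rw [norm_smul, norm_smul]
    _ ≤ ‖v‖ * ‖fderiv ℝ f x (e 0)‖ + ‖v‖ * ‖fderiv ℝ f x (e 1)‖ := by gcongr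
    _ = _ := by ring

lemma measurable_schwartz (f : 𝓢(Plane, ℂ)) : Measurable f := f.continuous.measurable

lemma N2_toLp (f : 𝓢(Plane, ℂ)) : ‖(f.toLp 2 : L2)‖ₑ = N2 fun x => ‖f x‖ₑ := by
  rw [N2_enorm]
  exact Lp.enorm_toLp _

lemma N2_fourier (f : 𝓢(Plane, ℂ)) : N2 (fun x => ‖𝓕 f x‖ₑ) = N2 fun x => ‖f x‖ₑ := by
  rw [← N2_toLp, ← N2_toLp, ← SchwartzMap.toLp_fourier_eq, ← ofReal_norm, ← ofReal_norm,
    Lp.norm_fourier_eq]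

lemma enorm_fourier_le (f : 𝓢(Plane, ℂ)) (x : Plane) : ‖𝓕 f x‖ₑ ≤ ∫⁻ y, ‖f y‖ₑ := by
  rw [SchwartzMap.fourier_coe, Real.fourier_eq']
  refine (enorm_integral_le_lintegral_enorm _).trans (lintegral_mono fun y => ?_)
  rw [enorm_smul, ← ofReal_norm (Complex.exp _), Complex.norm_exp_ofReal_mul_I,
    ENNReal.ofReal_one, one_mul]

/-- `|q|⁻² = 1 + 4r⁴ ≤ (1 + 2r²)²`. -/
lemma one_le_Qw_mul (y : Plane) : 1 ≤ Qw 1 y * (1 + 2 * ‖y‖ₑ ^ 2) := by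
  have hq := norm_qf_sq 1 (‖y‖ ^ 2)
  have h0 : 0 ≤ ‖y‖ ^ 2 := by positivity
  have hpos : 0 < 1 + 4 * (1 : ℝ) ^ 2 * (‖y‖ ^ 2) ^ 2 := by positivity
  have h1 : 1 ≤ ‖qf 1 (‖y‖ ^ 2)‖ * (1 + 2 * ‖y‖ ^ 2) := by
    rw [← one_le_sq_iff₀ (by positivity), mul_pow, hq, inv_mul_eq_div, le_div_iff₀ hpos]
    nlinarith
  have h2 : (1 + 2 * ‖y‖ₑ ^ 2) = ENNReal.ofReal (1 + 2 * ‖y‖ ^ 2) := by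
    rw [ENNReal.ofReal_add (by norm_num) (by positivity), ENNReal.ofReal_mul (by norm_num),
      ENNReal.ofReal_pow (norm_nonneg _), ofReal_norm]
    norm_num
  rw [h2, Qw, ← ofReal_norm, ← ENNReal.ofReal_mul (norm_nonneg _)]
  exact ENNReal.one_le_ofReal.mpr h1

/-- Cauchy–Schwarz with the multiplier at `c = 1`, which is in `L²` and comparable to `(1 +
|y|²)⁻¹`. The weight `|y|²` is thus strong enough for `L¹`, hence for the sup of the Fourier
transform. -/
lemma lintegral_enorm_le_wNorm {f : Plane → ℂ} (hf : Measurable f) :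
    ∫⁻ y, ‖f y‖ₑ ≤ 2 * qConst * wNorm f := by
  have hQ := measurable_Qw 1
  have h : ∀ y, ‖f y‖ₑ ≤ Qw 1 y * (‖f y‖ₑ + 2 * (‖y‖ₑ ^ 2 * ‖f y‖ₑ)) := fun y => by
    calc ‖f y‖ₑ = 1 * ‖f y‖ₑ := (one_mul _).symm
      _ ≤ Qw 1 y * (1 + 2 * ‖y‖ₑ ^ 2) * ‖f y‖ₑ := by gcongr; exact one_le_Qw_mul y
      _ = _ := by ring
  refine (lintegral_mono h).trans ((lintegral_mul_le_N2 hQ (by fun_prop)).trans ?_)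
  have h2 : N2 (fun y => ‖f y‖ₑ + 2 * (‖y‖ₑ ^ 2 * ‖f y‖ₑ)) ≤ 2 * wNorm f := by
    refine (N2_add_le (by fun_prop) (by fun_prop)).trans ?_
    rw [N2_const_mul 2 (by fun_prop), wNorm, mul_add]
    gcongr
    exact le_mul_of_one_le_left zero_le one_le_two
  calc N2 (Qw 1) * _ ≤ qConst * (2 * wNorm f) := mul_le_mul' le_rfl h2
    _ = _ := by ring

lemma enorm_coord_le (l : Fin 2) (y : Plane) : ‖coord l y‖ₑ ≤ ‖y‖ₑ := by
  rw [← ofReal_norm, ← ofReal_norm]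
  exact ENNReal.ofReal_le_ofReal (norm_coord_le l y)

lemma le_one_add_sq (a : ℝ≥0∞) : a ≤ 1 + a ^ 2 := by
  rcases le_total a 1 with h | h
  · exact h.trans le_self_add
  · refine le_trans ?_ le_add_self
    rw [sq]
    exact le_mul_of_one_le_left zero_le h

lemma N2_coord_mul_le {f : Plane → ℂ} (hf : Measurable f) (l : Fin 2) :
    N2 (fun y => ‖coord l y * f y‖ₑ) ≤ wNorm f := by
  refine (N2_mono fun y => ?_).trans (N2_add_le (f := fun y => ‖f y‖ₑ)
    (g := fun y => ‖y‖ₑ ^ 2 * ‖f y‖ₑ) (by fun_prop) (by fun_prop))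
  rw [enorm_mul]
  calc ‖coord l y‖ₑ * ‖f y‖ₑ ≤ (1 + ‖y‖ₑ ^ 2) * ‖f y‖ₑ := by
        gcongr
        exact (enorm_coord_le l y).trans (le_one_add_sq _)
    _ = _ := by ring

lemma N2_coord_coord_mul_le {f : Plane → ℂ} (l m : Fin 2) :
    N2 (fun y => ‖coord m y * (coord l y * f y)‖ₑ) ≤ wNorm f := by
  refine (N2_mono fun y => ?_).trans (le_add_self : N2 (fun y => ‖y‖ₑ ^ 2 * ‖f y‖ₑ) ≤ _)
  rw [enorm_mul, enorm_mul, ← mul_assoc, sq]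
  gcongr <;> exact enorm_coord_le _ y

/-- The majorant of the gradient of the Fourier transform. -/
def gradMaj (f : 𝓢(Plane, ℂ)) (x : Plane) : ℝ≥0∞ := ‖gradF 0 f x‖ₑ + ‖gradF 1 f x‖ₑ

lemma measurable_gradMaj (f : 𝓢(Plane, ℂ)) : Measurable (gradMaj f) :=
  (measurable_schwartz _).enorm.add (measurable_schwartz _).enorm

lemma cbound_fourier (f : 𝓢(Plane, ℂ)) :
    CBound (𝓕 f : 𝓢(Plane, ℂ)) (fun x => ‖𝓕 f x‖ₑ) (gradMaj f) :=
  ⟨(𝓕 f : 𝓢(Plane, ℂ)).differentiable, fun _ => le_rfl, fun x => by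
    have := enorm_fderiv_le (𝓕 f) x
    rwa [lineDeriv_fourier, lineDeriv_fourier] at this⟩

/-- The majorant of the second derivatives of the Fourier transform. -/
def hessMaj (f : 𝓢(Plane, ℂ)) (x : Plane) : ℝ≥0∞ :=
  7 * gradMaj (mulC 0 f) x + 7 * gradMaj (mulC 1 f) x

lemma measurable_hessMaj (f : 𝓢(Plane, ℂ)) : Measurable (hessMaj f) :=
  ((measurable_gradMaj _).const_mul _).add ((measurable_gradMaj _).const_mul _)

lemma cbound_gradF (f : 𝓢(Plane, ℂ)) (l : Fin 2) : CBound (gradF l f) (gradMaj f) (hessMaj f) := by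
  refine ⟨(gradF l f).differentiable, fun x => ?_, fun x => ?_⟩
  · fin_cases l
    · exact le_self_add
    · exact le_add_self
  · refine (enorm_fderiv_le (gradF l f) x).trans ?_
    rw [lineDeriv_gradF, lineDeriv_gradF]
    have h : ∀ m, ‖((-(2 * Real.pi * Complex.I)) • gradF m (mulC l f)) x‖ₑ ≤
        7 * ‖gradF m (mulC l f) x‖ₑ := fun m => by
      have : ((-(2 * Real.pi * Complex.I)) • gradF m (mulC l f)) x =
        -(2 * Real.pi * Complex.I) * gradF m (mulC l f) x := rfl
      rw [this, enorm_mul]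
      gcongr
      exact enorm_two_pi_I
    refine (add_le_add (h 0) (h 1)).trans ?_
    rw [← mul_add]
    unfold hessMaj
    fin_cases l
    · exact le_self_add
    · exact le_add_self

lemma N2_gradF_le (f : 𝓢(Plane, ℂ)) (l : Fin 2) :
    N2 (fun x => ‖gradF l f x‖ₑ) ≤ 7 * N2 fun x => ‖mulC l f x‖ₑ := by
  rw [← N2_fourier (mulC l f), ← N2_const_mul 7 (measurable_schwartz (𝓕 (mulC l f))).enorm]
  refine N2_mono fun x => ?_
  rw [gradF_apply, enorm_mul]
  gcongr
  exact enorm_two_pi_I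

lemma N2_gradMaj_le (f : 𝓢(Plane, ℂ)) {b : ℝ≥0∞} (h : ∀ l, N2 (fun x => ‖mulC l f x‖ₑ) ≤ b) :
    N2 (gradMaj f) ≤ 14 * b := by
  refine (N2_add_le (measurable_schwartz _).enorm (measurable_schwartz _).enorm).trans ?_
  calc _ ≤ 7 * b + 7 * b := add_le_add ((N2_gradF_le f 0).trans (by gcongr; exact h 0))
          ((N2_gradF_le f 1).trans (by gcongr; exact h 1))
    _ = _ := by ring

/-- The constant relating the weighted norm and the norms of the Fourier transform. -/
def wConst : ℝ≥0∞ := 2 * qConst + 196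

lemma wConst_lt_top : wConst < ∞ :=
  ENNReal.add_lt_top.mpr ⟨ENNReal.mul_lt_top (by norm_num) qConst_lt_top, by norm_num⟩

lemma le_wConst {a : ℝ≥0∞} (h : a ≤ 196) : a ≤ wConst := h.trans le_add_self

/-- The dictionary between weights and regularity: the `L¹` norm gives the sup of the Fourier
transform, Plancherel gives its `L²` norm, and a coordinate factor gives a derivative. -/
lemma majData_fourier (f : 𝓢(Plane, ℂ)) {K : ℝ≥0∞} (hK : wNorm f ≤ K) :
    MajData (wConst * K) (fun x => ‖𝓕 f x‖ₑ) (gradMaj f) where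
  mv := (measurable_schwartz _).enorm
  mp := measurable_gradMaj f
  sup x := by
    refine (enorm_fourier_le f x).trans ((lintegral_enorm_le_wNorm (measurable_schwartz f)).trans ?_)
    exact mul_le_mul' le_self_add hK
  v2 := by
    rw [N2_fourier]
    refine (le_self_add.trans hK).trans (le_mul_of_one_le_left zero_le (le_wConst (by norm_num)))
  p2 := by
    refine (N2_gradMaj_le f (b := K) fun l => ?_).trans
      (mul_le_mul' (le_wConst (by norm_num)) le_rfl)
    simp_rw [mulC_apply]
    exact (N2_coord_mul_le (measurable_schwartz f) l).trans hK

/-- Two derivatives cost two coordinate factors, controlled by `|y|²`. The factor is `2 · 7 · 14 =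
196`, with `7 ≥ 2π`. -/
lemma N2_hessMaj_le (f : 𝓢(Plane, ℂ)) {K : ℝ≥0∞} (hK : wNorm f ≤ K) :
    N2 (hessMaj f) ≤ wConst * K := by
  unfold hessMaj
  have h : ∀ l, N2 (fun x => 7 * gradMaj (mulC l f) x) ≤ 7 * (14 * K) := fun l => by
    rw [N2_const_mul 7 (measurable_gradMaj _)]
    gcongr
    refine N2_gradMaj_le _ fun m => ?_
    simp_rw [mulC_apply]
    exact (N2_coord_coord_mul_le l m).trans hK
  refine (N2_add_le ((measurable_gradMaj _).const_mul _) ((measurable_gradMaj _).const_mul _)).trans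
    ((add_le_add (h 0) (h 1)).trans ?_)
  calc 7 * (14 * K) + 7 * (14 * K) = 196 * K := by ring
    _ ≤ _ := mul_le_mul' (le_wConst le_rfl) le_rfl

lemma measurable_phase_prod (c : ℝ) : Measurable fun q : Plane × Plane => phase c q.2 q.1 := by
  unfold phase
  fun_prop

/-- The oscillatory estimate for Schwartz profiles, integrated over the centre of the phase. -/
lemma enorm_integral_nl_fourier_mul_le (g : ℂ) {c : ℝ} (hc : 1 ≤ |c|) (f : 𝓢(Plane, ℂ))
    {K : ℝ≥0∞} (hK : wNorm f ≤ K) {H Ψ : Plane → ℂ} (hH : Integrable H)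
    (hΨ : ∀ X, Ψ X = ∫ ξ, phase c ξ X * H ξ) :
    ‖∫ X, nl g (𝓕 f : 𝓢(Plane, ℂ)) (fun l => gradF l f) X * Ψ X‖ₑ ≤
      coreConst g * ENNReal.ofReal ((Real.sqrt |c|)⁻¹) * ((wConst * K) ^ 3 + (wConst * K) ^ 5) *
        ∫⁻ ξ, ‖H ξ‖ₑ := by
  have hr := Rapid.of_schwartz (𝓕 f)
  have hrP : ∀ l, Rapid (gradF l f) := fun l => Rapid.of_schwartz _
  set n := nl g (𝓕 f : 𝓢(Plane, ℂ)) (fun l => gradF l f) with hn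
  have hni : Integrable n := (hr.nl g hrP).integrable
  have hint : Integrable (Function.uncurry fun X ξ => n X * (phase c ξ X * H ξ))
      (volume.prod volume) := by
    have h1 := (hni.mul_prod hH).bdd_mul (c := 1)
      (measurable_phase_prod c).aestronglyMeasurable
      (Eventually.of_forall fun q => (norm_phase c q.2 q.1).le)
    refine h1.congr (Eventually.of_forall fun q => ?_)
    simp only [Function.uncurry]
    ring
  -- Fubini puts the oscillatory integral in `X` inside, where it is bounded uniformly in the centre
  -- `ξ`; what remains is the `L¹` norm of `H`.
  have h2 : ∫ X, n X * Ψ X = ∫ ξ, (∫ X, phase c ξ X * n X) * H ξ := by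
    simp_rw [hΨ, ← integral_const_mul]
    rw [integral_integral_swap hint]
    refine integral_congr_ae (Eventually.of_forall fun ξ => ?_)
    simp only
    rw [← integral_mul_const]
    refine integral_congr_ae (Eventually.of_forall fun X => ?_)
    simp only
    ring
  rw [h2, ← lintegral_const_mul'' _ hH.aestronglyMeasurable.enorm]
  refine (enorm_integral_le_lintegral_enorm _).trans (lintegral_mono fun ξ => ?_)
  rw [enorm_mul]
  gcongr
  exact enorm_integral_phase_mul_nl_le g hc ξ (cbound_fourier f) (cbound_gradF f) hr hrP
    (majData_fourier f hK) (measurable_hessMaj f) (N2_hessMaj_le f hK)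


/-! ### Passage to the limit -/

lemma tendsto_integral_of_enorm_le {E : Type*} [NormedAddCommGroup E] [NormedSpace ℝ E]
    {F : ℕ → Plane → E} {f : Plane → E} {b : Plane → ℝ≥0∞}
    (hF : ∀ k, AEStronglyMeasurable (F k) volume) (hb : Measurable b) (hbi : ∫⁻ x, b x < ∞)
    (hle : ∀ k x, ‖F k x‖ₑ ≤ b x) (hlim : ∀ᵐ x, Tendsto (fun k => F k x) atTop (𝓝 (f x))) :
    Tendsto (fun k => ∫ x, F k x) atTop (𝓝 (∫ x, f x)) := by
  refine tendsto_integral_of_dominated_convergence (fun x => (b x).toReal) hF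
    (integrable_toReal_of_lintegral_ne_top hb.aemeasurable hbi.ne) (fun k => ?_) hlim
  filter_upwards [ae_lt_top hb hbi.ne] with x hx
  rw [← toReal_enorm]
  exact ENNReal.toReal_mono hx.ne (hle k x)

lemma tendsto_gradInvLaplacian (l : Fin 2) {h : ℕ → Plane → ℝ} {h' : Plane → ℝ}
    {b : Plane → ℝ≥0∞} (hm : ∀ k, Measurable (h k)) (hb : Measurable b)
    (hle : ∀ k x, ‖h k x‖ₑ ≤ b x) (hlim : ∀ᵐ x, Tendsto (fun k => h k x) atTop (𝓝 (h' x)))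
    {x : Plane} (hx : riesz b x < ∞) :
    Tendsto (fun k => gradInvLaplacian l (h k) x) atTop (𝓝 (gradInvLaplacian l h' x)) := by
  unfold gradInvLaplacian
  refine Tendsto.const_mul _ ?_
  have hK : Measurable fun y : Plane => (x - y) l := by fun_prop
  refine tendsto_integral_of_enorm_le (b := fun y => ‖x - y‖ₑ⁻¹ * b y) (fun k => ?_)
    (by fun_prop) hx (fun k y => ?_) ?_
  · have := hm k
    exact Measurable.aestronglyMeasurable (by fun_prop)
  · exact enorm_mul_le_mul (enorm_kernel_le l _) (hle k y)
  · filter_upwards [hlim] with y hy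
    exact hy.const_mul _

section Pointwise

variable {u : Plane → ℂ} {q : Fin 2 → Plane → ℂ} {v p : Plane → ℝ≥0∞}

lemma enorm_potA_le_majA (hu : ∀ x, ‖u x‖ₑ ≤ v x) (j : Fin 2) (x : Plane) :
    ‖potA u j x‖ₑ ≤ majA v x :=
  (enorm_potA_le u j x).trans (riesz_mono (fun y => mul_le_mul' (hu y) (hu y)) x)

lemma enorm_ofReal_eq (a : ℝ) : ‖(a : ℂ)‖ₑ = ‖a‖ₑ := by
  rw [← ofReal_norm, Complex.norm_real, ofReal_norm]

lemma enorm_I_eq : ‖Complex.I‖ₑ = 1 := by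
  rw [← ofReal_norm, Complex.norm_I, ENNReal.ofReal_one]

lemma enorm_cur_le_majJ (hu : ∀ x, ‖u x‖ₑ ≤ v x) (hq : ∀ l x, ‖q l x‖ₑ ≤ p x) (j : Fin 2)
    (x : Plane) : ‖cur u q j x‖ₑ ≤ majJ v p x := by
  have h : ‖cur u q j x‖ₑ ≤ ‖conj (u x) * (q j x + Complex.I * (potA u j x : ℂ) * u x)‖ₑ := by
    rw [← ofReal_norm, ← ofReal_norm]
    exact ENNReal.ofReal_le_ofReal (Complex.abs_im_le_norm _)
  refine h.trans (enorm_mul_le_mul ?_ (enorm_add_le_add (hq j x) (enorm_mul_le_mul ?_ (hu x))))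
  · rw [← ofReal_norm, RCLike.norm_conj, ofReal_norm]
    exact hu x
  · rw [enorm_mul, enorm_I_eq, one_mul, enorm_ofReal_eq]
    exact enorm_potA_le_majA hu j x

lemma enorm_nl_le_majN (g : ℂ) (hu : ∀ x, ‖u x‖ₑ ≤ v x) (hq : ∀ l x, ‖q l x‖ₑ ≤ p x)
    (x : Plane) : ‖nl g u q x‖ₑ ≤ majN g v p x := by
  have hA := fun j => (enorm_ofReal_eq (potA u j x)).trans_le (enorm_potA_le_majA hu j x)
  have hG : ∀ l m, ‖gradInvLaplacian l (cur u q m) x‖ₑ ≤ riesz (majJ v p) x := fun l m =>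
    (enorm_gradInvLaplacian_le l _ x).trans (riesz_mono (enorm_cur_le_majJ hu hq m) x)
  have h0 : ‖(potA0 u q x : ℂ)‖ₑ ≤ riesz (majJ v p) x + riesz (majJ v p) x := by
    rw [enorm_ofReal_eq]
    unfold potA0
    exact enorm_sub_le.trans (add_le_add (hG 0 1) (hG 1 0))
  have h2 : ‖((‖u x‖ ^ 2 : ℝ) : ℂ)‖ₑ ≤ v x * v x := by
    rw [enorm_ofReal_eq, sq, enorm_mul, enorm_norm]
    exact mul_le_mul' (hu x) (hu x)
  unfold nl majN
  refine enorm_add_le_add (enorm_sub_le.trans (add_le_add (enorm_sub_le.trans (add_le_add ?_ ?_)) ?_))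
    ?_
  · refine enorm_mul_le_mul ?_ (hu x)
    rw [enorm_mul, enorm_neg, enorm_I_eq, one_mul]
    exact h0
  · refine enorm_mul_le_mul (by rw [← ofReal_norm]; simp) ?_
    rw [Fin.sum_univ_two]
    exact enorm_add_le_add (enorm_mul_le_mul (hA 0) (hq 0 x)) (enorm_mul_le_mul (hA 1) (hq 1 x))
  · rw [enorm_mul, enorm_I_eq, one_mul, Fin.sum_univ_two, sq, sq]
    exact enorm_add_le_add (enorm_mul_le_mul (enorm_mul_le_mul (hA 0) (hA 0)) (hu x))
      (enorm_mul_le_mul (enorm_mul_le_mul (hA 1) (hA 1)) (hu x))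
  · refine enorm_mul_le_mul (enorm_mul_le_mul ?_ h2) (hu x)
    rw [enorm_mul, enorm_I_eq, one_mul]

end Pointwise

lemma MajData.lintegral_majJ_lt_top {M : ℝ≥0∞} {v p : Plane → ℝ≥0∞} (h : MajData M v p)
    (hM : M < ∞) : ∫⁻ x, majJ v p x < ∞ := by
  have := kerConst_lt_top.ne
  have := hM.ne
  refine h.lintegral_majJ_le.trans_lt (lt_top_iff_ne_top.mpr ?_)
  finiteness

lemma MajData.majA_lt_top {M : ℝ≥0∞} {v p : Plane → ℝ≥0∞} (h : MajData M v p)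
    (hM : M < ∞) (x : Plane) : majA v x < ∞ := by
  have := kerConst_lt_top.ne
  have := hM.ne
  refine (h.majA_le x).trans_lt (lt_top_iff_ne_top.mpr ?_)
  finiteness

section Limit

variable {V : ℕ → Plane → ℂ} {P : ℕ → Fin 2 → Plane → ℂ} {V' : Plane → ℂ}
  {P' : Fin 2 → Plane → ℂ} {M : ℝ≥0∞} {v p : Plane → ℝ≥0∞}

/-- Dominated convergence inside each potential. For `A` the dominating potential is finite
everywhere; for `A₀` the majorant of the current is used only as an integrable function, whose
potential is finite almost everywhere. -/
lemma tendsto_nl_ae (g : ℂ) (hd : MajData M v p) (hM : M < ∞) (hVm : ∀ k, Measurable (V k))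
    (hPm : ∀ k l, Measurable (P k l)) (hV : ∀ k x, ‖V k x‖ₑ ≤ v x)
    (hP : ∀ k l x, ‖P k l x‖ₑ ≤ p x) (hV' : ∀ᵐ x, Tendsto (fun k => V k x) atTop (𝓝 (V' x)))
    (hP' : ∀ l, ∀ᵐ x, Tendsto (fun k => P k l x) atTop (𝓝 (P' l x))) :
    ∀ᵐ x, Tendsto (fun k => nl g (V k) (P k) x) atTop (𝓝 (nl g V' P' x)) := by
  have hG : ∀ l x, Tendsto (fun k => gradInvLaplacian l (fun y => ‖V k y‖ ^ 2) x) atTop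
      (𝓝 (gradInvLaplacian l (fun y => ‖V' y‖ ^ 2) x)) := fun l x => by
    refine tendsto_gradInvLaplacian l (b := fun y => v y * v y)
      (fun k => (hVm k).norm.pow_const 2) (hd.mv.mul hd.mv) (fun k y => ?_) ?_
      (hd.majA_lt_top hM x)
    · rw [sq, enorm_mul, enorm_norm]
      exact mul_le_mul' (hV k y) (hV k y)
    · filter_upwards [hV'] with y hy
      exact hy.norm.pow 2
  have hA : ∀ j x, Tendsto (fun k => potA (V k) j x) atTop (𝓝 (potA V' j x)) := fun j x => by
    unfold potA
    split_ifs
    · exact (hG 1 x).const_mul _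
    · exact (hG 0 x).const_mul _
  have hAc : ∀ j x, Tendsto (fun k => (potA (V k) j x : ℂ)) atTop (𝓝 (potA V' j x : ℂ)) :=
    fun j x => (Complex.continuous_ofReal.tendsto _).comp (hA j x)
  have hJ : ∀ j, ∀ᵐ x, Tendsto (fun k => cur (V k) (P k) j x) atTop (𝓝 (cur V' P' j x)) := by
    intro j
    filter_upwards [hV', hP' j] with x h1 h2
    exact (Complex.continuous_im.tendsto _).comp
      (((Complex.continuous_conj.tendsto _).comp h1).mul
        (h2.add (((hAc j x).const_mul Complex.I).mul h1)))
  filter_upwards [hV', hP' 0, hP' 1,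
    riesz_lt_top_ae hd.measurable_majJ (hd.lintegral_majJ_lt_top hM)] with x h1 h2 h2' h3
  have hGJ : ∀ l m, Tendsto (fun k => gradInvLaplacian l (cur (V k) (P k) m) x) atTop
      (𝓝 (gradInvLaplacian l (cur V' P' m) x)) := fun l m =>
    tendsto_gradInvLaplacian l (fun k => measurable_cur (hVm k) (hPm k) m) hd.measurable_majJ
      (fun k => enorm_cur_le_majJ (hV k) (hP k) m) (hJ m) h3
  have h0 : Tendsto (fun k => (potA0 (V k) (P k) x : ℂ)) atTop (𝓝 (potA0 V' P' x : ℂ)) :=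
    (Complex.continuous_ofReal.tendsto _).comp ((hGJ 0 1).sub (hGJ 1 0))
  have hn : Tendsto (fun k => ((‖V k x‖ ^ 2 : ℝ) : ℂ)) atTop (𝓝 ((‖V' x‖ ^ 2 : ℝ) : ℂ)) :=
    (Complex.continuous_ofReal.tendsto _).comp (h1.norm.pow 2)
  unfold nl
  simp only [Fin.sum_univ_two]
  exact ((((h0.const_mul _).mul h1).sub ((((hAc 0 x).mul h2).add
    ((hAc 1 x).mul h2')).const_mul _)).sub (((((hAc 0 x).pow 2).mul h1).add
    (((hAc 1 x).pow 2).mul h1)).const_mul _)).add ((hn.const_mul _).mul h1)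

lemma tendsto_integral_nl_mul (g : ℂ) (hd : MajData M v p) (hM : M < ∞)
    (hVm : ∀ k, Measurable (V k)) (hPm : ∀ k l, Measurable (P k l)) (hV : ∀ k x, ‖V k x‖ₑ ≤ v x)
    (hP : ∀ k l x, ‖P k l x‖ₑ ≤ p x) (hV' : ∀ᵐ x, Tendsto (fun k => V k x) atTop (𝓝 (V' x)))
    (hP' : ∀ l, ∀ᵐ x, Tendsto (fun k => P k l x) atTop (𝓝 (P' l x))) {Ψ : Plane → ℂ}
    (hΨ : Measurable Ψ) (hΨ2 : N2 (fun x => ‖Ψ x‖ₑ) < ∞) :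
    Tendsto (fun k => ∫ x, nl g (V k) (P k) x * Ψ x) atTop (𝓝 (∫ x, nl g V' P' x * Ψ x)) := by
  have h0 := hd.mv
  have h1 := hd.mp
  have h2 := hd.measurable_majA
  have h3 := hd.measurable_majJ
  have h4 := measurable_riesz h3
  refine tendsto_integral_of_enorm_le (b := fun x => ‖Ψ x‖ₑ * majN g v p x) (fun k => ?_) ?_ ?_
    (fun k x => ?_) ?_
  · exact ((measurable_nl g (hVm k) (hPm k)).mul hΨ).aestronglyMeasurable
  · unfold majN
    fun_prop
  · refine (hd.lintegral_majN_le g hΨ.enorm).trans_lt (lt_top_iff_ne_top.mpr ?_)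
    have := (MajData.const_lt_top g).ne
    have := hΨ2.ne
    have := hM.ne
    finiteness
  · rw [mul_comm]
    exact enorm_mul_le_mul le_rfl (enorm_nl_le_majN g (hV k) (hP k) x)
  · filter_upwards [tendsto_nl_ae g hd hM hVm hPm hV hP hV' hP'] with x hx
    exact hx.mul_const _

end Limit

/-! ### Approximation by Schwartz functions in the weighted space -/

/-- A fast convergent sequence in `L²` converges almost everywhere and has a majorant in `L²`. -/
lemma exists_majorant {F : ℕ → Plane → ℂ} {f : Plane → ℂ} (hF : ∀ k, Measurable (F k))
    (hf : Measurable f) (hf2 : N2 (fun x => ‖f x‖ₑ) < ∞)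
    (hs : ∑' k, N2 (fun x => ‖F k x - f x‖ₑ) ^ (2 : ℝ) < ∞) :
    (∀ᵐ x, Tendsto (fun k => F k x) atTop (𝓝 (f x))) ∧ N2 (fun x => ⨆ k, ‖F k x‖ₑ) < ∞ := by
  have hN : ∀ h : Plane → ℝ≥0∞, N2 h ^ (2 : ℝ) = ∫⁻ x, h x ^ (2 : ℝ) := fun h => by
    rw [N2, ← ENNReal.rpow_mul]
    norm_num
  simp_rw [hN] at hs
  have hm : ∀ k, Measurable fun x => ‖F k x - f x‖ₑ ^ (2 : ℝ) := fun k => by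
    have := hF k
    fun_prop
  -- The sum of the squared differences is an integrable function. Its finiteness almost everywhere
  -- forces convergence, and it dominates all terms of the sequence at once.
  rw [← lintegral_tsum fun k => (hm k).aemeasurable] at hs
  have hms : Measurable fun x => ∑' k, ‖F k x - f x‖ₑ ^ (2 : ℝ) := Measurable.tsum hm
  constructor
  · filter_upwards [ae_lt_top hms hs.ne] with x hx
    have h1 := ENNReal.tendsto_atTop_zero_of_tsum_ne_top hx.ne
    rw [tendsto_iff_edist_tendsto_0]
    have h2 := h1.ennrpow_const (1 / 2 : ℝ)
    simp_rw [← ENNReal.rpow_mul, edist_eq_enorm_sub] at h2 ⊢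
    norm_num at h2
    exact h2
  · have hle : ∀ x, (⨆ k, ‖F k x‖ₑ) ^ (2 : ℝ) ≤
        4 * ((∑' k, ‖F k x - f x‖ₑ ^ (2 : ℝ)) + ‖f x‖ₑ ^ (2 : ℝ)) := fun x => by
      rw [← ENNReal.le_rpow_inv_iff (by norm_num)]
      refine iSup_le fun k => ?_
      rw [ENNReal.le_rpow_inv_iff (by norm_num)]
      have h1 : ‖F k x‖ₑ ≤ ‖F k x - f x‖ₑ + ‖f x‖ₑ := by
        conv_lhs => rw [← sub_add_cancel (F k x) (f x)]
        exact enorm_add_le _ _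
      have h2 : ∀ a b : ℝ≥0∞, (a + b) ^ (2 : ℝ) ≤ 4 * (a ^ (2 : ℝ) + b ^ (2 : ℝ)) := fun a b => by
        have h3 := ENNReal.rpow_le_rpow (add_le_add (le_max_left a b) (le_max_right a b))
          (zero_le_two (α := ℝ))
        refine h3.trans ?_
        rw [← two_mul, ENNReal.mul_rpow_of_nonneg _ _ zero_le_two]
        norm_num
        gcongr
        rcases le_total a b with h | h
        · rw [max_eq_right h]
          exact le_add_self
        · rw [max_eq_left h]
          exact le_self_add
      refine (ENNReal.rpow_le_rpow h1 zero_le_two).trans ((h2 _ _).trans ?_)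
      gcongr
      exact ENNReal.le_tsum k
    refine ENNReal.rpow_lt_top_of_nonneg (by norm_num) (lt_top_iff_ne_top.mp ?_)
    refine (lintegral_mono hle).trans_lt ?_
    rw [lintegral_const_mul _ (by fun_prop), lintegral_add_left hms]
    refine ENNReal.mul_lt_top (by norm_num) (ENNReal.add_lt_top.mpr ⟨hs, ?_⟩)
    rw [← hN]
    exact ENNReal.rpow_lt_top_of_nonneg (by norm_num) hf2.ne

lemma N2_congr_ae {f g : Plane → ℝ≥0∞} (h : f =ᵐ[volume] g) : N2 f = N2 g := by
  unfold N2
  congr 1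
  refine lintegral_congr_ae ?_
  filter_upwards [h] with x hx
  rw [hx]

lemma wNorm_congr_ae {f g : Plane → ℂ} (h : f =ᵐ[volume] g) : wNorm f = wNorm g := by
  unfold wNorm
  congr 1 <;>
  · refine N2_congr_ae ?_
    filter_upwards [h] with x hx
    rw [hx]

lemma wNorm_add_le {f g : Plane → ℂ} (hf : Measurable f) (hg : Measurable g) :
    wNorm (fun y => f y + g y) ≤ wNorm f + wNorm g := by
  have h1 : N2 (fun y => ‖f y + g y‖ₑ) ≤ N2 (fun y => ‖f y‖ₑ) + N2 fun y => ‖g y‖ₑ :=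
    (N2_mono fun y => enorm_add_le _ _).trans (N2_add_le hf.enorm hg.enorm)
  have h2 : N2 (fun y => ‖y‖ₑ ^ 2 * ‖f y + g y‖ₑ) ≤
      N2 (fun y => ‖y‖ₑ ^ 2 * ‖f y‖ₑ) + N2 fun y => ‖y‖ₑ ^ 2 * ‖g y‖ₑ := by
    refine (N2_mono fun y => ?_).trans (N2_add_le (by fun_prop) (by fun_prop))
    rw [← mul_add]
    gcongr
    exact enorm_add_le _ _
  refine (add_le_add h1 h2).trans (le_of_eq ?_)
  unfold wNorm
  ring

/-- Schwartz functions are dense in the weighted space. -/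
lemma exists_schwartz_wNorm_sub_le (w : L2) (hw : wNorm w < ∞) {η : ℝ≥0∞} (hη : η ≠ 0) :
    ∃ f : 𝓢(Plane, ℂ), wNorm (fun y => f y - w y) ≤ η := by
  wlog hη' : η < ∞
  · obtain ⟨f, hf⟩ := this w hw one_ne_zero ENNReal.one_lt_top
    exact ⟨f, hf.trans (by rw [not_lt_top_iff.mp hη']; exact le_top)⟩
  have hwm := measurable_L2 w
  -- The weighted norm of `w` is equivalent to the `L²` norm of `(1 + |y|²) w`. That function is
  -- approximated by a Schwartz function, which is then divided by `1 + |y|²`.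
  set h : Plane → ℂ := fun y => ((1 + ‖y‖ ^ 2 : ℝ) : ℂ) * w y with hh
  have hm : Measurable h := by fun_prop
  have hpos : ∀ y : Plane, 0 < 1 + ‖y‖ ^ 2 := fun y => by positivity
  have hen : ∀ y : Plane, ‖((1 + ‖y‖ ^ 2 : ℝ) : ℂ)‖ₑ = 1 + ‖y‖ₑ ^ 2 := fun y => by
    rw [enorm_ofReal_eq, Real.enorm_of_nonneg (hpos y).le,
      ENNReal.ofReal_add (by norm_num) (by positivity), ENNReal.ofReal_pow (norm_nonneg _),
      ofReal_norm, ENNReal.ofReal_one]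
  have h2 : MemLp h 2 := by
    refine ⟨hm.aestronglyMeasurable, ?_⟩
    rw [← N2_enorm]
    refine lt_of_le_of_lt ?_ hw
    refine (N2_mono fun y => ?_).trans (N2_add_le (f := fun y => ‖w y‖ₑ)
      (g := fun y => ‖y‖ₑ ^ 2 * ‖w y‖ₑ) (by fun_prop) (by fun_prop))
    rw [hh, enorm_mul, hen, add_mul, one_mul]
  have hd := SchwartzMap.denseRange_toLpCLM (E := Plane) (F := ℂ) (p := 2) (by norm_num)
    (μ := volume)
  have hη2 : 0 < (η / 2).toReal :=
    ENNReal.toReal_pos (by simpa using hη) (ENNReal.div_lt_top hη'.ne two_ne_zero).ne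
  obtain ⟨G, hG⟩ := hd.exists_dist_lt (h2.toLp h) hη2
  have hG2 : N2 (fun y => ‖G y - h y‖ₑ) ≤ η / 2 := by
    have e : N2 (fun y => ‖G y - h y‖ₑ) = ‖(G.toLp 2 : L2) - h2.toLp h‖ₑ := by
      rw [enorm_L2_eq_N2]
      refine N2_congr_ae ?_
      filter_upwards [Lp.coeFn_sub (G.toLp 2 : L2) (h2.toLp h), G.coeFn_toLp 2 volume,
        h2.coeFn_toLp] with y h1 h3 h4
      rw [h1, Pi.sub_apply, h3, h4]
    rw [e, ← edist_eq_enorm_sub, edist_comm, edist_dist]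
    exact ENNReal.ofReal_le_of_le_toReal hG.le
  have htg := Function.hasTemperateGrowth_one_add_norm_sq_rpow Plane (-1)
  refine ⟨SchwartzMap.smulLeftCLM ℂ (fun x : Plane => (1 + ‖x‖ ^ 2) ^ (-1 : ℝ)) G, ?_⟩
  have hval : ∀ y, ‖G y - h y‖ₑ = (1 + ‖y‖ₑ ^ 2) *
      ‖SchwartzMap.smulLeftCLM ℂ (fun x : Plane => (1 + ‖x‖ ^ 2) ^ (-1 : ℝ)) G y - w y‖ₑ :=
    fun y => by
      rw [SchwartzMap.smulLeftCLM_apply_apply htg, ← hen, ← enorm_mul, mul_sub, Real.rpow_neg_one,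
        Complex.real_smul, ← mul_assoc, ← Complex.ofReal_mul, mul_inv_cancel₀ (hpos y).ne',
        Complex.ofReal_one, one_mul]
  have hle : ∀ s : Plane → ℝ≥0∞, (∀ y, s y ≤ 1 + ‖y‖ₑ ^ 2) → N2 (fun y => s y *
      ‖SchwartzMap.smulLeftCLM ℂ (fun x : Plane => (1 + ‖x‖ ^ 2) ^ (-1 : ℝ)) G y - w y‖ₑ) ≤
        η / 2 := fun s hs => by
    refine (N2_mono fun y => ?_).trans hG2
    rw [hval]
    gcongr
    exact hs y
  have h3 := hle (fun _ => 1) fun _ => le_self_add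
  have h4 := hle (fun y => ‖y‖ₑ ^ 2) fun _ => le_add_self
  simp only [one_mul] at h3
  exact (add_le_add h3 h4).trans (ENNReal.add_halves η).le

lemma enorm_fourier_L2 (w : L2) : ‖(𝓕 w : L2)‖ₑ = ‖w‖ₑ := by
  rw [← ofReal_norm, ← ofReal_norm, Lp.norm_fourier_eq]

lemma N2_fourier_sub (f : 𝓢(Plane, ℂ)) (w : L2) :
    N2 (fun x => ‖𝓕 f x - (𝓕 w : L2) x‖ₑ) = N2 fun x => ‖f x - w x‖ₑ := by
  have e : ∀ (f : 𝓢(Plane, ℂ)) (w : L2), N2 (fun x => ‖f x - w x‖ₑ) = ‖(f.toLp 2 : L2) - w‖ₑ := by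
    intro f w
    rw [enorm_L2_eq_N2]
    refine N2_congr_ae ?_
    filter_upwards [Lp.coeFn_sub (f.toLp 2 : L2) w, f.coeFn_toLp 2 volume] with y h1 h3
    rw [h1, Pi.sub_apply, h3]
  rw [e, e, ← SchwartzMap.toLp_fourier_eq, ← enorm_fourier_L2 (f.toLp 2 volume - w),
    sub_eq_add_neg (f.toLp 2 volume),
    FourierTransform.fourier_add, FourierTransform.fourier_neg, sub_eq_add_neg]

/-- The oscillatory estimate for weighted square-integrable profiles. -/
lemma enorm_integral_nl_L2_le (g : ℂ) {c : ℝ} (hc : 1 ≤ |c|) (w : L2) (wl : Fin 2 → L2)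
    (hwl : ∀ l, wl l =ᵐ[volume] fun y => coord l y * w y) {K : ℝ≥0∞} (hK0 : K ≠ 0) (hKt : K < ∞)
    (hK : wNorm w ≤ K) {H Ψ : Plane → ℂ} (hH : Integrable H) (hΨm : Measurable Ψ)
    (hΨ2 : N2 (fun x => ‖Ψ x‖ₑ) < ∞) (hΨ : ∀ X, Ψ X = ∫ ξ, phase c ξ X * H ξ) :
    ‖∫ X, nl g (𝓕 w : L2) (fun l X => -(2 * Real.pi * Complex.I) * (𝓕 (wl l) : L2) X) X * Ψ X‖ₑ ≤
      coreConst g * ENNReal.ofReal ((Real.sqrt |c|)⁻¹) *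
        ((wConst * (2 * K)) ^ 3 + (wConst * (2 * K)) ^ 5) * ∫⁻ ξ, ‖H ξ‖ₑ := by
  have hη : ∀ k : ℕ, K * 2⁻¹ ^ k ≠ 0 := fun k => by simp [hK0]
  -- The geometric rate makes the squared `L²` errors summable, as `exists_majorant` requires; it is
  -- at most `K`, so all approximations have weighted norm at most `2K`.
  choose f hf using fun k => exists_schwartz_wNorm_sub_le w (hK.trans_lt hKt) (hη k)
  have hwm := measurable_L2 w
  have hfK : ∀ k, wNorm (f k) ≤ 2 * K := fun k => by
    have h1 := wNorm_add_le (f := fun y => f k y - w y) (g := w)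
      ((measurable_schwartz _).sub hwm) hwm
    simp only [sub_add_cancel] at h1
    refine h1.trans ((add_le_add (hf k) hK).trans ?_)
    rw [two_mul]
    gcongr
    exact mul_le_of_le_one_right' (pow_le_one' (by norm_num) k)
  have hsum : ∀ {a : ℕ → ℝ≥0∞}, (∀ k, a k ≤ 7 * (K * 2⁻¹ ^ k)) → ∑' k, a k ^ (2 : ℝ) < ∞ := by
    intro a ha
    have h1 : ∀ k, a k ^ (2 : ℝ) ≤ (7 * K) ^ (2 : ℝ) * 2⁻¹ ^ k := fun k => by
      refine (ENNReal.rpow_le_rpow (ha k) zero_le_two).trans ?_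
      rw [← mul_assoc, ENNReal.mul_rpow_of_nonneg _ _ zero_le_two]
      gcongr
      norm_num
      rw [sq]
      exact mul_le_of_le_one_right' (pow_le_one' (by norm_num) k)
    refine (ENNReal.tsum_le_tsum h1).trans_lt ?_
    rw [ENNReal.tsum_mul_left, ENNReal.tsum_geometric]
    have := hKt.ne
    refine ENNReal.mul_lt_top (ENNReal.rpow_lt_top_of_nonneg (by norm_num) (by finiteness)) ?_
    rw [ENNReal.one_sub_inv_two, inv_inv]
    norm_num
  have hV : ∀ k, N2 (fun x => ‖𝓕 (f k) x - (𝓕 w : L2) x‖ₑ) ≤ 7 * (K * 2⁻¹ ^ k) := fun k => by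
    rw [N2_fourier_sub]
    exact (le_self_add.trans (hf k)).trans (le_mul_of_one_le_left zero_le (by norm_num))
  have hP : ∀ l k, N2 (fun x => ‖gradF l (f k) x -
      -(2 * Real.pi * Complex.I) * (𝓕 (wl l) : L2) x‖ₑ) ≤ 7 * (K * 2⁻¹ ^ k) := fun l k => by
    have h1 : ∀ x, ‖gradF l (f k) x - -(2 * Real.pi * Complex.I) * (𝓕 (wl l) : L2) x‖ₑ ≤
        7 * ‖𝓕 (mulC l (f k)) x - (𝓕 (wl l) : L2) x‖ₑ := fun x => by
      rw [gradF_apply, ← mul_sub, enorm_mul]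
      gcongr
      exact enorm_two_pi_I
    refine (N2_mono h1).trans ?_
    rw [N2_const_mul 7 (f := fun x => ‖𝓕 (mulC l (f k)) x - (𝓕 (wl l) : L2) x‖ₑ)
      ((measurable_schwartz _).sub (measurable_L2 _)).enorm, N2_fourier_sub]
    gcongr
    refine le_trans (le_of_eq ?_) ((N2_coord_mul_le ((measurable_schwartz (f k)).sub hwm) l).trans
      (hf k))
    refine N2_congr_ae ?_
    filter_upwards [hwl l] with y hy
    rw [hy, mulC_apply, Pi.sub_apply, mul_sub]
  have hL : ∀ u : L2, N2 (fun x => ‖u x‖ₑ) < ∞ := fun u => by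
    rw [← enorm_L2_eq_N2]
    exact enorm_lt_top
  obtain ⟨hVt, hVs⟩ := exists_majorant (fun k => measurable_schwartz (𝓕 (f k)))
    (measurable_L2 (𝓕 w)) (hL _) (hsum hV)
  have hPt := fun l => exists_majorant (fun k => measurable_schwartz (gradF l (f k)))
    ((measurable_L2 (𝓕 (wl l))).const_mul (-(2 * Real.pi * Complex.I))) (by
      have h7 : N2 (fun x => 7 * ‖(𝓕 (wl l) : L2) x‖ₑ) < ∞ := by
        rw [N2_const_mul 7 (by fun_prop)]
        exact ENNReal.mul_lt_top (by norm_num) (hL _)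
      refine (N2_mono fun x => ?_).trans_lt h7
      rw [enorm_mul]
      gcongr
      exact enorm_two_pi_I) (hsum (hP l))
  set v : Plane → ℝ≥0∞ := fun x => ⨆ k, ‖𝓕 (f k) x‖ₑ with hv
  set p : Plane → ℝ≥0∞ := fun x => (⨆ k, ‖gradF 0 (f k) x‖ₑ) + ⨆ k, ‖gradF 1 (f k) x‖ₑ with hp
  have hmv : Measurable v := Measurable.iSup fun k => (measurable_schwartz _).enorm
  have hmp : ∀ l, Measurable fun x => ⨆ k, ‖gradF l (f k) x‖ₑ :=
    fun l => Measurable.iSup fun k => (measurable_schwartz _).enorm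
  have hp2 : N2 p < ∞ := (N2_add_le (hmp 0) (hmp 1)).trans_lt
    (ENNReal.add_lt_top.mpr ⟨(hPt 0).2, (hPt 1).2⟩)
  have hvK : ∀ x, v x ≤ wConst * (2 * K) := fun x => iSup_le fun k =>
    (majData_fourier (f k) (hfK k)).sup x
  -- This constant is only known to be finite and serves domination alone. The quantitative bound
  -- passes to the limit from the estimates for the approximations, which are uniform in `k`.
  have hd : MajData (wConst * (2 * K) + N2 v + N2 p) v p :=
    ⟨hmv, (hmp 0).add (hmp 1), fun x => (hvK x).trans (by rw [add_assoc]; exact le_self_add),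
      le_add_self.trans le_self_add, le_add_self⟩
  have hMt : wConst * (2 * K) + N2 v + N2 p < ∞ :=
    ENNReal.add_lt_top.mpr ⟨ENNReal.add_lt_top.mpr ⟨ENNReal.mul_lt_top wConst_lt_top
      (ENNReal.mul_lt_top (by norm_num) hKt), hVs⟩, hp2⟩
  have hlim := tendsto_integral_nl_mul g hd hMt (V := fun k => (𝓕 (f k) : 𝓢(Plane, ℂ)))
    (P := fun k l => ⇑(gradF l (f k))) (fun k => measurable_schwartz _)
    (fun k l => measurable_schwartz _) (fun k x => le_iSup (fun k => ‖𝓕 (f k) x‖ₑ) k)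
    (fun k l x => by
      fin_cases l
      · exact (le_iSup (fun k => ‖gradF 0 (f k) x‖ₑ) k).trans le_self_add
      · exact (le_iSup (fun k => ‖gradF 1 (f k) x‖ₑ) k).trans le_add_self)
    hVt (fun l => (hPt l).1) hΨm hΨ2
  exact le_of_tendsto hlim.enorm (Eventually.of_forall fun k =>
    enorm_integral_nl_fourier_mul_le g hc (f k) (hfK k) hH hΨ)


/-! ### The nonlinear estimate -/

lemma wNorm_chirpMul (c : ℝ) (f : L2) : wNorm (chirpMul c f) = wNorm f := by
  rw [wNorm_congr_ae (chirpMul_ae c f)]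
  unfold wNorm
  have h : ∀ y, ‖chirp c y * f y‖ₑ = ‖f y‖ₑ := fun y => by
    rw [enorm_mul, ← ofReal_norm (chirp c y), norm_chirp, ENNReal.ofReal_one, one_mul]
  simp_rw [h]

lemma exists_coord_mul (f : L2) (hf : wNorm f < ∞) (l : Fin 2) :
    ∃ h : L2, h =ᵐ[volume] fun y => coord l y * f y := by
  have hm : MemLp (fun y => coord l y * f y) 2 := by
    refine ⟨((hasTemperateGrowth_coord l).1.continuous.measurable.mul
      (measurable_L2 f)).aestronglyMeasurable, ?_⟩
    rw [← N2_enorm]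
    exact (N2_coord_mul_le (measurable_L2 f) l).trans_lt hf
  exact ⟨hm.toLp, hm.coeFn_toLp⟩

/-- The same completion of the square on the test side: the dilated Fourier integral, chirped in
`X`, becomes a superposition of quadratic phases centred at `ξ` with weights of modulus `|G(ξ)|`. -/
lemma chirp_mul_fourier_smul (τ : ℝ) (G : 𝓢(Plane, ℂ)) (X : Plane) :
    -Complex.I * chirp (4 * Real.pi ^ 2 * τ) X * 𝓕 G ((4 * Real.pi * τ) • X) =
      ∫ ξ, phase (4 * Real.pi ^ 2 * τ) ξ X *
        (-Complex.I * chirp (-(4 * Real.pi ^ 2 * τ)) ξ * G ξ) := by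
  rw [SchwartzMap.fourier_coe, Real.fourier_eq', ← integral_const_mul]
  refine integral_congr_ae (Eventually.of_forall fun ξ => ?_)
  simp only [smul_eq_mul]
  have h : chirp (4 * Real.pi ^ 2 * τ) X *
      Complex.exp (↑(-2 * Real.pi * inner ℝ ξ ((4 * Real.pi * τ) • X)) * Complex.I) =
      phase (4 * Real.pi ^ 2 * τ) ξ X * chirp (-(4 * Real.pi ^ 2 * τ)) ξ := by
    unfold chirp phase
    rw [← Complex.exp_add, ← Complex.exp_add, norm_sub_sq_real, inner_smul_right,
      real_inner_comm ξ X]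
    congr 1
    push_cast
    ring
  linear_combination -Complex.I * G ξ * h

lemma N2_comp_smul_lt_top {f : Plane → ℂ} {r : ℝ} (hr : r ≠ 0) (h : N2 (fun x => ‖f x‖ₑ) < ∞) :
    N2 (fun x => ‖f (r • x)‖ₑ) < ∞ := by
  unfold N2 at h ⊢
  rw [lintegral_comp_smul_plane (fun x => ‖f x‖ₑ ^ (2 : ℝ)) hr]
  refine ENNReal.rpow_lt_top_of_nonneg (by norm_num) (ENNReal.mul_ne_top (by simp) ?_)
  intro h3
  rw [h3, ENNReal.top_rpow_of_pos (by norm_num)] at h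
  exact h.ne rfl

/-- The constant in the nonlinear estimate. -/
def nlConst (g : ℂ) : ℝ≥0∞ := coreConst g * ((2 * wConst) ^ 3 + (2 * wConst) ^ 5)

lemma nlConst_lt_top (g : ℂ) : nlConst g < ∞ := by
  have := wConst_lt_top.ne
  have := (coreConst_lt_top g).ne
  unfold nlConst
  finiteness

/-- The decay of the nonlinearity, tested against the Fourier transform of an integrable
function. -/
lemma enorm_integral_nonlinearity_le (g : ℂ) {τ : ℝ} (hτ : 1 ≤ |τ|) {u : L2} {b : ℝ≥0∞}
    (hb : ∀ᵐ x, ‖u x‖ₑ ≤ b) (hb' : b < ∞)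
    (hu : ∀ k, l2Norm (∂_{e k} (u : 𝓢'(Plane, ℂ))) < ∞) {K : ℝ≥0∞} (hK0 : K ≠ 0) (hKt : K < ∞)
    (hK : wNorm (freeInvL2 τ u) ≤ K) (G : 𝓢(Plane, ℂ)) :
    ‖∫ x, nonlinearity g u x * 𝓕 G x‖ₑ ≤
      nlConst g * ENNReal.ofReal (|τ|⁻¹ * (Real.sqrt |τ|)⁻¹) * (K ^ 3 + K ^ 5) * ∫⁻ ξ, ‖G ξ‖ₑ := by
  have hτ0 : τ ≠ 0 := fun h => by
    rw [h, abs_zero] at hτ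
    linarith
  have hρ := rho_ne_zero hτ0
  have hπ := Real.pi_gt_three
  set ρ := 4 * Real.pi * τ with hρd
  set c := 4 * Real.pi ^ 2 * τ with hcd
  have hc : |τ| ≤ |c| := by
    rw [hcd, abs_mul, abs_of_pos (show 0 < 4 * Real.pi ^ 2 by positivity)]
    exact le_mul_of_one_le_left (abs_nonneg _) (by nlinarith)
  have hρτ : |τ| ≤ |ρ| := by
    rw [hρd, abs_mul, abs_of_pos (show 0 < 4 * Real.pi by positivity)]
    exact le_mul_of_one_le_left (abs_nonneg _) (by linarith)
  set w := chirpMul (1 / (4 * τ)) (freeInvL2 τ u) with hw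
  have hwK : wNorm w ≤ K := (wNorm_chirpMul _ _).trans_le hK
  choose wl hwl using exists_coord_mul w (hwK.trans_lt hKt)
  have hgrad := fun l => fourier_coord_chirpMul_freeInvL2 hτ0 u l (hu l) (hwl l)
  set P : Fin 2 → Plane → ℂ := fun l X => -(2 * Real.pi * Complex.I) * (𝓕 (wl l) : L2) X with hP
  have hV : (𝓕 w : L2) =ᵐ[volume] psc τ u := by
    rw [hw, fourier_chirpMul_freeInvL2 hτ0]
    exact pscL2_ae hτ0 u
  have hnl : nl g (𝓕 w : L2) P =ᵐ[volume]
      fun X => (ρ : ℂ) ^ 2 * psc τ (nonlinearity g u) X := by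
    refine (nl_congr g hV fun l => (hgrad l).1).trans ?_
    filter_upwards [ae_comp_smul (kerInt_sq_ae u) hρ,
      ae_comp_smul (kerInt_cur_ae (fun l => partialL2 l u) hb hb' 0) hρ,
      ae_comp_smul (kerInt_cur_ae (fun l => partialL2 l u) hb hb' 1) hρ,
      ae_comp_smul (kerInt_coord_ae (hgrad 0).2) hρ, ae_comp_smul (kerInt_coord_ae (hgrad 1).2) hρ,
      ae_comp_smul (nonlinearity_ae_eq g hb hb' hu) hρ] with X h1 h2 h3 h4 h5 h6
    have h7 := nl_psc g hτ0 u (fun l => partialL2 l u) X h1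
      (fun j => by fin_cases j <;> assumption) (fun j => by fin_cases j <;> assumption)
    refine h7.trans ?_
    rw [psc, psc, h6]
  set Ψ : Plane → ℂ := fun X => -Complex.I * chirp c X * 𝓕 G (ρ • X) with hΨ
  have hΨm : Measurable Ψ := by
    have h1 := (continuous_chirp c).measurable
    have h2 : Measurable fun X : Plane => 𝓕 G (ρ • X) :=
      (measurable_schwartz (𝓕 G)).comp (measurable_const_smul ρ)
    fun_prop
  have hΨn : ∀ X, ‖Ψ X‖ₑ = ‖𝓕 G (ρ • X)‖ₑ := fun X => by
    rw [hΨ]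
    simp only
    rw [enorm_mul, enorm_mul, enorm_neg, enorm_I_eq, ← ofReal_norm (chirp c X), norm_chirp,
      ENNReal.ofReal_one, one_mul, one_mul]
  have hΨ2 : N2 (fun X => ‖Ψ X‖ₑ) < ∞ := by
    simp_rw [hΨn]
    refine N2_comp_smul_lt_top hρ ?_
    rw [← N2_toLp]
    exact enorm_lt_top
  have hmain := enorm_integral_nl_L2_le g (hτ.trans hc) w wl hwl hK0 hKt hwK
    (H := fun ξ => -Complex.I * chirp (-c) ξ * G ξ) (Ψ := Ψ) ?_ hΨm hΨ2
    (fun X => chirp_mul_fourier_smul τ G X)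
  · have hHn : ∀ ξ, ‖-Complex.I * chirp (-c) ξ * G ξ‖ₑ = ‖G ξ‖ₑ := fun ξ => by
      rw [enorm_mul, enorm_mul, enorm_neg, enorm_I_eq, ← ofReal_norm (chirp (-c) ξ), norm_chirp,
        ENNReal.ofReal_one, one_mul, one_mul]
    simp_rw [hHn] at hmain
    -- The Jacobian is `ρ²`, while the transformed nonlinearity carries `ρ²` by covariance and
    -- another `ρ` from the transform; the net factor is `ρ⁻¹`. With `|c|^{-1/2}` it yields
    -- `|τ|^{-3/2}`.
    have hint : ∫ x, nonlinearity g u x * 𝓕 G x = ((ρ⁻¹ : ℝ) : ℂ) *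
        ∫ X, nl g (𝓕 w : L2) P X * Ψ X := by
      have h1 := integral_comp_smul_plane (fun x => nonlinearity g u x * 𝓕 G x) hρ
      have hρc : (ρ : ℂ) ≠ 0 := by exact_mod_cast hρ
      have h2 : ∫ x, nonlinearity g u x * 𝓕 G x =
          (ρ : ℂ) ^ 2 * ∫ X, nonlinearity g u (ρ • X) * 𝓕 G (ρ • X) := by
        rw [h1]
        push_cast
        field_simp
      rw [h2, ← integral_const_mul, ← integral_const_mul]
      refine integral_congr_ae ?_
      filter_upwards [hnl] with X hX
      rw [hX, psc, hΨ]
      have h3 := chirp_mul_neg_apply c X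
      push_cast
      rw [← Complex.ofReal_ofNat, ← Complex.ofReal_mul, ← Complex.ofReal_mul, ← hρd, ← hcd]
      field_simp
      linear_combination (-(nonlinearity g u (ρ • X)) * 𝓕 G (ρ • X)) * h3
        + chirp c X * chirp (-c) X * nonlinearity g u (ρ • X) * 𝓕 G (ρ • X) * Complex.I_sq
    rw [hint, enorm_mul]
    have hρe : ‖((ρ⁻¹ : ℝ) : ℂ)‖ₑ ≤ ENNReal.ofReal |τ|⁻¹ := by
      rw [← ofReal_norm, Complex.norm_real, Real.norm_eq_abs, abs_inv]
      exact ENNReal.ofReal_le_ofReal (inv_anti₀ (by linarith) hρτ)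
    have hce : ENNReal.ofReal (Real.sqrt |c|)⁻¹ ≤ ENNReal.ofReal (Real.sqrt |τ|)⁻¹ :=
      ENNReal.ofReal_le_ofReal (inv_anti₀ (Real.sqrt_pos.mpr (by linarith)) (Real.sqrt_le_sqrt hc))
    have hpoly : (wConst * (2 * K)) ^ 3 + (wConst * (2 * K)) ^ 5 ≤
        ((2 * wConst) ^ 3 + (2 * wConst) ^ 5) * (K ^ 3 + K ^ 5) := by
      calc _ = (2 * wConst) ^ 3 * K ^ 3 + (2 * wConst) ^ 5 * K ^ 5 := by ring
        _ ≤ (2 * wConst) ^ 3 * K ^ 3 + (2 * wConst) ^ 5 * K ^ 5 +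
          ((2 * wConst) ^ 3 * K ^ 5 + (2 * wConst) ^ 5 * K ^ 3) := le_self_add
        _ = _ := by ring
    calc _ ≤ ENNReal.ofReal |τ|⁻¹ * (coreConst g * ENNReal.ofReal (Real.sqrt |τ|)⁻¹ *
          (((2 * wConst) ^ 3 + (2 * wConst) ^ 5) * (K ^ 3 + K ^ 5)) * ∫⁻ ξ, ‖G ξ‖ₑ) := by
          refine mul_le_mul' hρe (hmain.trans ?_)
          gcongr
      _ = _ := by
          rw [ENNReal.ofReal_mul (by positivity), nlConst]
          ring
  · exact G.integrable.bdd_mul (c := 1)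
      (continuous_const.mul (continuous_chirp _)).aestronglyMeasurable
      (Eventually.of_forall fun ξ => by rw [norm_mul, norm_neg, Complex.norm_I, norm_chirp, one_mul])


/-! ### Time evolution of the profile -/

lemma norm_exp_sub_one_sub_id_le (r : ℝ) :
    ‖Complex.exp (Complex.I * r) - 1 - Complex.I * r‖ ≤ 3 * r ^ 2 := by
  have hn : ‖Complex.I * (r : ℂ)‖ = |r| := by
    rw [norm_mul, Complex.norm_I, one_mul, Complex.norm_real, Real.norm_eq_abs]
  by_cases h : |r| ≤ 1
  · have := Complex.norm_exp_sub_one_sub_id_le (x := Complex.I * r) (by rwa [hn])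
    rw [hn, sq_abs] at this
    nlinarith [sq_nonneg r]
  · have h1 : ‖Complex.exp (Complex.I * r)‖ = 1 := by
      rw [mul_comm]
      exact Complex.norm_exp_ofReal_mul_I _
    refine (norm_sub_le _ _).trans ((add_le_add_left (norm_sub_le _ _) _).trans ?_)
    rw [h1, hn, norm_one]
    nlinarith [sq_abs r]

/-- The second-order Taylor remainder of the exponential is at most `3 s² |y|⁴ |h|`, so
differentiability in `L²` follows once two factors `|y|²` can be afforded. -/
lemma hasDerivAt_chirpMul {h k m : L2} (hk : k =ᵐ[volume] fun y => ((‖y‖ ^ 2 : ℝ) : ℂ) * h y)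
    (hm : m =ᵐ[volume] fun y => ((‖y‖ ^ 2 : ℝ) : ℂ) * k y) (t : ℝ) :
    HasDerivAt (fun s => chirpMul s h) (Complex.I • chirpMul t k) t := by
  rw [hasDerivAt_iff_isLittleO_nhds_zero]
  have hO : (fun s : ℝ => chirpMul (t + s) h - chirpMul t h - s • Complex.I • chirpMul t k)
      =O[𝓝 0] fun s : ℝ => s ^ 2 := by
    refine Asymptotics.IsBigO.of_bound (3 * ‖m‖) (Eventually.of_forall fun s => ?_)
    rw [norm_pow, Real.norm_eq_abs, sq_abs, mul_right_comm]
    refine Lp.norm_le_mul_norm_of_ae_le_mul ?_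
    filter_upwards [Lp.coeFn_sub (chirpMul (t + s) h - chirpMul t h) (s • Complex.I • chirpMul t k),
      Lp.coeFn_sub (chirpMul (t + s) h) (chirpMul t h), Lp.coeFn_smul s (Complex.I • chirpMul t k),
      Lp.coeFn_smul Complex.I (chirpMul t k), chirpMul_ae (t + s) h, chirpMul_ae t h,
      chirpMul_ae t k, hk, hm] with y h1 h2 h3 h4 h5 h6 h7 h8 h9
    rw [h1, Pi.sub_apply, h2, Pi.sub_apply, h3, Pi.smul_apply, h4, Pi.smul_apply, h5, h6, h7, h9, h8,
      smul_eq_mul, Complex.real_smul]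
    have h10 : chirp (t + s) y = chirp t y * Complex.exp (Complex.I * ((s * ‖y‖ ^ 2 : ℝ) : ℂ)) := by
      unfold chirp
      rw [← Complex.exp_add]
      congr 1
      push_cast
      ring
    have h11 : chirp (t + s) y * h y - chirp t y * h y -
        (s : ℂ) * (Complex.I * (chirp t y * (((‖y‖ ^ 2 : ℝ) : ℂ) * h y))) =
        chirp t y * (Complex.exp (Complex.I * ((s * ‖y‖ ^ 2 : ℝ) : ℂ)) - 1 -
          Complex.I * ((s * ‖y‖ ^ 2 : ℝ) : ℂ)) * h y := by
      rw [h10]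
      push_cast
      ring
    rw [h11, norm_mul, norm_mul, norm_chirp, one_mul, norm_mul, norm_mul, Complex.norm_real,
      Real.norm_of_nonneg (by positivity)]
    calc _ ≤ 3 * (s * ‖y‖ ^ 2) ^ 2 * ‖h y‖ := by
          gcongr
          exact norm_exp_sub_one_sub_id_le _
      _ = _ := by ring
  refine hO.trans_isLittleO ?_
  simpa using Asymptotics.isLittleO_pow_pow (𝕜 := ℝ) (m := 1) (n := 2) (by norm_num)

/-- Multiplication of a Schwartz function by `|x|²`. -/
def mulSq (G : 𝓢(Plane, ℂ)) : 𝓢(Plane, ℂ) :=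
  SchwartzMap.smulLeftCLM ℂ (fun x : Plane => ((‖x‖ ^ 2 : ℝ) : ℂ)) G

lemma hasTemperateGrowth_sq :
    Function.HasTemperateGrowth fun x : Plane => ((‖x‖ ^ 2 : ℝ) : ℂ) := by
  have := Function.hasTemperateGrowth_norm_sq (H := Plane)
  fun_prop

lemma mulSq_apply (G : 𝓢(Plane, ℂ)) (x : Plane) : mulSq G x = ((‖x‖ ^ 2 : ℝ) : ℂ) * G x :=
  SchwartzMap.smulLeftCLM_apply_apply hasTemperateGrowth_sq G x

/-- The free evolution `e^{4π² i t |ξ|²} G` on the Fourier side. -/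
def evol (t : ℝ) (G : 𝓢(Plane, ℂ)) : 𝓢(Plane, ℂ) :=
  SchwartzMap.smulLeftCLM ℂ (chirp (4 * Real.pi ^ 2 * t)) G

lemma evol_apply (t : ℝ) (G : 𝓢(Plane, ℂ)) (x : Plane) :
    evol t G x = chirp (4 * Real.pi ^ 2 * t) x * G x :=
  SchwartzMap.smulLeftCLM_apply_apply (by fun_prop) G x

lemma evol_mulSq (t : ℝ) (G : 𝓢(Plane, ℂ)) : evol t (mulSq G) = mulSq (evol t G) := by
  ext x
  rw [evol_apply, mulSq_apply, mulSq_apply, evol_apply]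
  ring

lemma star_toLp_ae (G : 𝓢(Plane, ℂ)) :
    (star (G.toLp 2 : L2) : L2) =ᵐ[volume] fun x => conj (G x) := by
  filter_upwards [Lp.coeFn_star (G.toLp 2 : L2), G.coeFn_toLp 2 volume] with x h1 h2
  rw [h1, Pi.star_apply, h2]
  rfl

lemma conj_chirp (c : ℝ) (x : Plane) : conj (chirp c x) = chirp (-c) x := by
  unfold chirp
  rw [← Complex.exp_conj, map_mul, Complex.conj_I, Complex.conj_ofReal]
  congr 1
  push_cast
  ring

/-- Conjugating the test function writes the bilinear pairing as an inner product, to which the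
product rule in a Hilbert space applies. -/
lemma inner_chirpMul_star (t : ℝ) (G : 𝓢(Plane, ℂ)) (v : L2) :
    inner ℂ (chirpMul (-(4 * Real.pi ^ 2) * t) (star (G.toLp 2 : L2))) v =
      (v : 𝓢'(Plane, ℂ)) (evol t G) := by
  rw [L2.inner_def, coe_apply]
  refine integral_congr_ae ?_
  filter_upwards [chirpMul_ae (-(4 * Real.pi ^ 2) * t) (star (G.toLp 2 : L2)), star_toLp_ae G]
    with x h1 h2
  rw [h1, h2, RCLike.inner_apply, map_mul, conj_chirp, Complex.conj_conj, evol_apply, neg_mul,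
    neg_neg, mul_comm]

lemma fourier_laplacian_apply (T : 𝓢'(Plane, ℂ)) (G : 𝓢(Plane, ℂ)) :
    (𝓕 (Δ T)) G = -(4 * (Real.pi : ℂ) ^ 2) * (𝓕 T) (mulSq G) := by
  rw [TemperedDistribution.laplacian_eq_fourierMultiplierCLM,
    TemperedDistribution.fourierMultiplierCLM_apply]
  change (-(2 * Real.pi) ^ 2 : ℝ) • (𝓕 T) (mulSq (𝓕⁻ (𝓕 G))) = _
  rw [Complex.real_smul, FourierTransform.fourierInv_fourier_eq]
  push_cast
  ring

lemma fourier_coe_apply (u : L2) (G : 𝓢(Plane, ℂ)) :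
    ((𝓕 u : L2) : 𝓢'(Plane, ℂ)) G = (u : 𝓢'(Plane, ℂ)) (𝓕 G) := by
  rw [← Lp.fourier_toTemperedDistribution_eq]
  rfl

/-- The pairing of the profile with a test function evolves by the nonlinearity. -/
lemma hasDerivAt_pairing {φ : ℝ → L2} {d N : L2} {t : ℝ} (hd : HasDerivAt φ d t)
    (hlap : (laplacianL2 (φ t) : 𝓢'(Plane, ℂ)) = Δ (φ t : 𝓢'(Plane, ℂ)))
    (hN : d = Complex.I • laplacianL2 (φ t) + N) (G : 𝓢(Plane, ℂ)) :
    HasDerivAt (fun s => ((𝓕 (φ s) : L2) : 𝓢'(Plane, ℂ)) (evol s G))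
      ((N : 𝓢'(Plane, ℂ)) (𝓕 (evol t G))) t := by
  have hF : HasDerivAt (fun s => (𝓕 (φ s) : L2)) (𝓕 d) t :=
    (((FourierTransform.fourierCLE ℂ L2).toContinuousLinearMap.restrictScalars ℝ).hasFDerivAt
      (x := φ t)).comp_hasDerivAt t hd
  have hsq : ∀ G : 𝓢(Plane, ℂ), (star ((mulSq G).toLp 2 : L2) : L2) =ᵐ[volume]
      fun y => ((‖y‖ ^ 2 : ℝ) : ℂ) * (star (G.toLp 2 : L2) : L2) y := fun G => by
    filter_upwards [star_toLp_ae G, star_toLp_ae (mulSq G)] with y h1 h2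
    rw [h1, h2, mulSq_apply, map_mul, Complex.conj_ofReal]
  have hA := HasDerivAt.scomp (h := fun s : ℝ => -(4 * Real.pi ^ 2) * s) t
    (hasDerivAt_chirpMul (hsq G) (hsq (mulSq G)) (-(4 * Real.pi ^ 2) * t))
    ((hasDerivAt_id t).const_mul (-(4 * Real.pi ^ 2)))
  have h := hA.inner ℂ hF
  simp only [Function.comp_def, inner_chirpMul_star] at h
  have hr : ∀ (r : ℝ) (v : L2), r • v = (r : ℂ) • v := RCLike.real_smul_eq_coe_smul (K := ℂ)
  -- The contribution of the Laplacian cancels the derivative of the chirp: both are multiplication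
  -- by `4π²i|ξ|²`, with opposite signs.
  have e : (N : 𝓢'(Plane, ℂ)) (𝓕 (evol t G)) = ((𝓕 d : L2) : 𝓢'(Plane, ℂ)) (evol t G) +
      inner ℂ ((-(4 * Real.pi ^ 2) * 1) • Complex.I • chirpMul (-(4 * Real.pi ^ 2) * t)
        (star ((mulSq G).toLp 2 : L2))) (𝓕 (φ t) : L2) := by
    rw [mul_one, hr, smul_smul, inner_smul_left, inner_chirpMul_star, hN,
      FourierTransform.fourier_add, FourierTransform.fourier_smul, coe_add, coe_smul,
      distrib_add_apply, distrib_smul_apply, evol_mulSq,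
      ← Lp.fourier_toTemperedDistribution_eq (laplacianL2 (φ t)), hlap, fourier_laplacian_apply,
      Lp.fourier_toTemperedDistribution_eq, fourier_coe_apply N, map_mul, Complex.conj_I,
      Complex.conj_ofReal]
    push_cast
    ring
  rw [e]
  exact h

/-- Duality between `L¹` and `L^∞`, with Schwartz test functions. -/
lemma ae_enorm_le_of_forall_schwartz {F : Plane → ℂ} (hF : LocallyIntegrable F) {A : ℝ≥0∞}
    (h : ∀ G : 𝓢(Plane, ℂ), ‖∫ x, G x * F x‖ₑ ≤ A * ∫⁻ x, ‖G x‖ₑ) : ∀ᵐ x, ‖F x‖ₑ ≤ A := by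
  set φ : ℕ → ContDiffBump (0 : Plane) := fun n =>
    ⟨(1 / 2 : ℝ) ^ n, 2 * (1 / 2 : ℝ) ^ n, by positivity, by
      have : 0 < (1 / 2 : ℝ) ^ n := by positivity
      linarith⟩ with hφ
  have hlim : Tendsto (fun n => (φ n).rOut) atTop (𝓝 0) := by
    have := (tendsto_pow_atTop_nhds_zero_of_lt_one (r := (1 / 2 : ℝ)) (by norm_num)
      (by norm_num)).const_mul 2
    simpa [hφ] using this
  -- Mollification converges at almost every point, and each mollified value is a pairing with a
  -- bump of unit `L¹` norm, hence bounded by `A`.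
  have hae := ContDiffBump.ae_convolution_tendsto_right_of_locallyIntegrable (μ := volume) (K := 2)
    hlim (Eventually.of_forall fun n => le_rfl) hF
  filter_upwards [hae] with x hx
  refine le_of_tendsto hx.enorm (Eventually.of_forall fun n => ?_)
  have hsm : ContDiff ℝ (⊤ : ℕ∞) fun y : Plane => (((φ n).normed volume (x - y) : ℝ) : ℂ) :=
    Complex.ofRealCLM.contDiff.comp ((φ n).contDiff_normed.comp (contDiff_const.sub contDiff_id))
  have hcs : HasCompactSupport fun y : Plane => (((φ n).normed volume (x - y) : ℝ) : ℂ) := by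
    have h1 : HasCompactSupport fun y : Plane => (φ n).normed volume (x - y) :=
      (φ n).hasCompactSupport_normed.comp_homeomorph (Homeomorph.subLeft x)
    exact h1.comp_left (g := fun r : ℝ => (r : ℂ)) Complex.ofReal_zero
  have hG := h (hcs.toSchwartzMap hsm)
  rw [convolution_eq_swap]
  have h1 : ∀ y, (hcs.toSchwartzMap hsm) y = (((φ n).normed volume (x - y) : ℝ) : ℂ) :=
    fun y => rfl
  simp_rw [h1, enorm_ofReal_eq] at hG
  have h2 : ∫⁻ y, ‖(φ n).normed volume (x - y)‖ₑ = 1 := by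
    rw [lintegral_sub_left_eq_self (fun y => ‖(φ n).normed volume y‖ₑ) x]
    simp_rw [Real.enorm_of_nonneg ((φ n).nonneg_normed _)]
    rw [← ofReal_integral_eq_lintegral_ofReal (φ n).integrable_normed
      (Eventually.of_forall fun y => (φ n).nonneg_normed y), (φ n).integral_normed,
      ENNReal.ofReal_one]
  rw [h2, mul_one] at hG
  simpa only [ContinuousLinearMap.lsmul_apply, Complex.real_smul] using hG


/-! ### The variation of the profile -/

/-- The profile `e^{4 π² i t |ξ|²} 𝓕 u`, with the normalization of Mathlib. -/
def prof (t : ℝ) (u : L2) (ξ : Plane) : ℂ := chirp (4 * Real.pi ^ 2 * t) ξ * (𝓕 u : L2) ξ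

lemma measurable_prof (t : ℝ) (u : L2) : Measurable (prof t u) :=
  (continuous_chirp _).measurable.mul (measurable_L2 _)

lemma enorm_prof (t : ℝ) (u : L2) (ξ : Plane) : ‖prof t u ξ‖ₑ = ‖(𝓕 u : L2) ξ‖ₑ := by
  rw [prof, enorm_mul, ← ofReal_norm, norm_chirp, ENNReal.ofReal_one, one_mul]

lemma prof_ae (t : ℝ) (u : L2) : (𝓕 (freeInvL2 t u) : L2) =ᵐ[volume] prof t u := by
  rw [fourier_freeInvL2]
  exact chirpMul_ae _ _

lemma locallyIntegrable_prof (t : ℝ) (u : L2) : LocallyIntegrable (prof t u) :=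
  ((memLp_chirp_mul (4 * Real.pi ^ 2 * t) (𝓕 u)).locallyIntegrable one_le_two)

lemma l2Norm_deriv_lt_top {T : 𝓢'(Plane, ℂ)} (h : h2Norm T < ∞) (k : Fin 2) :
    l2Norm (∂_{e k} T) < ∞ :=
  (le_vecNorm (fun k : Fin 2 => l2Norm (∂_{e k} T)) k).trans_lt
    ((le_add_self.trans le_self_add).trans_lt h)

lemma l2Norm_deriv_deriv_le (T : 𝓢'(Plane, ℂ)) (k l : Fin 2) :
    l2Norm (∂_{e k} (∂_{e l} T)) ≤ h2Norm T :=
  (le_vecNorm (fun p : Fin 2 × Fin 2 => l2Norm (∂_{e p.1} (∂_{e p.2} T))) (k, l)).trans le_add_self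

lemma laplacian_eq_add (T : 𝓢'(Plane, ℂ)) :
    Δ T = ∂_{e 0} (∂_{e 0} T) + ∂_{e 1} (∂_{e 1} T) := by
  have he : ∀ k, EuclideanSpace.basisFun (Fin 2) ℝ k = e k := fun k => by
    rw [EuclideanSpace.basisFun_apply]
    rfl
  rw [TemperedDistribution.laplacian_eq_sum (EuclideanSpace.basisFun (Fin 2) ℝ), Fin.sum_univ_two,
    he, he]

lemma l2Norm_laplacian_le (T : 𝓢'(Plane, ℂ)) : l2Norm (Δ T) ≤ 2 * h2Norm T := by
  rw [laplacian_eq_add, two_mul]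
  exact (l2Norm_add_le _ _).trans
    (add_le_add (l2Norm_deriv_deriv_le T 0 0) (l2Norm_deriv_deriv_le T 1 1))

lemma coe_laplacianL2 {u : L2} (h : h2Norm (u : 𝓢'(Plane, ℂ)) < ∞) :
    (laplacianL2 u : 𝓢'(Plane, ℂ)) = Δ (u : 𝓢'(Plane, ℂ)) := by
  obtain ⟨v, hv⟩ := exists_L2_of_l2Norm_lt_top
    ((l2Norm_laplacian_le (u : 𝓢'(Plane, ℂ))).trans_lt (ENNReal.mul_lt_top (by norm_num) h))
  rw [laplacianL2, ← hv, l2Rep_coe]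

/-- The exponent `1/40` is chosen so that the fifth power costs only `1/8` of the decay `3/2`. The
constant is `25600 = 160²`, from `log x ≤ 80 x^{1/80}`. -/
lemma log_sq_le {s : ℝ} (hs : 0 ≤ s) : Real.log (2 + s) ^ 2 ≤ 25600 * (1 + s) ^ (1 / 40 : ℝ) := by
  have h0 : 0 ≤ Real.log (2 + s) := Real.log_nonneg (by linarith)
  have h1 : Real.log (2 + s) ≤ 160 * (1 + s) ^ (1 / 80 : ℝ) := by
    have h2 := Real.log_le_rpow_div (x := 2 + s) (by linarith) (ε := 1 / 80) (by norm_num)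
    have h3 : (2 + s) ^ (1 / 80 : ℝ) ≤ 2 * (1 + s) ^ (1 / 80 : ℝ) := by
      calc (2 + s) ^ (1 / 80 : ℝ) ≤ (2 * (1 + s)) ^ (1 / 80 : ℝ) :=
            Real.rpow_le_rpow (by linarith) (by linarith) (by norm_num)
        _ = 2 ^ (1 / 80 : ℝ) * (1 + s) ^ (1 / 80 : ℝ) :=
            Real.mul_rpow (by norm_num) (by linarith)
        _ ≤ 2 ^ (1 : ℝ) * (1 + s) ^ (1 / 80 : ℝ) := by
            gcongr
            · norm_num
            · norm_num
        _ = _ := by rw [Real.rpow_one]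
    calc _ ≤ _ := h2
      _ ≤ 2 * (1 + s) ^ (1 / 80 : ℝ) / (1 / 80) := by gcongr
      _ = _ := by ring
  calc Real.log (2 + s) ^ 2 ≤ (160 * (1 + s) ^ (1 / 80 : ℝ)) ^ 2 := by gcongr
    _ = 25600 * ((1 + s) ^ (1 / 80 : ℝ) * (1 + s) ^ (1 / 80 : ℝ)) := by ring
    _ = _ := by
      rw [← Real.rpow_add (by linarith)]
      norm_num

/-- Shifting the time by `σ`, away from the origin, keeps the pseudoconformal parameter of size at
least one. -/
lemma abs_add_sign {t σ : ℝ} (hσ : σ = 1 ∨ σ = -1) (ht : 0 ≤ σ * t) : |t + σ| = 1 + |t| := by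
  rcases hσ with rfl | rfl
  · rw [abs_of_nonneg (by linarith), abs_of_nonneg (by linarith)]
    ring
  · rw [abs_of_nonpos (by linarith), abs_of_nonpos (by linarith)]
    ring

lemma mul_sign_eq_abs {t σ : ℝ} (hσ : σ = 1 ∨ σ = -1) (ht : 0 ≤ σ * t) : σ * t = |t| := by
  rcases hσ with rfl | rfl
  · rw [abs_of_nonneg (by linarith)]
    ring
  · rw [abs_of_nonpos (by linarith)]
    ring

section Solution

variable {g : ℂ} {B ε σ : ℝ} {I : Set ℝ} {φ : ℝ → L2}

lemma Assumptions.wNorm_le (h : Assumptions g B ε I σ φ) (hB : 0 < B) (hε : 0 < ε)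
    (hσ : σ = 1 ∨ σ = -1) {t : ℝ} (ht : t ∈ I) (ht0 : 0 ≤ σ * t) :
    wNorm (freeInvL2 (t + σ) (φ t)) ≤ ENNReal.ofReal (B * ε * (25600 * (1 + |t|) ^ (1 / 40 : ℝ))) := by
  have hτ : t + σ ≠ 0 := fun h0 => by
    have := abs_add_sign hσ ht0
    rw [h0, abs_zero] at this
    linarith [abs_nonneg t]
  refine ((h.gauge t ht ht0).wNorm_le (by positivity) hσ hτ).trans (ENNReal.ofReal_le_ofReal ?_)
  calc 100 * (B / 100 * ε) * Real.log (2 + |t|) ^ 2 = B * ε * Real.log (2 + |t|) ^ 2 := by ring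
    _ ≤ _ := by
      gcongr
      exact log_sq_le (abs_nonneg t)

/-- `-1 - 1/2 + 5/40 = -11/8 ≤ -5/4`. -/
lemma rpow_pieces {s : ℝ} (hs : 0 ≤ s) :
    (1 + s)⁻¹ * (Real.sqrt (1 + s))⁻¹ * ((1 + s) ^ (1 / 40 : ℝ)) ^ 5 ≤ (1 + s) ^ (-(5 / 4) : ℝ) := by
  have h : 0 < 1 + s := by linarith
  rw [Real.sqrt_eq_rpow, ← Real.rpow_natCast, ← Real.rpow_mul h.le, ← Real.rpow_neg h.le,
    ← Real.rpow_neg_one, ← Real.rpow_add h, ← Real.rpow_add h]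
  exact Real.rpow_le_rpow_of_exponent_le (by linarith) (by norm_num)

/-- The constant in the bound of the time derivative of the profile. -/
def timeConst (g : ℂ) : ℝ := 25600 ^ 5 * (nlConst g).toReal

lemma timeConst_nonneg (g : ℂ) : 0 ≤ timeConst g := by
  unfold timeConst
  positivity

lemma Assumptions.exists_deriv (h : Assumptions g B ε I σ φ) (hB : 0 < B) (hε : 0 < ε)
    (hσ : σ = 1 ∨ σ = -1) {t : ℝ} (ht : t ∈ I) (ht0 : 0 ≤ σ * t) (G : 𝓢(Plane, ℂ)) :
    ∃ d : ℂ, HasDerivAt (fun s => ((𝓕 (φ s) : L2) : 𝓢'(Plane, ℂ)) (evol s G)) d t ∧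
      ‖d‖ ≤ timeConst g * ((B * ε) ^ 3 + (B * ε) ^ 5) * (∫⁻ x, ‖G x‖ₑ).toReal *
        (1 + |t|) ^ (-(5 / 4) : ℝ) := by
  obtain ⟨d, hd, hdN⟩ := h.solution.equation t ht
  have h2 := h.solution.memH2 t ht
  set N : L2 := d - Complex.I • laplacianL2 (φ t) with hN
  have hNae : N =ᵐ[volume] nonlinearity g (φ t) := by
    filter_upwards [hdN, Lp.coeFn_sub d (Complex.I • laplacianL2 (φ t)),
      Lp.coeFn_smul Complex.I (laplacianL2 (φ t))] with x h3 h4 h5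
    rw [h4, Pi.sub_apply, h5, Pi.smul_apply, h3, smul_eq_mul, add_sub_cancel_left]
  refine ⟨_, hasDerivAt_pairing (N := N) hd (coe_laplacianL2 h2) (by rw [hN, add_sub_cancel]) G, ?_⟩
  have hb : ∀ᵐ x, ‖φ t x‖ₑ ≤ eLpNorm (φ t) ∞ volume := by
    rw [eLpNorm_exponent_top]
    exact enorm_ae_le_eLpNormEssSup _ _
  have hb' : eLpNorm (φ t) ∞ volume < ∞ := (h.decay t ht ht0).trans_lt ENNReal.ofReal_lt_top
  have hM : 0 < B * ε := mul_pos hB hε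
  have hs : 0 ≤ |t| := abs_nonneg t
  set y := (1 + |t|) ^ (1 / 40 : ℝ) with hy
  have hy1 : 1 ≤ y := Real.one_le_rpow (by linarith) (by norm_num)
  have hτ := abs_add_sign hσ ht0
  have hK0 : ENNReal.ofReal (B * ε * (25600 * y)) ≠ 0 := by
    rw [Ne, ENNReal.ofReal_eq_zero, not_le]
    positivity
  -- The profile is taken at time `t`, but the estimate is applied at parameter `t + σ`. This is
  -- harmless: the test function enters only through its modulus, which the evolution does not
  -- change.
  have key := enorm_integral_nonlinearity_le g (τ := t + σ) (by rw [hτ]; linarith) hb hb'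
    (l2Norm_deriv_lt_top h2) hK0 ENNReal.ofReal_lt_top (h.wNorm_le hB hε hσ ht ht0) (evol t G)
  have hG : ∀ ξ, ‖evol t G ξ‖ₑ = ‖G ξ‖ₑ := fun ξ => by
    rw [evol_apply, enorm_mul, ← ofReal_norm, norm_chirp, ENNReal.ofReal_one, one_mul]
  simp_rw [hG] at key
  have hint : (N : 𝓢'(Plane, ℂ)) (𝓕 (evol t G)) =
      ∫ x, nonlinearity g (φ t) x * 𝓕 (evol t G) x := by
    rw [coe_apply]
    refine integral_congr_ae ?_
    filter_upwards [hNae] with x hx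
    rw [hx, mul_comm]
  rw [← hint, hτ, ← ENNReal.ofReal_pow (by positivity), ← ENNReal.ofReal_pow (by positivity),
    ← ENNReal.ofReal_add (by positivity) (by positivity)] at key
  have hGi : ∫⁻ x, ‖G x‖ₑ ≠ ∞ := G.integrable.2.ne
  have hnl := (nlConst_lt_top g).ne
  have key2 := ENNReal.toReal_mono (by finiteness) key
  rw [toReal_enorm, ENNReal.toReal_mul, ENNReal.toReal_mul, ENNReal.toReal_mul,
    ENNReal.toReal_ofReal (by positivity), ENNReal.toReal_ofReal (by positivity)] at key2
  refine key2.trans ?_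
  have hy3 : y ^ 3 ≤ y ^ 5 := pow_le_pow_right₀ hy1 (by norm_num)
  have hpoly : (B * ε * (25600 * y)) ^ 3 + (B * ε * (25600 * y)) ^ 5 ≤
      25600 ^ 5 * ((B * ε) ^ 3 + (B * ε) ^ 5) * y ^ 5 := by
    have h3 : (B * ε) ^ 3 * y ^ 3 ≤ (B * ε) ^ 3 * y ^ 5 := by gcongr
    have h4 : 0 ≤ (B * ε) ^ 3 * y ^ 3 := by positivity
    nlinarith
  calc (nlConst g).toReal * ((1 + |t|)⁻¹ * (Real.sqrt (1 + |t|))⁻¹) *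
        ((B * ε * (25600 * y)) ^ 3 + (B * ε * (25600 * y)) ^ 5) * (∫⁻ x, ‖G x‖ₑ).toReal
      ≤ (nlConst g).toReal * ((1 + |t|)⁻¹ * (Real.sqrt (1 + |t|))⁻¹) *
        (25600 ^ 5 * ((B * ε) ^ 3 + (B * ε) ^ 5) * y ^ 5) * (∫⁻ x, ‖G x‖ₑ).toReal := by gcongr
    _ = timeConst g * ((B * ε) ^ 3 + (B * ε) ^ 5) * (∫⁻ x, ‖G x‖ₑ).toReal *
        ((1 + |t|)⁻¹ * (Real.sqrt (1 + |t|))⁻¹ * y ^ 5) := by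
      unfold timeConst
      ring
    _ ≤ _ := by
      have := timeConst_nonneg g
      gcongr
      exact rpow_pieces hs

lemma pairing_eq_integral_prof (t : ℝ) (u : L2) (G : 𝓢(Plane, ℂ)) :
    ((𝓕 u : L2) : 𝓢'(Plane, ℂ)) (evol t G) = ∫ x, G x * prof t u x := by
  rw [coe_apply]
  refine integral_congr_ae (Eventually.of_forall fun x => ?_)
  simp only [evol_apply, prof]
  ring

lemma Assumptions.norm_pairing_sub_le (h : Assumptions g B ε I σ φ) (hB : 0 < B) (hε : 0 < ε)
    (hσ : σ = 1 ∨ σ = -1) {t₁ t₂ : ℝ} (ht₁ : t₁ ∈ I) (ht₂ : t₂ ∈ I) (h0 : 0 ≤ σ * t₁)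
    (h12 : σ * t₁ ≤ σ * t₂) (G : 𝓢(Plane, ℂ)) :
    ‖((𝓕 (φ t₂) : L2) : 𝓢'(Plane, ℂ)) (evol t₂ G) -
        ((𝓕 (φ t₁) : L2) : 𝓢'(Plane, ℂ)) (evol t₁ G)‖ ≤
      4 * (timeConst g * ((B * ε) ^ 3 + (B * ε) ^ 5) * (∫⁻ x, ‖G x‖ₑ).toReal) *
        (1 + |t₁|) ^ (-(1 / 4) : ℝ) := by
  have hσσ : ∀ t, σ * (σ * t) = t := fun t => by rcases hσ with rfl | rfl <;> ring
  have hmem : ∀ s ∈ Set.Icc (σ * t₁) (σ * t₂), σ * s ∈ I := fun s hs => by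
    refine h.solution.ordConnected.uIcc_subset ht₁ ht₂ ?_
    rw [Set.mem_uIcc]
    rcases hσ with rfl | rfl
    · left
      simpa using hs
    · right
      obtain ⟨h3, h4⟩ := hs
      constructor <;> linarith
  set p := fun s => ((𝓕 (φ s) : L2) : 𝓢'(Plane, ℂ)) (evol s G) with hp
  set A := timeConst g * ((B * ε) ^ 3 + (B * ε) ^ 5) * (∫⁻ x, ‖G x‖ₑ).toReal with hA
  have hA0 : 0 ≤ A := by
    have := timeConst_nonneg g
    positivity
  have hder : ∀ s : ℝ, ∃ d : ℂ, s ∈ Set.Icc (σ * t₁) (σ * t₂) →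
      HasDerivAt (fun s => p (σ * s) - p t₁) d s ∧ ‖d‖ ≤ A * (1 + s) ^ (-(5 / 4) : ℝ) := by
    intro s
    by_cases hs : s ∈ Set.Icc (σ * t₁) (σ * t₂)
    · have hs0 : 0 ≤ s := h0.trans hs.1
      obtain ⟨d, hd, hdb⟩ := h.exists_deriv hB hε hσ (hmem s hs) (by rwa [hσσ]) G
      have habs : |σ * s| = s := by
        rcases hσ with rfl | rfl
        · rw [one_mul, abs_of_nonneg hs0]
        · rw [neg_one_mul, abs_neg, abs_of_nonneg hs0]
      have hσ1 : |σ| = 1 := by rcases hσ with rfl | rfl <;> simp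
      refine ⟨σ • d, fun _ => ⟨?_, ?_⟩⟩
      · have h1 := HasDerivAt.scomp (h := fun s : ℝ => σ * s) s hd
          ((hasDerivAt_id s).const_mul σ)
        rw [mul_one] at h1
        exact h1.sub_const _
      · rw [norm_smul, Real.norm_eq_abs, hσ1, one_mul]
        rwa [habs] at hdb
    · exact ⟨0, fun h => absurd h hs⟩
  choose d hd using hder
  -- The majorant is the primitive of `A (1+s)^{-5/4}` that vanishes at the initial time, which
  -- explains the `4` and the exponent `-1/4`. The substitution `t = σ s` treats both time
  -- directions at once.
  have hbd : ∀ s ∈ Set.Icc (σ * t₁) (σ * t₂), HasDerivAt (fun s : ℝ =>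
      4 * A * ((1 + σ * t₁) ^ (-(1 / 4) : ℝ) - (1 + s) ^ (-(1 / 4) : ℝ)))
      (A * (1 + s) ^ (-(5 / 4) : ℝ)) s := by
    intro s hs
    have hs0 : 0 < 1 + s := by linarith [hs.1]
    have h1 := (((((hasDerivAt_id s).const_add 1).rpow_const (p := (-(1 / 4) : ℝ))
      (Or.inl hs0.ne')).const_sub ((1 + σ * t₁) ^ (-(1 / 4) : ℝ))).const_mul (4 * A))
    refine h1.congr_deriv ?_
    rw [show (-(1 / 4) - 1 : ℝ) = -(5 / 4) by norm_num]
    simp only [id]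
    ring
  have hfin := image_norm_le_of_norm_deriv_right_le_deriv_boundary'
    (f := fun s => p (σ * s) - p t₁) (f' := d) (a := σ * t₁) (b := σ * t₂)
    (fun s hs => (hd s hs).1.continuousAt.continuousWithinAt)
    (fun s hs => (hd s (Set.Ico_subset_Icc_self hs)).1.hasDerivWithinAt)
    (by simp [hσσ])
    (fun s hs => (hbd s hs).continuousAt.continuousWithinAt)
    (fun s hs => (hbd s (Set.Ico_subset_Icc_self hs)).hasDerivWithinAt)
    (fun s hs => (hd s (Set.Ico_subset_Icc_self hs)).2)
    (Set.right_mem_Icc.mpr h12)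
  simp only [hσσ] at hfin
  refine hfin.trans ?_
  rw [mul_sign_eq_abs hσ h0]
  have : 0 ≤ (1 + σ * t₂) ^ (-(1 / 4) : ℝ) := Real.rpow_nonneg (by linarith) _
  gcongr
  linarith

/-- The variation of the profile. -/
lemma Assumptions.ae_prof_sub_le (h : Assumptions g B ε I σ φ) (hB : 0 < B) (hε : 0 < ε)
    (hσ : σ = 1 ∨ σ = -1) {t₁ t₂ : ℝ} (ht₁ : t₁ ∈ I) (ht₂ : t₂ ∈ I) (h0 : 0 ≤ σ * t₁)
    (h12 : σ * t₁ ≤ σ * t₂) :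
    ∀ᵐ ξ, ‖prof t₂ (φ t₂) ξ - prof t₁ (φ t₁) ξ‖ₑ ≤ ENNReal.ofReal
      (4 * (timeConst g * ((B * ε) ^ 3 + (B * ε) ^ 5)) * (1 + |t₁|) ^ (-(1 / 4) : ℝ)) := by
  refine ae_enorm_le_of_forall_schwartz
    ((locallyIntegrable_prof _ _).sub (locallyIntegrable_prof _ _)) fun G => ?_
  have hi : ∀ t u, Integrable fun x => G x * prof t u x := fun t u =>
    (MemLp.integrable_mul (p := 2) (q := 2) (G.memLp 2 volume)
      (memLp_chirp_mul (4 * Real.pi ^ 2 * t) (𝓕 u)))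
  have hk := h.norm_pairing_sub_le hB hε hσ ht₁ ht₂ h0 h12 G
  have hGi : ∫⁻ x, ‖G x‖ₑ ≠ ∞ := G.integrable.2.ne
  have := timeConst_nonneg g
  have hr : 0 ≤ (1 + |t₁|) ^ (-(1 / 4) : ℝ) := by positivity
  simp_rw [Pi.sub_apply, mul_sub]
  rw [integral_sub (hi _ _) (hi _ _), ← pairing_eq_integral_prof, ← pairing_eq_integral_prof,
    ← ofReal_norm, ← ENNReal.ofReal_toReal hGi, ← ENNReal.ofReal_mul (by positivity)]
  refine ENNReal.ofReal_le_ofReal (hk.trans (le_of_eq ?_))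
  ring

end Solution


/-! ### Pointwise bounds -/

/-- Riemann–Lebesgue bound for square-integrable functions. -/
lemma ae_enorm_fourier_le (w : L2) : ∀ᵐ ξ, ‖(𝓕 w : L2) ξ‖ₑ ≤ ∫⁻ y, ‖w y‖ₑ := by
  refine ae_enorm_le_of_forall_schwartz (locallyIntegrable_L2 _) fun G => ?_
  rw [← coe_apply, fourier_coe_apply, coe_apply, mul_comm,
    ← lintegral_const_mul _ (measurable_enorm_L2 w)]
  refine (enorm_integral_le_lintegral_enorm _).trans (lintegral_mono fun x => ?_)
  rw [enorm_mul]
  gcongr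
  exact enorm_fourier_le G x

/-- The dual Riemann–Lebesgue bound. -/
lemma ae_enorm_le_lintegral_fourier (u : L2) : ∀ᵐ x, ‖u x‖ₑ ≤ ∫⁻ ξ, ‖(𝓕 u : L2) ξ‖ₑ := by
  refine ae_enorm_le_of_forall_schwartz (locallyIntegrable_L2 _) fun G => ?_
  rw [← coe_apply]
  have h : (u : 𝓢'(Plane, ℂ)) G = ((𝓕 u : L2) : 𝓢'(Plane, ℂ)) (𝓕⁻ G) := by
    rw [fourier_coe_apply, FourierTransform.fourier_fourierInv_eq]
  rw [h, coe_apply, mul_comm, ← lintegral_const_mul _ (measurable_enorm_L2 _)]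
  refine (enorm_integral_le_lintegral_enorm _).trans (lintegral_mono fun x => ?_)
  rw [enorm_mul]
  gcongr
  have h2 : (𝓕⁻ G : 𝓢(Plane, ℂ)) x = 𝓕 G (-x) := by
    rw [SchwartzMap.fourierInv_coe, SchwartzMap.fourier_coe, Real.fourierInv_eq_fourier_neg]
  rw [h2]
  exact enorm_fourier_le G (-x)

/-- The constant in the tail bound. -/
def tailConst : ℝ≥0∞ := N2 fun z => farK z ^ (2 : ℝ)

lemma tailConst_lt_top : tailConst < ∞ := N2_farK_sq_lt_top

lemma N2_comp_smul (f : Plane → ℝ≥0∞) {r : ℝ} (hr : 0 < r) :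
    N2 (fun x => f (r⁻¹ • x)) = ENNReal.ofReal r * N2 f := by
  unfold N2
  rw [lintegral_comp_smul_plane (fun x => f x ^ (2 : ℝ)) (inv_ne_zero hr.ne'),
    ENNReal.mul_rpow_of_nonneg _ _ (by norm_num), inv_pow, inv_inv,
    ENNReal.ofReal_rpow_of_nonneg (by positivity) (by norm_num), ← Real.rpow_natCast,
    ← Real.rpow_mul hr.le]
  norm_num

/-- The tail of an integrable function with a quadratic weight in `L²`. -/
lemma setLIntegral_compl_ball_le {h : Plane → ℝ≥0∞} (hh : Measurable h) {R : ℝ} (hR : 0 < R) :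
    ∫⁻ x in (Metric.ball 0 R)ᶜ, h x ≤
      ENNReal.ofReal R⁻¹ * tailConst * N2 fun x => ‖x‖ₑ ^ 2 * h x := by
  have hf := measurable_farK
  rw [← lintegral_indicator measurableSet_ball.compl]
  have hpt : ∀ x : Plane, (Metric.ball (0 : Plane) R)ᶜ.indicator h x ≤
      (ENNReal.ofReal (R ^ 2)⁻¹ * farK (R⁻¹ • x) ^ (2 : ℝ)) * (‖x‖ₑ ^ 2 * h x) := by
    intro x
    by_cases hx : x ∈ Metric.ball (0 : Plane) R
    · rw [Set.indicator_of_notMem (by simpa using hx)]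
      exact zero_le
    · have hx' : R ≤ ‖x‖ := by simpa using hx
      have h1 : R⁻¹ • x ∈ (Metric.ball (0 : Plane) 1)ᶜ := by
        simp only [Set.mem_compl_iff, mem_ball_zero_iff, not_lt, norm_smul, norm_inv,
          Real.norm_eq_abs, abs_of_pos hR]
        rwa [inv_mul_eq_div, le_div_iff₀ hR, one_mul]
      have hx0 : 0 < ‖x‖ := hR.trans_le hx'
      rw [Set.indicator_of_mem (by simpa using hx), farK, Set.indicator_of_mem h1, ← mul_assoc]
      refine le_mul_of_one_le_left zero_le (le_of_eq ?_)
      have h2 : ‖R⁻¹ • x‖ₑ⁻¹ = ENNReal.ofReal (R * ‖x‖⁻¹) := by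
        rw [← ofReal_norm, norm_smul, norm_inv, Real.norm_eq_abs, abs_of_pos hR,
          ← ENNReal.ofReal_inv_of_pos (by positivity), mul_inv, inv_inv]
      rw [h2, ENNReal.ofReal_rpow_of_nonneg (by positivity) zero_le_two, ← ofReal_norm,
        ← ENNReal.ofReal_pow (norm_nonneg _), ← ENNReal.ofReal_mul (by positivity),
        ← ENNReal.ofReal_mul (by positivity), Real.rpow_two, eq_comm, ENNReal.ofReal_eq_one]
      field_simp
  refine (lintegral_mono hpt).trans ((lintegral_mul_le_N2 (by fun_prop) (by fun_prop)).trans ?_)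
  gcongr
  rw [N2_const_mul _ (by fun_prop), N2_comp_smul (fun x => farK x ^ (2 : ℝ)) hR, ← mul_assoc,
    ← ENNReal.ofReal_mul (by positivity), tailConst]
  gcongr
  refine le_of_eq ?_
  field_simp

lemma lintegral_le_ball_add_tail {h : Plane → ℝ≥0∞} (hh : Measurable h) {R : ℝ} (hR : 0 < R) :
    ∫⁻ x, h x ≤ (∫⁻ x in Metric.ball 0 R, h x) +
      ENNReal.ofReal R⁻¹ * tailConst * N2 fun x => ‖x‖ₑ ^ 2 * h x := by
  rw [← lintegral_add_compl h (measurableSet_ball (x := (0 : Plane)) (ε := R))]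
  gcongr
  exact setLIntegral_compl_ball_le hh hR

/-- `|ξ|² 𝓕 u` is `-(4π²)⁻¹` times the Fourier transform of the Laplacian, to which Plancherel
applies. -/
lemma N2_sq_mul_fourier_le {u : L2} (h : h2Norm (u : 𝓢'(Plane, ℂ)) < ∞) :
    N2 (fun ξ => ‖ξ‖ₑ ^ 2 * ‖(𝓕 u : L2) ξ‖ₑ) ≤ 2 * h2Norm (u : 𝓢'(Plane, ℂ)) := by
  have hlap := coe_laplacianL2 h
  have hπ : (4 * (Real.pi : ℂ) ^ 2) ≠ 0 := by simp [Real.pi_ne_zero]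
  set c : ℂ := -(4 * (Real.pi : ℂ) ^ 2)⁻¹ with hc
  have hs : TemperedDistribution.smulLeftCLM ℂ (fun x : Plane => ((‖x‖ ^ 2 : ℝ) : ℂ))
      ((𝓕 u : L2) : 𝓢'(Plane, ℂ)) = ((c • 𝓕 (laplacianL2 u) : L2) : 𝓢'(Plane, ℂ)) := by
    ext G
    rw [coe_smul, distrib_smul_apply, ← Lp.fourier_toTemperedDistribution_eq (laplacianL2 u), hlap,
      fourier_laplacian_apply, Lp.fourier_toTemperedDistribution_eq, hc]
    change ((𝓕 u : L2) : 𝓢'(Plane, ℂ)) (mulSq G) = _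
    field_simp
  have hae := ae_eq_of_smulLeft_eq hasTemperateGrowth_sq hs
  have h1 : N2 (fun ξ => ‖ξ‖ₑ ^ 2 * ‖(𝓕 u : L2) ξ‖ₑ) = ‖c • (𝓕 (laplacianL2 u) : L2)‖ₑ := by
    rw [enorm_L2_eq_N2]
    refine N2_congr_ae ?_
    filter_upwards [hae] with ξ hξ
    rw [hξ, enorm_mul, enorm_ofReal_eq, Real.enorm_of_nonneg (by positivity),
      ENNReal.ofReal_pow (norm_nonneg _), ofReal_norm]
  have hc1 : ‖c‖ₑ ≤ 1 := by
    rw [hc, enorm_neg, ← ofReal_norm]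
    refine ENNReal.ofReal_le_one.mpr ?_
    rw [norm_inv, norm_mul, norm_pow, Complex.norm_real, Real.norm_of_nonneg Real.pi_pos.le]
    refine inv_le_one_of_one_le₀ ?_
    norm_num
    nlinarith [Real.pi_gt_three]
  rw [h1, enorm_smul, enorm_fourier_L2, ← l2Norm_coe, hlap]
  exact (mul_le_of_le_one_left' hc1).trans (l2Norm_laplacian_le _)

/-- The constant relating the `L¹` norm and the weighted norm. -/
def oneConst : ℝ := (2 * qConst).toReal

lemma oneConst_nonneg : 0 ≤ oneConst := ENNReal.toReal_nonneg

lemma ofReal_oneConst : ENNReal.ofReal oneConst = 2 * qConst :=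
  ENNReal.ofReal_toReal (ENNReal.mul_lt_top (by norm_num) qConst_lt_top).ne

lemma lintegral_le_of_wNorm_le {w : L2} {K : ℝ} (h : wNorm w ≤ ENNReal.ofReal K) :
    ∫⁻ y, ‖w y‖ₑ ≤ ENNReal.ofReal (oneConst * K) := by
  rw [ENNReal.ofReal_mul oneConst_nonneg, ofReal_oneConst]
  exact (lintegral_enorm_le_wNorm (measurable_L2 w)).trans (by gcongr)

lemma wNorm_le_of_initialBound {ε : ℝ} {u : L2} (h : InitialBound ε u) :
    wNorm u ≤ ENNReal.ofReal ε := by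
  refine le_trans ?_ h
  have h1 : eLpNorm (fun x : Plane => (‖x‖ ^ 2 : ℂ) * u x) 2 volume =
      N2 fun y => ‖y‖ₑ ^ 2 * ‖u y‖ₑ := by
    rw [← N2_enorm]
    congr 1
    ext y
    rw [enorm_mul, ← Complex.ofReal_pow, enorm_ofReal_eq, Real.enorm_of_nonneg (by positivity),
      ENNReal.ofReal_pow (norm_nonneg _), ofReal_norm]
  rw [h1, l2Norm_coe, enorm_L2_eq_N2, wNorm]
  gcongr
  simp only [add_assoc]
  exact le_self_add

section Solution

variable {g : ℂ} {B ε σ : ℝ} {I : Set ℝ} {φ : ℝ → L2}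

lemma Assumptions.ae_fourier_le (h : Assumptions g B ε I σ φ) (hB : 0 < B) (hε : 0 < ε)
    (hσ : σ = 1 ∨ σ = -1) {t : ℝ} (ht : t ∈ I) (ht0 : 0 ≤ σ * t) :
    ∀ᵐ ξ, ‖(𝓕 (φ t) : L2) ξ‖ₑ ≤
      ENNReal.ofReal (oneConst * (B * ε * (25600 * (1 + |t|) ^ (1 / 40 : ℝ)))) := by
  filter_upwards [ae_enorm_fourier_le (freeInvL2 (t + σ) (φ t)), prof_ae (t + σ) (φ t)] with ξ h1 h2
  rw [← enorm_prof (t + σ), ← h2]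
  exact h1.trans (lintegral_le_of_wNorm_le (h.wNorm_le hB hε hσ ht ht0))

lemma Assumptions.ae_fourier_zero_le (h : Assumptions g B ε I σ φ) :
    ∀ᵐ ξ, ‖(𝓕 (φ 0) : L2) ξ‖ₑ ≤ ENNReal.ofReal (oneConst * ε) := by
  filter_upwards [ae_enorm_fourier_le (φ 0)] with ξ h1
  exact h1.trans (lintegral_le_of_wNorm_le (wNorm_le_of_initialBound h.initial))

/-- The constant in the bound of the variation of the profile. -/
def profConst (g : ℂ) : ℝ := 2 * (25600 * oneConst) + 8 * timeConst g + 1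

lemma profConst_pos (g : ℂ) : 0 < profConst g := by
  have := timeConst_nonneg g
  have := oneConst_nonneg
  unfold profConst
  positivity

/-- Where `(Bε)²` exceeds `(1+|t|)^{3/20}`, the linear bound `Bε (1+|t|)^{1/40}` is already cubic
with the required decay, because `1/40 + 1/10 ≤ 3/20`. -/
lemma Assumptions.ae_prof_le_of_large (h : Assumptions g B ε I σ φ) (hB : 0 < B) (hε : 0 < ε)
    (hσ : σ = 1 ∨ σ = -1) {t : ℝ} (ht : t ∈ I) (ht0 : 0 ≤ σ * t)
    (hM : (1 + |t|) ^ (3 / 20 : ℝ) ≤ (B * ε) ^ 2) :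
    ∀ᵐ ξ, ‖prof t (φ t) ξ‖ₑ ≤
      ENNReal.ofReal (25600 * oneConst * (B * ε) ^ 3 * (1 + |t|) ^ (-(1 / 10) : ℝ)) := by
  filter_upwards [h.ae_fourier_le hB hε hσ ht ht0] with ξ hξ
  rw [enorm_prof]
  refine hξ.trans (ENNReal.ofReal_le_ofReal ?_)
  have h1 : 0 < 1 + |t| := by positivity
  have h2 := oneConst_nonneg
  have h3 : 0 < B * ε := mul_pos hB hε
  have h4 : (1 + |t|) ^ (1 / 40 : ℝ) ≤ (B * ε) ^ 2 * (1 + |t|) ^ (-(1 / 10) : ℝ) := by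
    calc (1 + |t|) ^ (1 / 40 : ℝ) ≤ (1 + |t|) ^ (3 / 20 + -(1 / 10) : ℝ) :=
          Real.rpow_le_rpow_of_exponent_le (by linarith [abs_nonneg t]) (by norm_num)
      _ = (1 + |t|) ^ (3 / 20 : ℝ) * (1 + |t|) ^ (-(1 / 10) : ℝ) := Real.rpow_add h1 _ _
      _ ≤ _ := by gcongr
  calc oneConst * (B * ε * (25600 * (1 + |t|) ^ (1 / 40 : ℝ))) ≤
        oneConst * (B * ε * (25600 * ((B * ε) ^ 2 * (1 + |t|) ^ (-(1 / 10) : ℝ)))) := by gcongr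
    _ = _ := by ring

/-- The quintic term is absorbed at the price of `(1+|t₁|)^{3/20}`, and `3/20 - 1/4 = -1/10`: this
is the origin of the rate. -/
lemma Assumptions.ae_prof_sub_le_of_small (h : Assumptions g B ε I σ φ) (hB : 0 < B) (hε : 0 < ε)
    (hσ : σ = 1 ∨ σ = -1) {t₁ t₂ : ℝ} (ht₁ : t₁ ∈ I) (ht₂ : t₂ ∈ I) (h0 : 0 ≤ σ * t₁)
    (h12 : σ * t₁ ≤ σ * t₂) (hM : (B * ε) ^ 2 ≤ (1 + |t₁|) ^ (3 / 20 : ℝ)) :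
    ∀ᵐ ξ, ‖prof t₂ (φ t₂) ξ - prof t₁ (φ t₁) ξ‖ₑ ≤
      ENNReal.ofReal (8 * timeConst g * (B * ε) ^ 3 * (1 + |t₁|) ^ (-(1 / 10) : ℝ)) := by
  filter_upwards [h.ae_prof_sub_le hB hε hσ ht₁ ht₂ h0 h12] with ξ hξ
  refine hξ.trans (ENNReal.ofReal_le_ofReal ?_)
  have h1 : 1 ≤ 1 + |t₁| := by linarith [abs_nonneg t₁]
  have h2 := timeConst_nonneg g
  have h3 : 0 < B * ε := mul_pos hB hε
  have h5 : 1 ≤ (1 + |t₁|) ^ (3 / 20 : ℝ) := Real.one_le_rpow h1 (by norm_num)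
  have h4 : (B * ε) ^ 3 + (B * ε) ^ 5 ≤ 2 * (B * ε) ^ 3 * (1 + |t₁|) ^ (3 / 20 : ℝ) := by
    calc (B * ε) ^ 3 + (B * ε) ^ 5 = (B * ε) ^ 3 * 1 + (B * ε) ^ 3 * (B * ε) ^ 2 := by ring
      _ ≤ (B * ε) ^ 3 * (1 + |t₁|) ^ (3 / 20 : ℝ) + (B * ε) ^ 3 * (1 + |t₁|) ^ (3 / 20 : ℝ) := by
        gcongr
      _ = _ := by ring
  calc 4 * (timeConst g * ((B * ε) ^ 3 + (B * ε) ^ 5)) * (1 + |t₁|) ^ (-(1 / 4) : ℝ) ≤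
        4 * (timeConst g * (2 * (B * ε) ^ 3 * (1 + |t₁|) ^ (3 / 20 : ℝ))) *
          (1 + |t₁|) ^ (-(1 / 4) : ℝ) := by gcongr
    _ = 8 * timeConst g * (B * ε) ^ 3 *
        ((1 + |t₁|) ^ (3 / 20 : ℝ) * (1 + |t₁|) ^ (-(1 / 4) : ℝ)) := by ring
    _ = _ := by
      rw [← Real.rpow_add (by linarith)]
      norm_num

lemma rpow_neg_anti {a b r : ℝ} (ha : 0 ≤ a) (hab : a ≤ b) (hr : 0 ≤ r) :
    (1 + b) ^ (-r) ≤ (1 + a) ^ (-r) :=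
  Real.rpow_le_rpow_of_nonpos (by linarith) (by linarith) (by linarith)

/-- The cubic bound of the variation of the profile. -/
lemma Assumptions.ae_prof_sub_le_cube (h : Assumptions g B ε I σ φ) (hB : 0 < B) (hε : 0 < ε)
    (hσ : σ = 1 ∨ σ = -1) {t₁ t₂ : ℝ} (ht₁ : t₁ ∈ I) (ht₂ : t₂ ∈ I) (h0 : 0 ≤ σ * t₁)
    (h12 : σ * t₁ ≤ σ * t₂) :
    ∀ᵐ ξ, ‖prof t₂ (φ t₂) ξ - prof t₁ (φ t₁) ξ‖ₑ ≤
      ENNReal.ofReal (profConst g * (B * ε) ^ 3 * (1 + |t₁|) ^ (-(1 / 10) : ℝ)) := by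
  have hc1 := timeConst_nonneg g
  have hc2 := oneConst_nonneg
  have hM : 0 < B * ε := mul_pos hB hε
  have hr : 0 ≤ (1 + |t₁|) ^ (-(1 / 10) : ℝ) := by positivity
  have hy : 0 ≤ (B * ε) ^ 3 * (1 + |t₁|) ^ (-(1 / 10) : ℝ) := by positivity
  have habs : |t₁| ≤ |t₂| := by rwa [← mul_sign_eq_abs hσ h0, ← mul_sign_eq_abs hσ (h0.trans h12)]
  by_cases hs : (B * ε) ^ 2 ≤ (1 + |t₁|) ^ (3 / 20 : ℝ)
  · filter_upwards [h.ae_prof_sub_le_of_small hB hε hσ ht₁ ht₂ h0 h12 hs] with ξ hξ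
    refine hξ.trans (ENNReal.ofReal_le_ofReal ?_)
    rw [mul_assoc (8 * timeConst g), mul_assoc (profConst g)]
    refine mul_le_mul_of_nonneg_right ?_ hy
    unfold profConst
    linarith
  · push Not at hs
    have hb1 := h.ae_prof_le_of_large hB hε hσ ht₁ h0 hs.le
    by_cases hs2 : (1 + |t₂|) ^ (3 / 20 : ℝ) ≤ (B * ε) ^ 2
    · filter_upwards [hb1, h.ae_prof_le_of_large hB hε hσ ht₂ (h0.trans h12) hs2] with ξ h1 h2
      refine enorm_sub_le.trans ((add_le_add h2 h1).trans ?_)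
      rw [← ENNReal.ofReal_add (by positivity) (by positivity)]
      refine ENNReal.ofReal_le_ofReal ?_
      have h3 := rpow_neg_anti (abs_nonneg t₁) habs (r := 1 / 10) (by norm_num)
      calc _ ≤ 25600 * oneConst * (B * ε) ^ 3 * (1 + |t₁|) ^ (-(1 / 10) : ℝ) +
            25600 * oneConst * (B * ε) ^ 3 * (1 + |t₁|) ^ (-(1 / 10) : ℝ) := by gcongr
        _ = 2 * (25600 * oneConst) * ((B * ε) ^ 3 * (1 + |t₁|) ^ (-(1 / 10) : ℝ)) := by ring
        _ ≤ profConst g * ((B * ε) ^ 3 * (1 + |t₁|) ^ (-(1 / 10) : ℝ)) := by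
          refine mul_le_mul_of_nonneg_right ?_ hy
          unfold profConst
          linarith
        _ = _ := by ring
    · push Not at hs2
      -- The two times lie in different regimes. `R` is the value of `1 + |t|` at the switching
      -- time, where both one-regime bounds hold; the difference is split there.
      set R := ((B * ε) ^ 2) ^ (20 / 3 : ℝ) with hR
      have hRpow : R ^ (3 / 20 : ℝ) = (B * ε) ^ 2 := by
        rw [hR, ← Real.rpow_mul (by positivity)]
        norm_num
      have hR0 : 0 < R := by positivity
      have hR1 : 1 + |t₁| ≤ R := by
        rw [← hRpow] at hs
        exact ((Real.rpow_lt_rpow_iff (by positivity) hR0.le (by norm_num)).mp hs).le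
      have hR2 : R ≤ 1 + |t₂| := by
        rw [← hRpow] at hs2
        exact ((Real.rpow_lt_rpow_iff hR0.le (by positivity) (by norm_num)).mp hs2).le
      have hσσ : σ * (σ * (R - 1)) = R - 1 := by rcases hσ with rfl | rfl <;> ring
      set t := σ * (R - 1) with ht
      have h0t : 0 ≤ σ * t := by
        rw [hσσ]
        linarith [abs_nonneg t₁]
      have htabs : 1 + |t| = R := by
        rw [← mul_sign_eq_abs hσ h0t, hσσ]
        ring
      have h1t : σ * t₁ ≤ σ * t := by
        rw [hσσ, mul_sign_eq_abs hσ h0]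
        linarith
      have ht2 : σ * t ≤ σ * t₂ := by
        rw [hσσ, mul_sign_eq_abs hσ (h0.trans h12)]
        linarith
      have htI : t ∈ I := by
        refine h.solution.ordConnected.uIcc_subset ht₁ ht₂ ?_
        rw [Set.mem_uIcc]
        rcases hσ with rfl | rfl
        · left
          constructor <;> linarith
        · right
          constructor <;> linarith
      have htM : (1 + |t|) ^ (3 / 20 : ℝ) = (B * ε) ^ 2 := by rw [htabs, hRpow]
      have h3 := rpow_neg_anti (abs_nonneg t₁) (b := |t|) (by linarith) (r := 1 / 10) (by norm_num)
      filter_upwards [hb1, h.ae_prof_le_of_large hB hε hσ htI h0t htM.le,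
        h.ae_prof_sub_le_of_small hB hε hσ htI ht₂ h0t ht2 htM.ge] with ξ h4 h5 h6
      have h7 : prof t₂ (φ t₂) ξ - prof t₁ (φ t₁) ξ =
        (prof t₂ (φ t₂) ξ - prof t (φ t) ξ) + (prof t (φ t) ξ - prof t₁ (φ t₁) ξ) := by ring
      rw [h7]
      refine (enorm_add_le _ _).trans ((add_le_add h6 (enorm_sub_le.trans
        (add_le_add h5 h4))).trans ?_)
      rw [← ENNReal.ofReal_add (by positivity) (by positivity),
        ← ENNReal.ofReal_add (by positivity) (by positivity)]
      refine ENNReal.ofReal_le_ofReal ?_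
      calc _ ≤ 8 * timeConst g * (B * ε) ^ 3 * (1 + |t₁|) ^ (-(1 / 10) : ℝ) +
            (25600 * oneConst * (B * ε) ^ 3 * (1 + |t₁|) ^ (-(1 / 10) : ℝ) +
            25600 * oneConst * (B * ε) ^ 3 * (1 + |t₁|) ^ (-(1 / 10) : ℝ)) := by gcongr
        _ = (2 * (25600 * oneConst) + 8 * timeConst g) *
            ((B * ε) ^ 3 * (1 + |t₁|) ^ (-(1 / 10) : ℝ)) := by ring
        _ ≤ profConst g * ((B * ε) ^ 3 * (1 + |t₁|) ^ (-(1 / 10) : ℝ)) := by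
          refine mul_le_mul_of_nonneg_right ?_ hy
          unfold profConst
          linarith
        _ = _ := by ring

end Solution


/-! ### Asymptotics of the profile -/

lemma profile_eq (t : ℝ) (u : L2) (ξ : Plane) :
    profile t u ξ = (((2 * Real.pi)⁻¹ : ℝ) : ℂ) * prof t u ((2 * Real.pi)⁻¹ • ξ) := by
  have hπ := Real.pi_ne_zero
  have h : chirp (4 * Real.pi ^ 2 * t) ((2 * Real.pi)⁻¹ • ξ) =
      Complex.exp (Complex.I * ((t * ‖ξ‖ ^ 2 : ℝ) : ℂ)) := by
    unfold chirp
    rw [norm_smul, mul_pow, Real.norm_eq_abs, sq_abs]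
    congr 3
    field_simp
    ring
  rw [prof, h, profile, fourier]
  ring

lemma enorm_two_pi_inv_ofReal_le : ‖(((2 * Real.pi)⁻¹ : ℝ) : ℂ)‖ₑ ≤ 1 := by
  rw [enorm_ofReal_eq]
  exact enorm_two_pi_inv_le

lemma two_pi_inv_ne_zero : (2 * Real.pi)⁻¹ ≠ 0 := by
  have := Real.pi_ne_zero
  positivity

lemma eLpNorm_top_le {f : Plane → ℂ} {A : ℝ≥0∞} (h : ∀ᵐ x, ‖f x‖ₑ ≤ A) :
    eLpNorm f ∞ volume ≤ A := by
  rw [eLpNorm_exponent_top]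
  exact essSup_le_of_ae_le _ h

lemma eLpNorm_dilation_le {f : Plane → ℂ} {F : Plane → ℂ} {A : ℝ≥0∞}
    (hf : ∀ ξ, f ξ = (((2 * Real.pi)⁻¹ : ℝ) : ℂ) * F ((2 * Real.pi)⁻¹ • ξ))
    (h : ∀ᵐ x, ‖F x‖ₑ ≤ A) : eLpNorm f ∞ volume ≤ A := by
  refine eLpNorm_top_le ?_
  filter_upwards [ae_comp_smul h two_pi_inv_ne_zero] with ξ hξ
  rw [hf, enorm_mul]
  exact (mul_le_of_le_one_left' enorm_two_pi_inv_ofReal_le).trans hξ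

section Solution

variable {g : ℂ} {B ε σ : ℝ} {I : Set ℝ} {φ : ℝ → L2}

lemma Assumptions.eLpNorm_profile_sub_le (h : Assumptions g B ε I σ φ) (hB : 0 < B) (hε : 0 < ε)
    (hσ : σ = 1 ∨ σ = -1) {t₁ t₂ : ℝ} (ht₁ : t₁ ∈ I) (ht₂ : t₂ ∈ I) (h0 : 0 ≤ σ * t₁)
    (h12 : σ * t₁ ≤ σ * t₂) :
    eLpNorm (fun ξ => profile t₂ (φ t₂) ξ - profile t₁ (φ t₁) ξ) ∞ volume ≤
      ENNReal.ofReal (profConst g * B ^ 3 * ε ^ 3 * (1 + |t₁|) ^ (-(1 / 10) : ℝ)) := by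
  refine (eLpNorm_dilation_le (F := fun ξ => prof t₂ (φ t₂) ξ - prof t₁ (φ t₁) ξ) (fun ξ => ?_)
    (h.ae_prof_sub_le_cube hB hε hσ ht₁ ht₂ h0 h12)).trans (le_of_eq ?_)
  · simp only [profile_eq]
    ring
  · congr 1
    ring

lemma tendsto_rate (C : ℝ) : Tendsto (fun s : ℝ =>
    ENNReal.ofReal (C * (1 + s) ^ (-(1 / 10) : ℝ))) atTop (𝓝 0) := by
  have h1 := (tendsto_rpow_neg_atTop (y := 1 / 10) (by norm_num)).comp
    (tendsto_atTop_add_const_left atTop (1 : ℝ) tendsto_id)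
  have h2 := ENNReal.tendsto_ofReal (h1.const_mul C)
  rw [mul_zero, ENNReal.ofReal_zero] at h2
  exact h2

/-- Existence of the asymptotic profile. -/
lemma Assumptions.exists_prof_limit (h : Assumptions g B ε I σ φ) (hB : 0 < B) (hε : 0 < ε)
    (hσ : σ = 1 ∨ σ = -1) (hI : ∀ t : ℝ, 0 ≤ σ * t → t ∈ I) :
    ∃ F : Plane → ℂ, Measurable F ∧ ∀ t : ℝ, 0 ≤ σ * t → ∀ᵐ ξ, ‖prof t (φ t) ξ - F ξ‖ₑ ≤
      ENNReal.ofReal (profConst g * (B * ε) ^ 3 * (1 + |t|) ^ (-(1 / 10) : ℝ)) := by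
  have hσσ : ∀ t, σ * (σ * t) = t := fun t => by rcases hσ with rfl | rfl <;> ring
  set V : ℕ → Plane → ℂ := fun n => prof (σ * n) (φ (σ * n)) with hV
  have hn0 : ∀ n : ℕ, 0 ≤ σ * (σ * n) := fun n => by
    rw [hσσ]
    positivity
  have habs : ∀ n : ℕ, |σ * n| = n := fun n => by
    rw [← mul_sign_eq_abs hσ (hn0 n), hσσ]
  -- The bounds hold off a null set depending on the pair of times, so the limit is taken along
  -- integer times, where countably many null sets suffice.
  have hcauchy : ∀ᵐ ξ, ∀ n m : ℕ, n ≤ m → ‖V m ξ - V n ξ‖ₑ ≤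
      ENNReal.ofReal (profConst g * (B * ε) ^ 3 * (1 + (n : ℝ)) ^ (-(1 / 10) : ℝ)) := by
    rw [ae_all_iff]
    intro n
    rw [ae_all_iff]
    intro m
    by_cases hnm : n ≤ m
    · filter_upwards [h.ae_prof_sub_le_cube hB hε hσ (hI _ (hn0 n)) (hI _ (hn0 m)) (hn0 n)
        (by rw [hσσ, hσσ]; exact_mod_cast hnm)] with ξ hξ _
      rwa [habs] at hξ
    · exact Eventually.of_forall fun ξ hc => absurd hc hnm
  have hlim : ∀ᵐ ξ, ∃ l, Tendsto (fun n => V n ξ) atTop (𝓝 l) := by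
    filter_upwards [hcauchy] with ξ hξ
    refine cauchySeq_tendsto_of_complete ?_
    rw [EMetric.cauchySeq_iff']
    intro η hη
    have h1 := (tendsto_rate (profConst g * (B * ε) ^ 3)).comp tendsto_natCast_atTop_atTop
    obtain ⟨N, hN⟩ := (h1.eventually_lt_const hη).exists
    refine ⟨N, fun n hn => ?_⟩
    rw [edist_eq_enorm_sub]
    exact (hξ N n hn).trans_lt hN
  obtain ⟨F, hFm, hF⟩ := measurable_limit_of_tendsto_metrizable_ae
    (f := V) (L := atTop) (fun n => (measurable_prof (σ * n) (φ (σ * n))).aemeasurable) hlim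
  refine ⟨F, hFm, fun t ht => ?_⟩
  have hall : ∀ᵐ ξ, ∀ n : ℕ, |t| ≤ n → ‖V n ξ - prof t (φ t) ξ‖ₑ ≤
      ENNReal.ofReal (profConst g * (B * ε) ^ 3 * (1 + |t|) ^ (-(1 / 10) : ℝ)) := by
    rw [ae_all_iff]
    intro n
    by_cases hn : |t| ≤ n
    · filter_upwards [h.ae_prof_sub_le_cube hB hε hσ (hI _ ht) (hI _ (hn0 n)) ht
        (by rw [hσσ, mul_sign_eq_abs hσ ht]; exact hn)] with ξ hξ _
      exact hξ
    · exact Eventually.of_forall fun ξ hc => absurd hc hn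
  filter_upwards [hall, hF] with ξ h1 h2
  rw [← enorm_neg, neg_sub]
  refine le_of_tendsto (h2.sub_const _).enorm ?_
  filter_upwards [tendsto_natCast_atTop_atTop.eventually_ge_atTop |t|] with n hn
  exact h1 n hn

lemma Assumptions.exists_profile_limit (h : Assumptions g B ε I σ φ) (hB : 0 < B) (hε : 0 < ε)
    (hσ : σ = 1 ∨ σ = -1) (hI : ∀ t : ℝ, 0 ≤ σ * t → t ∈ I) :
    ∃ F : Plane → ℂ, MemLp F ∞ volume ∧
      (∀ t : ℝ, 0 ≤ σ * t → eLpNorm (fun ξ => profile t (φ t) ξ - F ξ) ∞ volume ≤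
        ENNReal.ofReal (profConst g * B ^ 3 * ε ^ 3 * (1 + |t|) ^ (-(1 / 10) : ℝ))) ∧
      Tendsto (fun s : ℝ => eLpNorm (fun ξ => profile (σ * s) (φ (σ * s)) ξ - F ξ) ∞ volume)
        atTop (𝓝 0) := by
  obtain ⟨F, hFm, hF⟩ := h.exists_prof_limit hB hε hσ hI
  have h0 : 0 ≤ σ * 0 := by rw [mul_zero]
  have hσσ : ∀ t, σ * (σ * t) = t := fun t => by rcases hσ with rfl | rfl <;> ring
  have hbd : ∀ t : ℝ, 0 ≤ σ * t → eLpNorm (fun ξ => profile t (φ t) ξ -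
      (((2 * Real.pi)⁻¹ : ℝ) : ℂ) * F ((2 * Real.pi)⁻¹ • ξ)) ∞ volume ≤
        ENNReal.ofReal (profConst g * B ^ 3 * ε ^ 3 * (1 + |t|) ^ (-(1 / 10) : ℝ)) := fun t ht => by
    refine (eLpNorm_dilation_le (F := fun ξ => prof t (φ t) ξ - F ξ) (fun ξ => ?_)
      (hF t ht)).trans (le_of_eq ?_)
    · simp only [profile_eq]
      ring
    · congr 1
      ring
  refine ⟨fun ξ => (((2 * Real.pi)⁻¹ : ℝ) : ℂ) * F ((2 * Real.pi)⁻¹ • ξ), ⟨?_, ?_⟩, hbd, ?_⟩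
  · have : Measurable fun ξ : Plane => F ((2 * Real.pi)⁻¹ • ξ) :=
      hFm.comp (measurable_const_smul _)
    exact (this.const_mul _).aestronglyMeasurable
  -- Boundedness of the limit comes from its distance to the profile at time `0`, which the initial
  -- data control.
  · refine (eLpNorm_dilation_le (F := F) (A := ENNReal.ofReal (oneConst * ε) + ENNReal.ofReal
      (profConst g * (B * ε) ^ 3 * (1 + |(0 : ℝ)|) ^ (-(1 / 10) : ℝ))) (fun ξ => rfl) ?_).trans_lt
      (ENNReal.add_lt_top.mpr ⟨ENNReal.ofReal_lt_top, ENNReal.ofReal_lt_top⟩)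
    filter_upwards [hF 0 h0, h.ae_fourier_zero_le] with ξ h1 h2
    rw [← enorm_prof 0] at h2
    have h3 : F ξ = prof 0 (φ 0) ξ - (prof 0 (φ 0) ξ - F ξ) := by ring
    rw [h3]
    exact enorm_sub_le.trans (add_le_add h2 h1)
  · refine tendsto_of_tendsto_of_tendsto_of_le_of_le' tendsto_const_nhds
      (tendsto_rate (profConst g * B ^ 3 * ε ^ 3)) (Eventually.of_forall fun _ => zero_le) ?_
    filter_upwards [eventually_ge_atTop (0 : ℝ)] with s hs
    have hs0 : 0 ≤ σ * (σ * s) := by rwa [hσσ]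
    refine (hbd (σ * s) hs0).trans (le_of_eq ?_)
    rw [← mul_sign_eq_abs hσ hs0, hσσ]

/-! ### Boundedness of the Fourier transform -/

/-- The modulus of the Fourier transform is that of the profile. The profile at time `0` costs
`oneConst * ε`, at most half of the target when `B` is large; its variation is cubic in `Bε`, at
most the other half when `ε` is small. -/
lemma exists_ae_fourier_le (g : ℂ) {δ : ℝ} (hδ : 0 < δ) : ∃ B₀ : ℝ, 0 < B₀ ∧ ∀ B : ℝ, B₀ ≤ B →
    ∃ ε₀ : ℝ, 0 < ε₀ ∧ ∀ (ε : ℝ) (I : Set ℝ) (σ : ℝ) (φ : ℝ → L2),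
      0 < ε → ε ≤ ε₀ → (σ = 1 ∨ σ = -1) → Assumptions g B ε I σ φ →
      ∀ t ∈ I, 0 ≤ σ * t → ∀ᵐ ξ, ‖(𝓕 (φ t) : L2) ξ‖ₑ ≤ ENNReal.ofReal (δ * B * ε) := by
  have hQ := oneConst_nonneg
  have hP := profConst_pos g
  refine ⟨2 * oneConst / δ + 1, by positivity, fun B hB₀ => ?_⟩
  have hB : 0 < B := lt_of_lt_of_le (by positivity) hB₀
  refine ⟨min 1 (δ / (2 * (profConst g * B ^ 2))), by positivity, ?_⟩
  intro ε I σ φ hε hε₀ hσ h t ht ht0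
  have h0 : 0 ≤ σ * 0 := by rw [mul_zero]
  filter_upwards [h.ae_prof_sub_le_cube hB hε hσ h.solution.zero_mem ht h0
    (by rw [mul_zero]; exact ht0), h.ae_fourier_zero_le] with ξ h1 h2
  rw [← enorm_prof 0] at h2
  rw [← enorm_prof t]
  have h3 : prof t (φ t) ξ = (prof t (φ t) ξ - prof 0 (φ 0) ξ) + prof 0 (φ 0) ξ := by ring
  rw [h3]
  refine (enorm_add_le _ _).trans ((add_le_add h1 h2).trans ?_)
  rw [abs_zero, add_zero, Real.one_rpow, mul_one,
    ← ENNReal.ofReal_add (by positivity) (by positivity)]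
  refine ENNReal.ofReal_le_ofReal ?_
  have hε1 : ε ≤ 1 := hε₀.trans (min_le_left _ _)
  have hε2 : profConst g * B ^ 2 * ε ≤ δ / 2 := by
    have := hε₀.trans (min_le_right _ _)
    rw [le_div_iff₀ (by positivity)] at this
    linarith
  have hε3 : profConst g * B ^ 2 * ε ^ 2 ≤ δ / 2 := by
    refine le_trans ?_ hε2
    rw [sq ε, ← mul_assoc]
    exact mul_le_of_le_one_right (by positivity) hε1
  have hB2 : oneConst ≤ δ / 2 * B := by
    have : 2 * oneConst / δ ≤ B := by linarith
    rw [div_le_iff₀ hδ] at this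
    linarith
  calc profConst g * (B * ε) ^ 3 + oneConst * ε =
        profConst g * B ^ 2 * ε ^ 2 * (B * ε) + oneConst * ε := by ring
    _ ≤ δ / 2 * (B * ε) + δ / 2 * B * ε := by gcongr
    _ = _ := by ring

/-! ### Pointwise decay -/

lemma ofReal_tailConst : ENNReal.ofReal tailConst.toReal = tailConst :=
  ENNReal.ofReal_toReal tailConst_lt_top.ne

/-- The bound for bounded times. -/
lemma ae_enorm_le_of_fourier_le {u : L2} {a b R : ℝ} (ha : 0 ≤ a) (hb : 0 ≤ b) (hR : 0 < R)
    (hu : h2Norm (u : 𝓢'(Plane, ℂ)) ≤ ENNReal.ofReal b)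
    (hF : ∀ᵐ ξ, ‖(𝓕 u : L2) ξ‖ₑ ≤ ENNReal.ofReal a) :
    ∀ᵐ x, ‖u x‖ₑ ≤ ENNReal.ofReal (a * (volume (Metric.ball (0 : Plane) R)).toReal +
      R⁻¹ * tailConst.toReal * (2 * b)) := by
  filter_upwards [ae_enorm_le_lintegral_fourier u] with x hx
  refine hx.trans ((lintegral_le_ball_add_tail (measurable_enorm_L2 _) hR).trans ?_)
  have h1 : ∫⁻ ξ in Metric.ball 0 R, ‖(𝓕 u : L2) ξ‖ₑ ≤
      ENNReal.ofReal (a * (volume (Metric.ball (0 : Plane) R)).toReal) := by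
    rw [ENNReal.ofReal_mul ha, ENNReal.ofReal_toReal measure_ball_lt_top.ne,
      ← setLIntegral_const]
    exact lintegral_mono_ae (ae_restrict_of_ae hF)
  have h2 := N2_sq_mul_fourier_le (hu.trans_lt ENNReal.ofReal_lt_top)
  have h3 : ENNReal.ofReal (R⁻¹ * tailConst.toReal * (2 * b)) =
      ENNReal.ofReal R⁻¹ * tailConst * (2 * ENNReal.ofReal b) := by
    rw [ENNReal.ofReal_mul (by positivity), ENNReal.ofReal_mul (by positivity),
      ENNReal.ofReal_mul (by positivity), ofReal_tailConst, ENNReal.ofReal_ofNat]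
  rw [ENNReal.ofReal_add (by positivity) (by positivity), h3]
  refine add_le_add h1 ?_
  gcongr
  exact h2.trans (by gcongr)

lemma enorm_chirp_sub_one_le (c : ℝ) (y : Plane) :
    ‖chirp c y - 1‖ₑ ≤ ENNReal.ofReal (|c| * ‖y‖ ^ 2) := by
  unfold chirp
  refine Real.enorm_exp_I_mul_ofReal_sub_one_le.trans (le_of_eq ?_)
  rw [← ofReal_norm, norm_mul, norm_pow, norm_norm, Real.norm_eq_abs]

/-- The error in the asymptotic formula for the free evolution. -/
lemma lintegral_chirp_sub_one_mul_le {f : L2} {K c R : ℝ} (hK : 0 ≤ K) (hR : 0 < R)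
    (hf : wNorm f ≤ ENNReal.ofReal K) :
    ∫⁻ y, ‖chirp c y - 1‖ₑ * ‖f y‖ₑ ≤
      ENNReal.ofReal ((|c| * R ^ 2 * oneConst + 2 * R⁻¹ * tailConst.toReal) * K) := by
  have hQ := oneConst_nonneg
  have hm : Measurable fun y => ‖chirp c y - 1‖ₑ := by
    have := (continuous_chirp c).measurable
    fun_prop
  have hn : ∀ y, ‖chirp c y - 1‖ₑ ≤ 2 := fun y => by
    refine enorm_sub_le.trans (le_of_eq ?_)
    rw [← ofReal_norm, norm_chirp, ENNReal.ofReal_one, enorm_one]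
    norm_num
  refine (lintegral_le_ball_add_tail (hm.mul (measurable_enorm_L2 f)) hR).trans ?_
  have h1 : ∫⁻ y in Metric.ball 0 R, ‖chirp c y - 1‖ₑ * ‖f y‖ₑ ≤
      ENNReal.ofReal (|c| * R ^ 2) * ENNReal.ofReal (oneConst * K) := by
    calc _ ≤ ∫⁻ y in Metric.ball 0 R, ENNReal.ofReal (|c| * R ^ 2) * ‖f y‖ₑ := by
          refine setLIntegral_mono (by fun_prop) fun y hy => ?_
          gcongr
          refine (enorm_chirp_sub_one_le c y).trans (ENNReal.ofReal_le_ofReal ?_)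
          have : ‖y‖ ≤ R := (mem_ball_zero_iff.mp hy).le
          gcongr
      _ ≤ ∫⁻ y, ENNReal.ofReal (|c| * R ^ 2) * ‖f y‖ₑ := setLIntegral_le_lintegral _ _
      _ = ENNReal.ofReal (|c| * R ^ 2) * ∫⁻ y, ‖f y‖ₑ := lintegral_const_mul _ (by fun_prop)
      _ ≤ _ := by
          gcongr
          exact lintegral_le_of_wNorm_le hf
  have h2 : N2 (fun y => ‖y‖ₑ ^ 2 * (‖chirp c y - 1‖ₑ * ‖f y‖ₑ)) ≤ 2 * ENNReal.ofReal K := by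
    refine le_trans ?_ (mul_le_mul' le_rfl (le_add_self.trans hf))
    rw [← N2_const_mul 2 (by fun_prop)]
    refine N2_mono fun y => ?_
    calc ‖y‖ₑ ^ 2 * (‖chirp c y - 1‖ₑ * ‖f y‖ₑ) ≤ ‖y‖ₑ ^ 2 * (2 * ‖f y‖ₑ) := by
          gcongr
          exact hn y
      _ = _ := by ring
  refine (add_le_add h1 (mul_le_mul' le_rfl h2)).trans (le_of_eq ?_)
  have h3 : ENNReal.ofReal (2 * R⁻¹ * tailConst.toReal * K) =
      ENNReal.ofReal R⁻¹ * tailConst * (2 * ENNReal.ofReal K) := by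
    rw [ENNReal.ofReal_mul (by positivity), ENNReal.ofReal_mul (by positivity),
      ENNReal.ofReal_mul (by positivity), ofReal_tailConst, ENNReal.ofReal_ofNat]
    ring
  rw [add_mul, ENNReal.ofReal_add (by positivity) (by positivity), h3,
    ← ENNReal.ofReal_mul (by positivity), ← mul_assoc (|c| * R ^ 2)]

/-- The bound for large times. -/
lemma ae_enorm_le_of_wNorm_le {u : L2} {τ a K R : ℝ} (hτ : τ ≠ 0) (ha : 0 ≤ a) (hK : 0 ≤ K)
    (hR : 0 < R) (hf : wNorm (freeInvL2 τ u) ≤ ENNReal.ofReal K)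
    (hF : ∀ᵐ ξ, ‖(𝓕 u : L2) ξ‖ₑ ≤ ENNReal.ofReal a) :
    ∀ᵐ x, ‖u x‖ₑ ≤ ENNReal.ofReal ((4 * Real.pi * |τ|)⁻¹ *
      (a + (|1 / (4 * τ)| * R ^ 2 * oneConst + 2 * R⁻¹ * tailConst.toReal) * K)) := by
  have hρ := rho_ne_zero hτ
  have hQ := oneConst_nonneg
  set f := freeInvL2 τ u with hfd
  set w := chirpMul (1 / (4 * τ)) f with hw
  set b := (|1 / (4 * τ)| * R ^ 2 * oneConst + 2 * R⁻¹ * tailConst.toReal) * K with hb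
  have hb0 : 0 ≤ b := by positivity
  have hdiff : ∫⁻ y, ‖(w - f : L2) y‖ₑ ≤ ENNReal.ofReal b := by
    -- The chirped and the unchirped profile differ in `L¹` by a small amount, so their Fourier
    -- transforms differ uniformly by as much.
    refine le_trans (le_of_eq ?_) (lintegral_chirp_sub_one_mul_le (c := 1 / (4 * τ)) hK hR hf)
    refine lintegral_congr_ae ?_
    filter_upwards [Lp.coeFn_sub w f, chirpMul_ae (1 / (4 * τ)) f] with y h1 h2
    rw [h1, Pi.sub_apply, hw, h2, ← enorm_mul, sub_mul, one_mul]
  have hsub : (𝓕 w : L2) = 𝓕 (w - f) + 𝓕 f := by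
    rw [← FourierTransform.fourier_add, sub_add_cancel]
  have hX : ∀ᵐ X : Plane, ‖u ((4 * Real.pi * τ) • X)‖ₑ ≤
      ENNReal.ofReal ((4 * Real.pi * |τ|)⁻¹ * (a + b)) := by
    filter_upwards [ae_enorm_fourier_le (w - f), prof_ae τ u, hF,
      Lp.coeFn_add (𝓕 (w - f) : L2) (𝓕 f), pscL2_ae hτ u] with X h1 h2 h3 h4 h5
    have h6 : ‖psc τ u X‖ₑ ≤ ENNReal.ofReal (a + b) := by
      rw [← h5, ← fourier_chirpMul_freeInvL2 hτ, ← hfd, ← hw, hsub, h4, Pi.add_apply, add_comm,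
        ENNReal.ofReal_add ha hb0]
      refine (enorm_add_le _ _).trans (add_le_add ?_ (h1.trans hdiff))
      rw [hfd, h2, enorm_prof]
      exact h3
    rw [← ofReal_norm, norm_psc, ENNReal.ofReal_le_ofReal_iff (by positivity), abs_mul,
      abs_of_pos (show 0 < 4 * Real.pi by positivity)] at h6
    rw [← ofReal_norm]
    refine ENNReal.ofReal_le_ofReal ?_
    have hpos : 0 < 4 * Real.pi * |τ| := by positivity
    rwa [inv_mul_eq_div, le_div_iff₀ hpos, mul_comm]
  filter_upwards [ae_comp_smul hX (inv_ne_zero hρ)] with x hx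
  rwa [smul_smul, mul_inv_cancel₀ hρ, one_smul] at hx

end Solution


/-- Times with `1 + |t| ≤ T` use Fourier inversion, split at frequency `R`, and the rest the
pseudoconformal formula. The constants `T`, `R` and `δ` are chosen in this order, before `B`, so
that `δ` can be handed to `exists_ae_fourier_le`. -/
lemma exists_decayBound (g : ℂ) : ∃ B₀ : ℝ, 0 < B₀ ∧ ∀ B : ℝ, B₀ ≤ B →
    ∃ ε₀ : ℝ, 0 < ε₀ ∧ ∀ (ε : ℝ) (I : Set ℝ) (σ : ℝ) (φ : ℝ → L2),
      0 < ε → ε ≤ ε₀ → (σ = 1 ∨ σ = -1) → Assumptions g B ε I σ φ →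
      ∀ t ∈ I, 0 ≤ σ * t → DecayBound (B / 10 * ε) t (φ t) := by
  have hQ := oneConst_nonneg
  set κ := tailConst.toReal with hκ
  have hκ0 : 0 ≤ κ := ENNReal.toReal_nonneg
  set D := 25600 * (oneConst + 2 * κ) with hD
  have hD0 : 0 ≤ D := by positivity
  obtain ⟨T, hT1, hT⟩ : ∃ T : ℝ, 1 ≤ T ∧ ∀ τ : ℝ, T ≤ τ → D * τ ^ (-(9 / 40) : ℝ) ≤ 1 / 2 := by
    have h1 := (tendsto_rpow_neg_atTop (y := 9 / 40) (by norm_num)).const_mul D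
    rw [mul_zero] at h1
    obtain ⟨T, hT⟩ := eventually_atTop.mp (h1.eventually_le_const (show (0 : ℝ) < 1 / 2 by norm_num))
    exact ⟨max 1 T, le_max_left _ _, fun τ hτ => hT τ ((le_max_right _ _).trans hτ)⟩
  -- Makes the frequency tail `κ/R` at most `1/T`. The choice of `δ` below then bounds the low
  -- frequencies by `1/(20T)`, and the total is `1/20 + 1/50 = 7/100 < 1/10` in units of `Bε/T`.
  set R := 1 + κ * T with hR
  have hR0 : 0 < R := by positivity
  set v := (volume (Metric.ball (0 : Plane) R)).toReal with hv
  have hv0 : 0 ≤ v := ENNReal.toReal_nonneg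
  set δ := min (1 / 2) (1 / (20 * T * (v + 1))) with hδ
  have hδ0 : 0 < δ := by positivity
  obtain ⟨B₀, hB₀, hmain⟩ := exists_ae_fourier_le g hδ0
  refine ⟨B₀, hB₀, fun B hB => ?_⟩
  obtain ⟨ε₀, hε₀, hmain⟩ := hmain B hB
  refine ⟨ε₀, hε₀, fun ε I σ φ hε hεε hσ h t ht ht0 => ?_⟩
  have hBp : 0 < B := hB₀.trans_le hB
  have hM : 0 < B * ε := mul_pos hBp hε
  have hF := hmain ε I σ φ hε hεε hσ h t ht ht0
  have hs := abs_nonneg t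
  refine eLpNorm_top_le ?_
  by_cases hcase : 1 + |t| ≤ T
  · filter_upwards [ae_enorm_le_of_fourier_le (a := δ * B * ε) (b := B / 100 * ε) (by positivity)
      (by positivity) hR0 (h.gauge t ht ht0).sobolev hF] with x hx
    refine hx.trans (ENNReal.ofReal_le_ofReal ?_)
    have h1 : δ * v ≤ 1 / (20 * T) := by
      have : δ * (v + 1) ≤ 1 / (20 * T) := by
        calc δ * (v + 1) ≤ 1 / (20 * T * (v + 1)) * (v + 1) := by
              gcongr
              exact min_le_right _ _
          _ = _ := by field_simp
      nlinarith
    have h2 : R⁻¹ * κ ≤ 1 / T := by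
      rw [inv_mul_eq_div, div_le_div_iff₀ hR0 (by linarith)]
      linarith
    have h3 : T⁻¹ ≤ (1 + |t|)⁻¹ := inv_anti₀ (by linarith) hcase
    calc δ * B * ε * v + R⁻¹ * κ * (2 * (B / 100 * ε)) =
          (δ * v + R⁻¹ * κ * (1 / 50)) * (B * ε) := by ring
      _ ≤ (1 / (20 * T) + 1 / T * (1 / 50)) * (B * ε) := by gcongr
      _ = 7 / 100 * (B * ε) * T⁻¹ := by
        field_simp
        ring
      _ ≤ B / 10 * ε * T⁻¹ := by
        have : 0 ≤ T⁻¹ := by positivity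
        refine mul_le_mul_of_nonneg_right ?_ this
        nlinarith
      _ ≤ _ := by gcongr
  · push Not at hcase
    set τ := 1 + |t| with hτ
    have hτ0 : 0 < τ := by positivity
    have hτabs : |t + σ| = τ := abs_add_sign hσ ht0
    have hτne : t + σ ≠ 0 := fun h0 => by
      rw [h0, abs_zero] at hτabs
      linarith
    -- The radius `τ^{1/4}` balances the chirp error `τ⁻¹ R²` inside the ball against the tail,
    -- giving at most `τ^{-1/4}` against a growth of `τ^{1/40}`. The final factor `1/10` comes from
    -- `1/(4π)`.
    filter_upwards [ae_enorm_le_of_wNorm_le hτne (a := δ * B * ε) (by positivity) (by positivity)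
      (Real.rpow_pos_of_pos hτ0 (1 / 4)) (h.wNorm_le hBp hε hσ ht ht0) hF] with x hx
    refine hx.trans (ENNReal.ofReal_le_ofReal ?_)
    rw [← hτ, hτabs, ← hκ]
    have h1 : |1 / (4 * (t + σ))| ≤ τ⁻¹ := by
      rw [abs_div, abs_mul, hτabs, abs_one, abs_of_pos (by norm_num : (0 : ℝ) < 4), one_div]
      exact inv_anti₀ hτ0 (by linarith)
    have h2 : τ⁻¹ * (τ ^ (1 / 4 : ℝ)) ^ 2 ≤ τ ^ (-(1 / 4) : ℝ) := by
      rw [← Real.rpow_neg_one, ← Real.rpow_natCast, ← Real.rpow_mul hτ0.le, ← Real.rpow_add hτ0]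
      exact Real.rpow_le_rpow_of_exponent_le (by linarith) (by norm_num)
    have h3 : |1 / (4 * (t + σ))| * (τ ^ (1 / 4 : ℝ)) ^ 2 * oneConst +
        2 * (τ ^ (1 / 4 : ℝ))⁻¹ * κ ≤ (oneConst + 2 * κ) * τ ^ (-(1 / 4) : ℝ) := by
      rw [← Real.rpow_neg hτ0.le]
      calc _ ≤ τ⁻¹ * (τ ^ (1 / 4 : ℝ)) ^ 2 * oneConst + 2 * τ ^ (-(1 / 4) : ℝ) * κ := by gcongr
        _ ≤ τ ^ (-(1 / 4) : ℝ) * oneConst + 2 * τ ^ (-(1 / 4) : ℝ) * κ := by gcongr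
        _ = _ := by ring
    have h4 : τ ^ (-(1 / 4) : ℝ) * τ ^ (1 / 40 : ℝ) = τ ^ (-(9 / 40) : ℝ) := by
      rw [← Real.rpow_add hτ0]
      norm_num
    have h5 : (4 * Real.pi * τ)⁻¹ ≤ 1 / 10 * τ⁻¹ := by
      rw [mul_inv]
      gcongr
      rw [one_div]
      exact inv_anti₀ (by norm_num) (by linarith [Real.pi_gt_three])
    have h6 : δ ≤ 1 / 2 := min_le_left _ _
    calc (4 * Real.pi * τ)⁻¹ * (δ * B * ε + (|1 / (4 * (t + σ))| * (τ ^ (1 / 4 : ℝ)) ^ 2 * oneConst +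
          2 * (τ ^ (1 / 4 : ℝ))⁻¹ * κ) * (B * ε * (25600 * τ ^ (1 / 40 : ℝ))))
        ≤ (4 * Real.pi * τ)⁻¹ * (δ * B * ε + (oneConst + 2 * κ) * τ ^ (-(1 / 4) : ℝ) *
          (B * ε * (25600 * τ ^ (1 / 40 : ℝ)))) := by gcongr
      _ = (4 * Real.pi * τ)⁻¹ * ((δ + D * (τ ^ (-(1 / 4) : ℝ) * τ ^ (1 / 40 : ℝ))) * (B * ε)) := by
        rw [hD]
        ring
      _ ≤ (4 * Real.pi * τ)⁻¹ * ((1 / 2 + 1 / 2) * (B * ε)) := by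
        rw [h4]
        gcongr
        exact hT τ hcase.le
      _ ≤ 1 / 10 * τ⁻¹ * ((1 / 2 + 1 / 2) * (B * ε)) := by gcongr
      _ = _ := by ring

end CSS

end

theorem proposition3p3 (g : ℂ) :
    -- the quantitative bound, and convergence of the profile with a rate
    (∃ C : ℝ, 0 < C ∧ ∀ (B ε : ℝ) (I : Set ℝ) (σ : ℝ) (φ : ℝ → CSS.L2),
      0 < B → 0 < ε → (σ = 1 ∨ σ = -1) → CSS.Assumptions g B ε I σ φ →
      (∀ t₁ ∈ I, ∀ t₂ ∈ I, 0 ≤ σ * t₁ → σ * t₁ ≤ σ * t₂ →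
        eLpNorm (fun ξ => CSS.profile t₂ (φ t₂) ξ - CSS.profile t₁ (φ t₁) ξ) ∞ volume
          ≤ ENNReal.ofReal (C * B ^ 3 * ε ^ 3 * (1 + |t₁|) ^ (-(1 / 10) : ℝ))) ∧
      ((∀ t : ℝ, 0 ≤ σ * t → t ∈ I) →
        ∃ F : CSS.Plane → ℂ, MemLp F ∞ volume ∧
          (∀ t : ℝ, 0 ≤ σ * t →
            eLpNorm (fun ξ => CSS.profile t (φ t) ξ - F ξ) ∞ volume
              ≤ ENNReal.ofReal (C * B ^ 3 * ε ^ 3 * (1 + |t|) ^ (-(1 / 10) : ℝ))) ∧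
          Tendsto (fun s : ℝ =>
            eLpNorm (fun ξ => CSS.profile (σ * s) (φ (σ * s)) ξ - F ξ) ∞ volume)
            atTop (𝓝 0))) ∧
    -- boundedness of the Fourier transform, for `B` large and then `ε` small
    (∀ δ : ℝ, 0 < δ → ∃ B₀ : ℝ, 0 < B₀ ∧ ∀ B : ℝ, B₀ ≤ B → ∃ ε₀ : ℝ, 0 < ε₀ ∧
      ∀ (ε : ℝ) (I : Set ℝ) (σ : ℝ) (φ : ℝ → CSS.L2),
        0 < ε → ε ≤ ε₀ → (σ = 1 ∨ σ = -1) → CSS.Assumptions g B ε I σ φ →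
        ∀ t ∈ I, 0 ≤ σ * t →
          eLpNorm (CSS.fourier (φ t)) ∞ volume ≤ ENNReal.ofReal (δ * B * ε)) ∧
    -- the improved decay bound, for `B` large and then `ε` small
    (∃ B₀ : ℝ, 0 < B₀ ∧ ∀ B : ℝ, B₀ ≤ B → ∃ ε₀ : ℝ, 0 < ε₀ ∧
      ∀ (ε : ℝ) (I : Set ℝ) (σ : ℝ) (φ : ℝ → CSS.L2),
        0 < ε → ε ≤ ε₀ → (σ = 1 ∨ σ = -1) → CSS.Assumptions g B ε I σ φ →
        ∀ t ∈ I, 0 ≤ σ * t → CSS.DecayBound (B / 10 * ε) t (φ t)) := by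
  refine ⟨⟨CSS.profConst g, CSS.profConst_pos g, fun B ε I σ φ hB hε hσ h =>
    ⟨fun t₁ ht₁ t₂ ht₂ h0 h12 => h.eLpNorm_profile_sub_le hB hε hσ ht₁ ht₂ h0 h12,
      fun hI => h.exists_profile_limit hB hε hσ hI⟩⟩, fun δ hδ => ?_, CSS.exists_decayBound g⟩
  obtain ⟨B₀, hB₀, hmain⟩ := CSS.exists_ae_fourier_le g hδ
  refine ⟨B₀, hB₀, fun B hB => ?_⟩
  obtain ⟨ε₀, hε₀, hmain⟩ := hmain B hB
  exact ⟨ε₀, hε₀, fun ε I σ φ hε hεε hσ h t ht ht0 =>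
    CSS.eLpNorm_dilation_le (fun ξ => rfl) (hmain ε I σ φ hε hεε hσ h t ht ht0)⟩
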